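/- **Setting.** Let $\mathcal M$ be a smooth Riemannian manifold of dimension $d\ge 1$ with a retraction $\mathrm R:\mathrm T\mathcal M\to\mathcal M$, i.e. a smooth map such that for every $(x,v)\in \mathrm T\mathcal M$ the curve $t\mapsto \mathrm R_x(tv)$ has value $x$ and velocity $v$ at $t=0$. Let $f:\mathcal M\to\mathbb R$ be twice continuously differentiable with $f\ge f_{\rm low}$, and let $\hat f_x=f\circ\mathrm R_x:\mathrm T_x\mathcal M\to\mathbb R$, with Euclidean gradient $\nabla\hat f_x$ and Hessian $\nabla^2\hat f_x$. Let $B_x(a)$ be the closed ball of radius $a$ around $0$ in $\mathrm T_x\mathcal M$. Assume there are $\ell,\hat\rho,b>0$ such that for all $x$ with $\|\mathrm{grad} f(x)\|\le\frac12\ell b$: (1) $\nabla\hat f_x$ is $\ell$-Lipschitz on $B_x(3b)$; (2) $\|\nabla^2\hat f_x(s)-\nabla^2\hat f_x(0)\|\le\hat\rho\|s\|$ for $s\in B_x(3b)$; (3) $\sigma_{\min}(\mathrm{D}\mathrm R_x(s))\ge\frac12$ for $s\in B_x(3b)$; and such that (4) $\hat f_x(s)\le\hat f_x(0)+\langle\nabla\hat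 f_x(0),s\rangle+\frac\ell2\|s\|^2$ for all $(x,s)\in \mathrm T\mathcal M$. Let $\epsilon>0$ satisfy $\sqrt{\hat\rho\epsilon}\le\frac12\ell$ and $\epsilon\le b^2\hat\rho$. **Parameters.** For $\chi, c>0$ put $\eta=\frac1{4\ell}$, $\kappa=\frac{\ell}{\sqrt{\hat\rho\epsilon}}$, $\theta=\frac1{4\sqrt\kappa}$, $\gamma=\frac{\sqrt{\hat\rho\epsilon}}4$, $s=\frac1{32}\sqrt{\epsilon/\hat\rho}$, $r=\eta\epsilon\chi^{-5}c^{-8}$, $\mathscr T=\sqrt\kappa\,\chi c$, $\mathscr E=\sqrt{\epsilon^3/\hat\rho}\,\chi^{-5}c^{-7}$, $\mathscr M=\frac{\epsilon\sqrt\kappa}{\ell}c^{-1}$. **Algorithms.** $\mathtt{TSS}(x,s_0)$ (perturbed run; the unperturbed run $\mathtt{TSS}(x)$ has $s_0=0$) sets $v_0=0$ and, for $j=0,\dots,\mathscr T-1$: sets $u_j=s_j+(1-\theta_j)v_j$, where $\theta_j=\theta$ if $\|s_j+(1-\theta)v_j\|\le 2b$ and otherwise $\theta_j\in[\theta,1]$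 is such that $\|u_j\|=2b$; if $\hat f_x(s_j)<\hat f_x(u_j)+\langle\nabla\hat f_x(u_j),s_j-u_j\rangle-\frac\gamma2\|s_j-u_j\|^2$, it returns $\mathrm R_x(s_j)$ when $\|v_j\|\ge s$ and otherwise $\mathrm R_x(\dot s)$ with $\dot s$ a minimizer of $\hat f_x$ over $\{s_j,\ s_j\pm s\,v_j/\|v_j\|\}$; else it sets $s_{j+1}=u_j-\eta\nabla\hat f_x(u_j)$, $v_{j+1}=s_{j+1}-s_j$, and returns $\mathrm R_x(s_{j+1})$ if $\|s_{j+1}\|>b$ or (in an unperturbed run) $\|\nabla\hat f_x(s_{j+1})\|\le\epsilon/2$. After the last iteration it returns $\mathrm R_x(s_{\mathscr T})$. $\mathtt{PTAGD}(x_0)$ starts with $t=0$ and repeats: if $\|\mathrm{grad}f(x_t)\|>2\ell\mathscr M$, set $x_{t+1}=\mathrm R_{x_t}(-\eta\,\mathrm{grad}f(x_t))$ and increase $t$ by $1$; else if $\|\mathrm{grad}f(x_t)\|>\epsilon$, set $x_{t+\mathscr T}=\mathtt{TSS}(x_t)$ and increase $t$ by $\mathscr T$; else draw $\xi$ uniformly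 from $B_{x_t}(r)$ (independently of the past given $x_t$), set $x_{t+\mathscr T}=\mathtt{TSS}(x_t,\xi)$, return $x_t$ if $f(x_t)-f(x_{t+\mathscr T})<\frac12\mathscr E$, and otherwise increase $t$ by $\mathscr T$. **Theorem.** There is a universal constant $c_0>0$ such that the following holds in every such setting and for every $c\ge c_0$. Let $x_0\in\mathcal M$, $\delta\in(0,1)$, $\Delta_f\ge\max\big(f(x_0)-f_{\rm low},\sqrt{\epsilon^3/\hat\rho}\big)$, and let $\chi$ satisfy $$\chi\ \ge\ \max\left(\log_2\frac{d^{1/2}\ell^{3/2}\Delta_f}{(\hat\rho\epsilon)^{1/4}\epsilon^2\delta},\ \log_2(\theta^{-1})\right),\qquad \mathscr T=\sqrt\kappa\,\chi c\ \text{ a positive integer multiple of } 4 .$$ Put $T_2=\big(2+4\frac{f(x_0)-f_{\rm low}}{\mathscr E}\big)\mathscr T$. Then, for every realization of the perturbations, $\mathtt{PTAGD}(x_0)$ terminates and returns a point $x_t$ with $f(x_t)\le f(x_0)$, $\|\mathrm{grad}f(x_t)\|\le\epsilon$ and $t+\mathscr T\le T_2$, using at most $2T_2$ gradient queries and $4T_2$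 function queries, no Hessian queries, and at most $6T_2$ calls to the retraction (one call being charged for each query of $\hat f_x$ or $\nabla\hat f_x$ and for each new iterate). With probability at least $1-2\delta$, the returned point also satisfies $\lambda_{\min}(\nabla^2\hat f_{x_t}(0))\ge-\sqrt{\hat\rho\epsilon}$. -/

import Mathlib

open scoped Manifold ContDiff ENNReal InnerProductSpace Gradient
open Bundle

noncomputable section

namespace PTAGD

/-! ### Parameters -/

/-- The constants from which all parameters of the algorithm are computed:
the tolerance `ε`, the regularity constants `ℓ`, `ρ` (written `ρ̂` in print) and `b`,
the logarithmic factor `χ` and the universal constant `c`. -/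
structure Params where
  ε : ℝ
  ℓ : ℝ
  ρ : ℝ
  b : ℝ
  χ : ℝ
  c : ℝ

namespace Params

variable (p : Params)

/-- Step size `η = 1 / (4 ℓ)`. -/
def η : ℝ := 1 / (4 * p.ℓ)

/-- `κ = ℓ / √(ρ ε)`. -/
def κ : ℝ := p.ℓ / √(p.ρ * p.ε)

/-- Momentum parameter `θ = 1 / (4 √κ)`. -/
def θ : ℝ := 1 / (4 * √p.κ)

/-- `γ = √(ρ ε) / 4`. -/
def γ : ℝ := √(p.ρ * p.ε) / 4

/-- `s = (1/32) √(ε / ρ)`. -/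
def s : ℝ := 1 / 32 * √(p.ε / p.ρ)

/-- Perturbation radius `r = η ε χ⁻⁵ c⁻⁸`. -/
def r : ℝ := p.η * p.ε * p.χ ^ (-5 : ℤ) * p.c ^ (-8 : ℤ)

/-- `𝒯 = √κ χ c`, as a real number. -/
def T : ℝ := √p.κ * p.χ * p.c

/-- `𝒯` as a number of iterations. It is only used when `𝒯` is a positive integer. -/
def steps : ℕ := ⌊p.T⌋₊

/-- `ℰ = √(ε³ / ρ) χ⁻⁵ c⁻⁷`. -/
def E : ℝ := √(p.ε ^ 3 / p.ρ) * p.χ ^ (-5 : ℤ) * p.c ^ (-7 : ℤ)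

/-- `ℳ = (ε √κ / ℓ) c⁻¹`. -/
def M : ℝ := p.ε * √p.κ / p.ℓ * p.c⁻¹

end Params

/-! ### Counting oracle queries -/

/-- Numbers of gradient queries, function-value queries and calls to the retraction. -/
structure Cost where
  grad : ℕ
  fn : ℕ
  retr : ℕ

instance : Zero Cost := ⟨⟨0, 0, 0⟩⟩

instance : Add Cost := ⟨fun k k' => ⟨k.grad + k'.grad, k.fn + k'.fn, k.retr + k'.retr⟩⟩

/-- Evaluating `∇ f̂_x` at a tangent vector: one gradient query; moving to the corresponding point
of the manifold is charged as one call to the retraction. -/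
def Cost.pullbackGrad : Cost := ⟨1, 0, 1⟩

/-- Evaluating `f̂_x` at a tangent vector: one function query and one call to the retraction. -/
def Cost.pullbackFn : Cost := ⟨0, 1, 1⟩

/-- Evaluating `grad f(x)` at a point of the manifold. -/
def Cost.gradAt : Cost := ⟨1, 0, 0⟩

/-- Evaluating `f(x)` at a point of the manifold. -/
def Cost.fnAt : Cost := ⟨0, 1, 0⟩

/-- One call to the retraction. -/
def Cost.retraction : Cost := ⟨0, 0, 1⟩

/-! ### Steps in one tangent space

In this section `V` is a tangent space with its inner product and `g : V → ℝ` is the pullback of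
the cost function to it. -/

section TangentSteps

variable {V : Type*} [NormedAddCommGroup V] [InnerProductSpace ℝ V] [FiniteDimensional ℝ V]

/-- The Euclidean gradient of `g` at `u`. -/
def euclGrad (g : V → ℝ) (u : V) : V :=
  haveI : CompleteSpace V := FiniteDimensional.complete ℝ V
  ∇ g u

/-- The Euclidean Hessian of `g` at `u`, as a linear operator. -/
def euclHess (g : V → ℝ) (u : V) : V →L[ℝ] V :=
  fderiv ℝ (euclGrad g) u

/-- The capped momentum parameter `θ_j` for the iterate `s` and the momentum `v`: it is `θ` if
`‖s + (1 - θ) v‖ ≤ 2b`, and otherwise it is the `θ' ∈ [θ, 1]` with `‖s + (1 - θ') v‖ = 2b`.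
When `‖s‖ ≤ b`, as is the case whenever the algorithm evaluates this, that `θ'` exists and is
unique, so that the infimum below just names it. -/
def cappedTheta (p : Params) (s v : V) : ℝ :=
  if ‖s + (1 - p.θ) • v‖ ≤ 2 * p.b then p.θ
  else sInf {θ' : ℝ | θ' ∈ Set.Icc p.θ 1 ∧ ‖s + (1 - θ') • v‖ = 2 * p.b}

/-- The negative curvature condition at the pair `(s, u)`. -/
def NCC (p : Params) (g : V → ℝ) (s u : V) : Prop :=
  g s < g u + ⟪euclGrad g u, s - u⟫_ℝ - p.γ / 2 * ‖s - u‖ ^ 2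

/-- Negative curvature exploitation. Returns a tangent vector and the cost of finding it; ties in
the `argmin` over `{s, s + v', s - v'}` are broken in that order. -/
def nce (p : Params) (g : V → ℝ) (s v : V) : V × Cost :=
  if p.s ≤ ‖v‖ then (s, 0)
  else
    let v' : V := (p.s / ‖v‖) • v
    let best : V :=
      if g s ≤ g (s + v') ∧ g s ≤ g (s - v') then s
      else if g (s + v') ≤ g (s - v') then s + v'
      else s - v'
    (best, Cost.pullbackFn + Cost.pullbackFn + Cost.pullbackFn)

open Classical in
/-- The loop of the tangent space steps algorithm, with `n` iterations still to run, current
iterate `s` and current momentum `v`. Returns the tangent vector to be retracted and the cost of the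
iterations. -/
def tssLoop (p : Params) (g : V → ℝ) (perturbed : Bool) : ℕ → V → V → V × Cost
  | 0, s, _ => (s, 0)
  | n + 1, s, v =>
    let u : V := s + (1 - cappedTheta p s v) • v
    -- the negative curvature condition needs `g s`, `g u` and the gradient of `g` at `u`
    let k₁ : Cost := Cost.pullbackFn + Cost.pullbackFn + Cost.pullbackGrad
    if NCC p g s u then
      let o := nce p g s v
      (o.1, k₁ + o.2)
    else
      let s' : V := u - p.η • euclGrad g u
      let v' : V := s' - s
      -- the gradient at the new iterate is only needed in unperturbed runs
      let k₂ : Cost := if perturbed then k₁ else k₁ + Cost.pullbackGrad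
      if p.b < ‖s'‖ ∨ (perturbed = false ∧ ‖euclGrad g s'‖ ≤ p.ε / 2) then (s', k₂)
      else
        let o := tssLoop p g perturbed n s' v'
        (o.1, k₂ + o.2)

/-- The tangent space steps algorithm, up to the final retraction. The start is `none` if no initial
vector is provided (then it is the origin), and `some ξ` for a perturbed run from `ξ`. -/
def tss (p : Params) (g : V → ℝ) (start : Option V) : V × Cost :=
  match start with
  | none => tssLoop p g false p.steps 0 0
  | some ξ => tssLoop p g true p.steps ξ 0

/-- The expectation of `φ ξ` for `ξ` uniformly distributed in the closed ball of radius `r`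
around the origin of `V`, with respect to the Lebesgue measure given by the inner product. -/
def uniformBallExpectation (r : ℝ) (φ : V → ℝ≥0∞) : ℝ≥0∞ :=
  letI : MeasurableSpace V := borel V
  haveI : BorelSpace V := ⟨rfl⟩
  ⨍⁻ ξ in Metric.closedBall (0 : V) r, φ ξ ∂MeasureTheory.volume

end TangentSteps

/-! ### The algorithm on a Riemannian manifold -/

section Manifold

variable {d : ℕ} {M : Type*} [TopologicalSpace M] [ChartedSpace (EuclideanSpace ℝ (Fin d)) M]

instance instFiniteDimensionalTangentSpace
    [RiemannianBundle (fun x : M => TangentSpace (𝓡 d) x)] (x : M) :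
    FiniteDimensional ℝ (TangentSpace (𝓡 d) x) :=
  inferInstanceAs (FiniteDimensional ℝ (EuclideanSpace ℝ (Fin d)))

/-- A retraction defined on the whole tangent bundle: a smooth map `R : TM → M` such that each
curve `t ↦ R(x, t v)` passes through `x` with velocity `v` at time `0`. -/
structure IsRetraction [IsManifold (𝓡 d) ∞ M] (R : TangentBundle (𝓡 d) M → M) : Prop where
  smooth : ContMDiff (𝓡 d).tangent (𝓡 d) ∞ R
  base : ∀ x : M, R ⟨x, 0⟩ = x
  velocity : ∀ (x : M) (v : TangentSpace (𝓡 d) x),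
    mfderiv 𝓘(ℝ, ℝ) (𝓡 d) (fun t : ℝ => R ⟨x, t • v⟩) 0 (1 : ℝ) = v

/-- The pullback `f̂_x = f ∘ R_x` of `f` to the tangent space at `x`. -/
def pullback (f : M → ℝ) (R : TangentBundle (𝓡 d) M → M) (x : M) : TangentSpace (𝓡 d) x → ℝ :=
  fun v => f (R ⟨x, v⟩)

variable [RiemannianBundle (fun x : M => TangentSpace (𝓡 d) x)]

variable (d) in
/-- The Riemannian gradient: the tangent vector representing the differential of `f` at `x`. -/
def riemGrad (f : M → ℝ) (x : M) : TangentSpace (𝓡 d) x :=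
  haveI : CompleteSpace (TangentSpace (𝓡 d) x) := FiniteDimensional.complete ℝ _
  (InnerProductSpace.toDual ℝ (TangentSpace (𝓡 d) x)).symm (mfderiv (𝓡 d) 𝓘(ℝ, ℝ) f x)

/-- The regularity assumption on `f` and its pullbacks, with constants `flow`, `ℓ`, `ρ`, `b`. -/
structure RegularPullbacks (f : M → ℝ) (R : TangentBundle (𝓡 d) M → M) (flow ℓ ρ b : ℝ) :
    Prop where
  lower_bound : ∀ x, flow ≤ f x
  contMDiff : ContMDiff (𝓡 d) 𝓘(ℝ, ℝ) 2 f
  grad_lipschitz : ∀ x, ‖riemGrad d f x‖ ≤ 1 / 2 * ℓ * b →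
    ∀ s ∈ Metric.closedBall (0 : TangentSpace (𝓡 d) x) (3 * b),
    ∀ s' ∈ Metric.closedBall (0 : TangentSpace (𝓡 d) x) (3 * b),
      ‖euclGrad (pullback f R x) s - euclGrad (pullback f R x) s'‖ ≤ ℓ * ‖s - s'‖
  hess_lipschitz : ∀ x, ‖riemGrad d f x‖ ≤ 1 / 2 * ℓ * b →
    ∀ s ∈ Metric.closedBall (0 : TangentSpace (𝓡 d) x) (3 * b),
      ‖euclHess (pullback f R x) s - euclHess (pullback f R x) 0‖ ≤ ρ * ‖s‖
  /-- The smallest singular value of the differential of `R_x` at `s` is at least `1/2`. -/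
  sigma_min : ∀ x, ‖riemGrad d f x‖ ≤ 1 / 2 * ℓ * b →
    ∀ s ∈ Metric.closedBall (0 : TangentSpace (𝓡 d) x) (3 * b), ∀ v : TangentSpace (𝓡 d) x,
      1 / 2 * ‖v‖ ≤
        ‖mfderiv 𝓘(ℝ, TangentSpace (𝓡 d) x) (𝓡 d)
          (fun w : TangentSpace (𝓡 d) x => R ⟨x, w⟩) s v‖
  upper_bound : ∀ (x : M) (s : TangentSpace (𝓡 d) x),
    pullback f R x s ≤
      pullback f R x 0 + ⟪euclGrad (pullback f R x) 0, s⟫_ℝ + ℓ / 2 * ‖s‖ ^ 2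

/-- State of the main loop: current point `x_t`, counter `t`, and the queries made so far. -/
structure State (M : Type*) where
  pt : M
  t : ℕ
  cost : Cost

/-- Result of one pass through the main loop: either the loop goes on from a new state, or the
algorithm returns the point `x_t`; then the recorded counter is that `t`, and the recorded cost
includes the last pass. -/
inductive Outcome (M : Type*) where
  | next (st : State M)
  | halt (st : State M)

/-- The state at the start of the algorithm. -/
def State.init (x₀ : M) : State M := ⟨x₀, 0, 0⟩

/-- One pass through the main loop of the perturbed tangent accelerated gradient descent
algorithm, where `ξ` is the value that the random perturbation takes if it is used. -/
def step (p : Params) (f : M → ℝ) (R : TangentBundle (𝓡 d) M → M) (st : State M)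
    (ξ : TangentSpace (𝓡 d) st.pt) : Outcome M :=
  let x := st.pt
  let G := riemGrad d f x
  let k := st.cost + Cost.gradAt
  if 2 * p.ℓ * p.M < ‖G‖ then
    .next ⟨R ⟨x, -(p.η • G)⟩, st.t + 1, k + Cost.retraction⟩
  else if p.ε < ‖G‖ then
    let o := tss p (pullback f R x) none
    .next ⟨R ⟨x, o.1⟩, st.t + p.steps, k + o.2 + Cost.retraction⟩
  else
    let o := tss p (pullback f R x) (some ξ)
    let y := R ⟨x, o.1⟩
    let k' := k + o.2 + Cost.retraction + Cost.fnAt + Cost.fnAt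
    if f x - f y < 1 / 2 * p.E then .halt ⟨x, st.t, k'⟩
    else .next ⟨y, st.t + p.steps, k'⟩

/-- The run of the algorithm from `x₀` for a given realization `pert` of the perturbations (`pert n x` is
the perturbation drawn in pass `n` if the current point is `x`): the outcome after `n` passes. -/
def run (p : Params) (f : M → ℝ) (R : TangentBundle (𝓡 d) M → M) (x₀ : M)
    (pert : ℕ → (x : M) → TangentSpace (𝓡 d) x) : ℕ → Outcome M
  | 0 => .next (.init x₀)
  | n + 1 =>
    match run p f R x₀ pert n with
    | .halt st => .halt st
    | .next st => step p f R st (pert n st.pt)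

open Classical in
/-- The probability that the algorithm, started in the state `st`, returns within `n` passes and
that the final state satisfies `Q`, when each pass draws, given everything that happened before,
its perturbation uniformly from the closed ball of radius `r` in the current tangent space.

The recursion conditions on the perturbation of the first pass, so that `n` passes give an `n`-fold
iterated integral of the indicator of the event. The integral in use is a lower integral: should an
integrand fail to be measurable, the value could only be too small. -/
def returnProb (p : Params) (f : M → ℝ) (R : TangentBundle (𝓡 d) M → M) (Q : State M → Prop) :
    ℕ → State M → ℝ≥0∞
  | 0, _ => 0
  | n + 1, st =>
    uniformBallExpectation p.r fun ξ : TangentSpace (𝓡 d) st.pt =>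
      match step p f R st ξ with
      | .halt st' => if Q st' then 1 else 0
      | .next st' => returnProb p f R Q n st'

/-- The probability that the run from `x₀` ever returns, in a final state satisfying `Q`:
the limit of a non-decreasing sequence. -/
def successProb (p : Params) (f : M → ℝ) (R : TangentBundle (𝓡 d) M → M) (Q : State M → Prop)
    (x₀ : M) : ℝ≥0∞ :=
  ⨆ n : ℕ, returnProb p f R Q n (.init x₀)

/-- `T₂ = (2 + 4 (f(x₀) - flow) / ℰ) 𝒯`. -/
def T₂ (p : Params) (f : M → ℝ) (flow : ℝ) (x₀ : M) : ℝ :=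
  (2 + 4 * ((f x₀ - flow) / p.E)) * p.T

variable (d) in
/-- What holds surely of the final state: the returned point does not increase `f`, is approximately
first-order critical, and the counter and the numbers of queries are bounded. -/
structure IsFirstOrderOutput (p : Params) (f : M → ℝ) (flow : ℝ) (x₀ : M) (st : State M) :
    Prop where
  value : f st.pt ≤ f x₀
  grad : ‖riemGrad d f st.pt‖ ≤ p.ε
  counter : (st.t : ℝ) + p.T ≤ T₂ p f flow x₀
  gradQueries : (st.cost.grad : ℝ) ≤ 2 * T₂ p f flow x₀
  fnQueries : (st.cost.fn : ℝ) ≤ 4 * T₂ p f flow x₀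
  retractions : (st.cost.retr : ℝ) ≤ 6 * T₂ p f flow x₀

/-- All eigenvalues of the Hessian of the pullback at the origin of the tangent space at the final
point, hence the smallest one, are at least `-√(ρ ε)`. -/
def IsSecondOrderOutput (p : Params) (f : M → ℝ) (R : TangentBundle (𝓡 d) M → M)
    (st : State M) : Prop :=
  ∀ μ : ℝ, Module.End.HasEigenvalue
      (euclHess (pullback f R st.pt) 0 :
        TangentSpace (𝓡 d) st.pt →ₗ[ℝ] TangentSpace (𝓡 d) st.pt) μ →
    -√(p.ρ * p.ε) ≤ μ

end Manifold

end PTAGD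

end

/-! Every pass through the main loop gains a definite decrease or prepares the next pass. If the
gradient is large, one gradient step already gains `E`. For the accelerated passes, the Hamiltonian
`energy` (cost plus kinetic energy) drops at each step at which the negative curvature condition
fails, and the drop controls the squared step length (`sq_norm_agdStep_le`). If the condition holds,
either the kinetic energy is discarded or a direction of negative curvature is exploited. Hence a
pass gains `E`, stops early at a small gradient, or is localized: it runs to completion within the
small radius `loc` of its start, where the Hessian is almost constant (`tssLoop_cases`).

Localized unperturbed runs are read in an eigenbasis of the Hessian at the origin, where each
gradient component obeys a two-term linear recursion with small forcing. Modes with `λ ≥ σ`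
contract. Modes with `λ ≤ -σ` split into a stable coordinate, which decays from the start, and an
unstable one, which is controlled backwards from the end because the run stays bounded. Both are
exponentially small at the midpoint. In the remaining, nearly flat modes, the average gradient
telescopes to something small. So the midpoint gradient has norm at most `ε / 2`
(`SlowRun.norm_grad_le`), and the run would have stopped there. An unperturbed pass therefore gains
`E` or ends at a point of gradient norm at most `ε`, from which the next pass is perturbed.

For perturbed runs at a point with an eigenvalue below `-σ`, two localized runs whose starts differ
by `t` along the most unstable eigenvector separate at least like `(1 + θ) ^ steps`
(`growth_of_slowRuns`), which is impossible for `t ≥ sep`. The perturbations leading to too little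
decrease thus form a set that is thin in one direction, and disjoint translates bound its volume
(`volume_le_of_thin`). The logarithmic factor `χ` makes its proportion in the ball at most `2 δ E /
(3 Δ)` (`failure_le`).

The counters follow from charging every pass to the decrease of `f` (`Invariant`, `remaining`). For
the probability, each perturbed pass that does not return lowers `f` by `E / 2`, so there are at
most `1 + 2 (f x₀ - flow) / E ≤ 3 Δ / E` occasions to fail (`le_returnProb`), and their sum is at
most `2 δ`. -/

noncomputable section

namespace PTAGD

/-! ### Differentials and gradients of pullbacks along the retraction. -/

section Pullback

variable {d : ℕ} {M : Type*} [TopologicalSpace M] [ChartedSpace (EuclideanSpace ℝ (Fin d)) M]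
  {f : M → ℝ}

theorem inner_euclGrad {V : Type*} [NormedAddCommGroup V] [InnerProductSpace ℝ V]
    [FiniteDimensional ℝ V] (g : V → ℝ) (s v : V) :
    ⟪euclGrad g s, v⟫_ℝ = fderiv ℝ g s v := by
  have : CompleteSpace V := FiniteDimensional.complete ℝ V
  simp [euclGrad, gradient]

/-- The chain rule along a line through the origin. Both sides are read in the model space because
the tangent spaces at `φ (0 • v)` and `φ 0` are different types. -/
theorem mfderiv_comp_smul {V : Type*} [NormedAddCommGroup V] [NormedSpace ℝ V]
    {φ : V → M} (hφ : ContMDiff 𝓘(ℝ, V) (𝓡 d) ∞ φ) (v : V) :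
    (mfderiv 𝓘(ℝ, ℝ) (𝓡 d) (fun t : ℝ => φ (t • v)) 0 (1 : ℝ) : EuclideanSpace ℝ (Fin d)) =
      mfderiv 𝓘(ℝ, V) (𝓡 d) φ 0 v := by
  have h2 : MDifferentiableAt 𝓘(ℝ, V) (𝓡 d) φ ((0 : ℝ) • v) :=
    (hφ _).mdifferentiableAt (by simp)
  have h1 : HasFDerivAt (fun t : ℝ => t • v) (ContinuousLinearMap.toSpanSingleton ℝ v) (0 : ℝ) :=
    (ContinuousLinearMap.toSpanSingleton ℝ v).hasFDerivAt (x := (0 : ℝ))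
  have h3 := mfderiv_comp (0 : ℝ) h2 h1.differentiableAt.mdifferentiableAt
  rw [mfderiv_eq_fderiv, h1.fderiv] at h3
  have h6 := congrArg (fun L => L (1 : ℝ)) h3
  refine h6.trans ?_
  have h7 : (ContinuousLinearMap.toSpanSingleton ℝ v) (1 : ℝ) = v := by simp
  change (mfderiv 𝓘(ℝ, V) (𝓡 d) φ ((0 : ℝ) • v)) ((ContinuousLinearMap.toSpanSingleton ℝ v) (1 : ℝ)) = _
  rw [h7]
  congr 2
  simp

variable [RiemannianBundle (fun x : M => TangentSpace (𝓡 d) x)]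

theorem inner_riemGrad (x : M) (v : TangentSpace (𝓡 d) x) :
    ⟪riemGrad d f x, v⟫_ℝ = mfderiv (𝓡 d) 𝓘(ℝ, ℝ) f x v := by
  have : CompleteSpace (TangentSpace (𝓡 d) x) := FiniteDimensional.complete ℝ _
  exact InnerProductSpace.toDual_symm_apply

theorem inner_euclGrad_comp {V : Type*} [NormedAddCommGroup V] [InnerProductSpace ℝ V]
    [FiniteDimensional ℝ V] (hf : ContMDiff (𝓡 d) 𝓘(ℝ, ℝ) 2 f) {φ : V → M}
    (hφ : ContMDiff 𝓘(ℝ, V) (𝓡 d) ∞ φ) (s v : V) :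
    ⟪euclGrad (fun w => f (φ w)) s, v⟫_ℝ =
      ⟪riemGrad d f (φ s), mfderiv 𝓘(ℝ, V) (𝓡 d) φ s v⟫_ℝ := by
  rw [inner_riemGrad, inner_euclGrad]
  have h1 : MDifferentiableAt (𝓡 d) 𝓘(ℝ, ℝ) f (φ s) := (hf _).mdifferentiableAt (by norm_num)
  have h2 : MDifferentiableAt 𝓘(ℝ, V) (𝓡 d) φ s := (hφ s).mdifferentiableAt (by simp)
  rw [← mfderiv_eq_fderiv]
  exact congrArg (fun L => L v) (mfderiv_comp s h1 h2)

/-- The singular value bound makes the differential injective, hence surjective by equality of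
dimensions. Writing the Riemannian gradient as the image of `v` and pairing it with itself gives its
squared norm as the pullback gradient tested on `v`, while `‖v‖` is at most twice its norm. -/
theorem norm_riemGrad_le_of_norm_mfderiv {V : Type*} [NormedAddCommGroup V]
    [InnerProductSpace ℝ V] [FiniteDimensional ℝ V] (hV : Module.finrank ℝ V = d)
    (hf : ContMDiff (𝓡 d) 𝓘(ℝ, ℝ) 2 f) {φ : V → M}
    (hφ : ContMDiff 𝓘(ℝ, V) (𝓡 d) ∞ φ) (s : V)
    (hσ : ∀ v : V, 1 / 2 * ‖v‖ ≤ ‖(mfderiv 𝓘(ℝ, V) (𝓡 d) φ s v : TangentSpace (𝓡 d) (φ s))‖) :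
    ‖riemGrad d f (φ s)‖ ≤ 2 * ‖euclGrad (fun w => f (φ w)) s‖ := by
  let A : V →ₗ[ℝ] TangentSpace (𝓡 d) (φ s) := (mfderiv 𝓘(ℝ, V) (𝓡 d) φ s).toLinearMap
  have hσ' : ∀ v : V, 1 / 2 * ‖v‖ ≤ ‖A v‖ := hσ
  have hinj : Function.Injective A := by
    rw [injective_iff_map_eq_zero]
    intro v hv
    have := hσ' v
    rw [hv, norm_zero] at this
    exact norm_le_zero_iff.1 (by linarith)
  have hd : Module.finrank ℝ (TangentSpace (𝓡 d) (φ s)) = d :=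
    finrank_euclideanSpace_fin (𝕜 := ℝ) (n := d)
  have hsurj : Function.Surjective A :=
    (LinearMap.injective_iff_surjective_of_finrank_eq_finrank (f := A) (hV.trans hd.symm)).1 hinj
  obtain ⟨v, hv⟩ := hsurj (riemGrad d f (φ s))
  have h1 : ⟪euclGrad (fun w => f (φ w)) s, v⟫_ℝ = ⟪riemGrad d f (φ s), A v⟫_ℝ :=
    inner_euclGrad_comp hf hφ s v
  rw [hv, real_inner_self_eq_norm_sq] at h1
  have h2 := real_inner_le_norm (euclGrad (fun w => f (φ w)) s) v
  have h3 := hσ' v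
  rw [hv] at h3
  by_contra hcon
  push Not at hcon
  have h4 : 0 < ‖riemGrad d f (φ s)‖ := lt_of_le_of_lt (by positivity) hcon
  nlinarith [norm_nonneg (euclGrad (fun w => f (φ w)) s), norm_nonneg v]

variable [IsManifold (𝓡 d) ∞ M] {R : TangentBundle (𝓡 d) M → M}

/-- In the trivialization at `x` the fibre coordinate of this map is continuous linear and the base
coordinate is constant. -/
theorem contMDiff_tangentSpace_mk (x : M) :
    ContMDiff 𝓘(ℝ, TangentSpace (𝓡 d) x) (𝓡 d).tangent ∞
      (fun v : TangentSpace (𝓡 d) x => (⟨x, v⟩ : TangentBundle (𝓡 d) M)) := by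
  have : Fact (1 ≤ (∞ : WithTop ℕ∞)) := ⟨by norm_num⟩
  intro v
  rw [contMDiffAt_totalSpace]
  refine ⟨contMDiffAt_const, ?_⟩
  have hx : x ∈ (trivializationAt (EuclideanSpace ℝ (Fin d)) (TangentSpace (𝓡 d)) x).baseSet :=
    FiberBundle.mem_baseSet_trivializationAt' x
  let L : TangentSpace (𝓡 d) x →L[ℝ] EuclideanSpace ℝ (Fin d) :=
    (trivializationAt (EuclideanSpace ℝ (Fin d)) (TangentSpace (𝓡 d)) x).continuousLinearMapAt ℝ x
  have hL : ContMDiff 𝓘(ℝ, TangentSpace (𝓡 d) x) 𝓘(ℝ, EuclideanSpace ℝ (Fin d)) ∞ L :=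
    L.contMDiff
  refine (hL v).congr_of_eventuallyEq (Filter.Eventually.of_forall fun w => ?_)
  simp only [L]
  rw [Trivialization.continuousLinearMapAt_apply, Trivialization.coe_linearMapAt_of_mem _ hx]

theorem IsRetraction.contMDiff_fiber (hR : IsRetraction R) (x : M) :
    ContMDiff 𝓘(ℝ, TangentSpace (𝓡 d) x) (𝓡 d) ∞
      (fun v : TangentSpace (𝓡 d) x => R ⟨x, v⟩) :=
  hR.smooth.comp (contMDiff_tangentSpace_mk x)

theorem IsRetraction.contDiff_pullback (hR : IsRetraction R)
    (hf : ContMDiff (𝓡 d) 𝓘(ℝ, ℝ) 2 f) (x : M) : ContDiff ℝ 2 (pullback f R x) := by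
  rw [← contMDiff_iff_contDiff]
  exact hf.comp ((hR.contMDiff_fiber x).of_le (by norm_cast))

/-- The velocity condition says that the differential of `R_x` at the origin is the identity. -/
theorem IsRetraction.euclGrad_pullback_zero (hR : IsRetraction R)
    (hf : ContMDiff (𝓡 d) 𝓘(ℝ, ℝ) 2 f) (x : M) :
    euclGrad (pullback f R x) 0 = riemGrad d f x := by
  refine ext_inner_right ℝ fun v => ?_
  refine (inner_euclGrad_comp hf (hR.contMDiff_fiber x) 0 v).trans ?_
  rw [inner_riemGrad, inner_riemGrad]
  have h1 := mfderiv_comp_smul (hR.contMDiff_fiber x) v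
  have h2 := hR.velocity x v
  have h3 : (mfderiv 𝓘(ℝ, TangentSpace (𝓡 d) x) (𝓡 d)
      (fun w : TangentSpace (𝓡 d) x => R ⟨x, w⟩) 0 v : EuclideanSpace ℝ (Fin d)) = v :=
    h1.symm.trans h2
  -- The base points `R ⟨x, 0⟩` and `x` are equal only propositionally, so the differential of `f`
  -- is transported by substituting a variable point.
  have h4 : ∀ (y : M) (_ : y = x) (a : EuclideanSpace ℝ (Fin d)),
      (mfderiv (𝓡 d) 𝓘(ℝ, ℝ) f y : EuclideanSpace ℝ (Fin d) → ℝ) a =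
        (mfderiv (𝓡 d) 𝓘(ℝ, ℝ) f x : EuclideanSpace ℝ (Fin d) → ℝ) a := by
    rintro y rfl a; rfl
  refine (h4 _ (hR.base x) _).trans ?_
  exact congrArg (mfderiv (𝓡 d) 𝓘(ℝ, ℝ) f x : EuclideanSpace ℝ (Fin d) → ℝ) h3

theorem IsRetraction.norm_riemGrad_le (hR : IsRetraction R)
    (hf : ContMDiff (𝓡 d) 𝓘(ℝ, ℝ) 2 f) (x : M) (s : TangentSpace (𝓡 d) x)
    (hσ : ∀ v : TangentSpace (𝓡 d) x, 1 / 2 * ‖v‖ ≤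
        ‖mfderiv 𝓘(ℝ, TangentSpace (𝓡 d) x) (𝓡 d)
          (fun w : TangentSpace (𝓡 d) x => R ⟨x, w⟩) s v‖) :
    ‖riemGrad d f (R ⟨x, s⟩)‖ ≤ 2 * ‖euclGrad (pullback f R x) s‖ :=
  norm_riemGrad_le_of_norm_mfderiv (V := TangentSpace (𝓡 d) x)
    (finrank_euclideanSpace_fin (𝕜 := ℝ) (n := d)) hf
    (hR.contMDiff_fiber x) s hσ

end Pullback

/-! ### Scalar momentum recursions: contraction and the saddle splitting. -/

section ScalarRecursion

theorem add_sq_le_weighted (x y τ : ℝ) (hτ : 0 < τ) :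
    (x + y) ^ 2 ≤ (1 + τ) * x ^ 2 + (1 + 1 / τ) * y ^ 2 := by
  have h : (1 + τ) * x ^ 2 + (1 + 1 / τ) * y ^ 2 - (x + y) ^ 2 = (τ * x - y) ^ 2 / τ := by
    field_simp; ring
  have h2 : 0 ≤ (τ * x - y) ^ 2 / τ := by positivity
  linarith

/-- The quadratic form multiplied by `D` under the companion map `(h, k) ↦ (P h - D k, h)`. -/
def momentumForm (P D h k : ℝ) : ℝ := h ^ 2 - P * h * k + D * k ^ 2

/-- The form factors as `(h - μ k) (h - μ' k)` with the roots of `X² - P X + D`, and the companion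
map multiplies each factor by the other root. The product of the roots is `D`. -/
theorem momentumForm_companion (P D h k : ℝ) :
    momentumForm P D (P * h - D * k) h = D * momentumForm P D h k := by
  unfold momentumForm; ring

/-- A nonpositive discriminant makes the form a sum of two squares, to which Young's inequality
applies separately. -/
theorem momentumForm_add_le {P D : ℝ} (hPD : P ^ 2 ≤ 4 * D) {τ : ℝ} (hτ : 0 < τ)
    (h k h' k' : ℝ) :
    momentumForm P D (h + h') (k + k') ≤
      (1 + τ) * momentumForm P D h k + (1 + 1 / τ) * momentumForm P D h' k' := by
  have e : ∀ x y, momentumForm P D x y = (x - P / 2 * y) ^ 2 + (D - P ^ 2 / 4) * y ^ 2 := by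
    intro x y; unfold momentumForm; ring
  have h1 := add_sq_le_weighted (h - P / 2 * k) (h' - P / 2 * k') τ hτ
  have h2 := mul_le_mul_of_nonneg_left (add_sq_le_weighted k k' τ hτ)
    (show 0 ≤ D - P ^ 2 / 4 by linarith)
  rw [e, e, e]
  have h3 : h + h' - P / 2 * (k + k') = h - P / 2 * k + (h' - P / 2 * k') := by ring
  rw [h3]
  linarith

/-- Discrete Grönwall; since `r ≤ 1`, the powers of `r` in front of the sources are simply dropped.
-/
theorem le_pow_mul_add_sum {q x : ℕ → ℝ} {r : ℝ} (hr : 0 ≤ r) (hr1 : r ≤ 1) {N : ℕ}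
    (hx : ∀ j, 0 ≤ x j) (hq : ∀ j < N, q (j + 1) ≤ r * q j + x j) :
    ∀ j ≤ N, q j ≤ r ^ j * q 0 + ∑ i ∈ Finset.range j, x i := by
  intro j
  induction j with
  | zero => simp
  | succ n ih =>
    intro hn
    have h1 := ih (by omega)
    have h2 := hq n (by omega)
    have h3 := mul_le_mul_of_nonneg_left h1 hr
    have h4 : 0 ≤ ∑ i ∈ Finset.range n, x i := Finset.sum_nonneg fun i _ => hx i
    have h5 := mul_le_of_le_one_left h4 hr1
    rw [Finset.sum_range_succ, pow_succ]
    nlinarith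

variable {θ a : ℝ} {h k d e : ℕ → ℝ} {N : ℕ}

/-- Decay in an oscillating mode of the momentum recursion. -/
theorem sq_le_of_oscillating (hθ : 0 < θ) (hθ' : θ ≤ 1 / 5) (ha : 4 * θ ^ 2 ≤ a)
    (ha' : a ≤ 1 / 4) (hk0 : k 0 = h 0)
    (hh : ∀ j < N, h (j + 1) =
      (1 - a) * ((2 - θ) * h j - (1 - θ) * k j) + d (j + 1) - a * e j)
    (hk : ∀ j < N, k (j + 1) = h j + d (j + 1)) :
    ∀ j ≤ N, h j ^ 2 ≤ 2 * ((1 - θ / 2) ^ j * h 0 ^ 2 +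
      6 / θ * ∑ i ∈ Finset.range j, (d (i + 1) ^ 2 + e i ^ 2)) := by
  set P := (1 - a) * (2 - θ) with hP
  set D := (1 - a) * (1 - θ) with hD
  have hapos : 0 < a := lt_of_lt_of_le (by positivity) ha
  -- The roots are complex, with a margin proportional to `a`: by `4 θ² ≤ a` the term `θ² / 4` costs
  -- at most `a / 16`.
  have hdisc : a / 2 ≤ D - P ^ 2 / 4 := by
    have h1 : D - P ^ 2 / 4 = (1 - a) * ((1 - θ / 2) ^ 2 * a - θ ^ 2 / 4) := by
      rw [hP, hD]; ring
    rw [h1]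
    have h2 : 7 / 10 * a ≤ (1 - θ / 2) ^ 2 * a - θ ^ 2 / 4 := by
      have : (81 / 100 : ℝ) ≤ (1 - θ / 2) ^ 2 := by nlinarith
      nlinarith
    nlinarith
  have hD1 : D ≤ 1 - θ := by rw [hD]; nlinarith
  have hD0 : 0 < D := by nlinarith [sq_nonneg P]
  have hPD : P ^ 2 ≤ 4 * D := by linarith
  -- Since `1 - P + D = a`, the form equals `a x²` on the diagonal `(x, x)`. The start and the
  -- forcing `d` both lie on the diagonal, so dividing by `a` normalizes the start and the forcing
  -- costs no factor `1 / a`.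
  set q : ℕ → ℝ := fun j => momentumForm P D (h j) (k j) / a with hq
  have hQnn : ∀ x y, a / 2 * x ^ 2 ≤ momentumForm P D x y := by
    intro x y
    have e1 : D * momentumForm P D x y = (D * y - P / 2 * x) ^ 2 + (D - P ^ 2 / 4) * x ^ 2 := by
      unfold momentumForm; ring
    have e2 : 0 ≤ momentumForm P D x y := by
      by_contra hcon
      push Not at hcon
      nlinarith [sq_nonneg (D * y - P / 2 * x), sq_nonneg x, mul_pos hapos hD0,
        mul_nonneg hapos.le (sq_nonneg x)]
    nlinarith [sq_nonneg (D * y - P / 2 * x), sq_nonneg x]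
  have hq0 : q 0 = h 0 ^ 2 := by
    simp only [hq, hk0, momentumForm, hP, hD]
    field_simp; ring
  -- The form contracts by `D ≤ 1 - θ`. Young's inequality with weight `θ / 2` gives up half of that
  -- rate to absorb the forcing.
  have hstep : ∀ j < N, q (j + 1) ≤ (1 - θ / 2) * q j + 6 / θ * (d (j + 1) ^ 2 + e j ^ 2) := by
    intro j hj
    have h1 := momentumForm_add_le hPD (τ := θ / 2) (by positivity) (P * h j - D * k j) (h j)
      (d (j + 1) - a * e j) (d (j + 1))
    rw [momentumForm_companion] at h1
    have h2 : momentumForm P D (h (j + 1)) (k (j + 1)) =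
        momentumForm P D (P * h j - D * k j + (d (j + 1) - a * e j)) (h j + d (j + 1)) := by
      rw [hh j hj, hk j hj]; congr 1; rw [hP, hD]; ring
    have h3 : momentumForm P D (d (j + 1) - a * e j) (d (j + 1)) ≤
        2 * a * (d (j + 1) ^ 2 + e j ^ 2) := by
      have e1 := momentumForm_add_le hPD (τ := 1) one_pos (d (j + 1)) (d (j + 1)) (-(a * e j)) 0
      have e2 : momentumForm P D (d (j + 1)) (d (j + 1)) = a * d (j + 1) ^ 2 := by
        unfold momentumForm; rw [hP, hD]; ring
      have e3 : momentumForm P D (-(a * e j)) 0 = a ^ 2 * e j ^ 2 := by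
        unfold momentumForm; ring
      rw [e2, e3] at e1
      have e4 : a ^ 2 * e j ^ 2 ≤ a * e j ^ 2 := by
        have := sq_nonneg (e j)
        nlinarith [mul_nonneg hapos.le this]
      rw [add_zero, ← sub_eq_add_neg] at e1
      linarith
    have h4 : 0 ≤ momentumForm P D (h j) (k j) :=
      le_trans (by positivity) (hQnn (h j) (k j))
    have h5 : (1 + θ / 2) * (D * momentumForm P D (h j) (k j)) ≤
        (1 - θ / 2) * momentumForm P D (h j) (k j) := by
      rw [← mul_assoc]
      exact mul_le_mul_of_nonneg_right (by nlinarith) h4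
    have h6 : (1 + 1 / (θ / 2)) ≤ 3 / θ := by
      rw [show 1 + 1 / (θ / 2) = (θ + 2) / θ by field_simp]
      gcongr; linarith
    have h7 : (1 + 1 / (θ / 2)) * momentumForm P D (d (j + 1) - a * e j) (d (j + 1)) ≤
        3 / θ * (2 * a * (d (j + 1) ^ 2 + e j ^ 2)) :=
      (mul_le_mul_of_nonneg_left h3 (by positivity)).trans
        (mul_le_mul_of_nonneg_right h6 (by positivity))
    have h8 : a * q (j + 1) ≤
        a * ((1 - θ / 2) * q j + 6 / θ * (d (j + 1) ^ 2 + e j ^ 2)) := by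
      have e1 : a * q (j + 1) = momentumForm P D (h (j + 1)) (k (j + 1)) := by
        simp only [hq]; field_simp
      have e2 : a * q j = momentumForm P D (h j) (k j) := by simp only [hq]; field_simp
      rw [e1, h2, mul_add, mul_left_comm a, e2]
      have e3 : a * (6 / θ * (d (j + 1) ^ 2 + e j ^ 2)) =
        3 / θ * (2 * a * (d (j + 1) ^ 2 + e j ^ 2)) := by ring
      rw [e3]
      linarith
    exact le_of_mul_le_mul_left h8 hapos
  intro j hj
  have h1 := le_pow_mul_add_sum (r := 1 - θ / 2) (by linarith) (by linarith)
    (fun j => by positivity) hstep j hj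
  rw [hq0, ← Finset.mul_sum] at h1
  have h2 : h j ^ 2 ≤ 2 * q j := by
    have e2 : a * q j = momentumForm P D (h j) (k j) := by simp only [hq]; field_simp
    have := hQnn (h j) (k j)
    nlinarith
  linarith

/-- The numbers `1 + α` and `1 - β` are the two real roots of the characteristic polynomial `X² - (1
+ A)(2 - θ) X + (1 + A)(1 - θ)` of a saddle mode: `α` is the rate of growth and `β` the rate of
decay. Positivity of the product of the roots gives `β < 1`, and `A ≥ 4 θ²` forces both rates to be
at least `θ`. -/
theorem exists_unstable_rates {A : ℝ} (hθ : 0 < θ) (hθ' : θ ≤ 1 / 5) (hA : 4 * θ ^ 2 ≤ A) :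
    ∃ α β : ℝ, θ ≤ α ∧ θ ≤ β ∧ β < 1 ∧ α * β = A ∧ α - β = -θ + (2 - θ) * A := by
  have hApos : 0 < A := lt_of_lt_of_le (by positivity) hA
  set t := -θ + (2 - θ) * A with ht
  set w := √(t ^ 2 + 4 * A) with hw
  have hw2 : w ^ 2 = t ^ 2 + 4 * A := Real.sq_sqrt (by positivity)
  have hwpos : 0 < w := Real.sqrt_pos.2 (by positivity)
  have habs : |t| < w := abs_lt_of_sq_lt_sq (by linarith) hwpos.le
  obtain ⟨h1, h2⟩ := abs_lt.1 habs
  set α := (t + w) / 2 with hα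
  set β := (w - t) / 2 with hβ
  have hαβ : α * β = A := by rw [hα, hβ]; nlinarith
  have hd : α - β = t := by rw [hα, hβ]; ring
  have hα0 : 0 < α := by rw [hα]; linarith
  have hβ0 : 0 < β := by rw [hβ]; linarith
  refine ⟨α, β, ?_, ?_, ?_, hαβ, hd.trans ht⟩
  · by_contra hcon
    push Not at hcon
    have : β ≤ 2 * θ := by nlinarith
    nlinarith
  · by_contra hcon
    push Not at hcon
    have e1 : α < 2 * A := by nlinarith
    nlinarith
  · have : (1 + α) * (1 - β) = (1 - θ) * (1 + A) := by nlinarith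
    by_contra hcon
    push Not at hcon
    nlinarith

set_option maxHeartbeats 1000000 in
/-- Decay, first forwards and then backwards in time, in a saddle mode of the momentum
recursion. -/
theorem sq_le_of_saddle (hθ : 0 < θ) (hθ' : θ ≤ 1 / 5) (ha : a ≤ -(4 * θ ^ 2))
    (hk0 : k 0 = h 0)
    (hh : ∀ j < N, h (j + 1) =
      (1 - a) * ((2 - θ) * h j - (1 - θ) * k j) + d (j + 1) - a * e j)
    (hk : ∀ j < N, k (j + 1) = h j + d (j + 1)) {j : ℕ} (hj : j ≤ N) :
    h j ^ 2 ≤ 2 * ((1 - θ) ^ j * h 0 ^ 2 + ((1 + θ)⁻¹) ^ (N - j) * (2 / θ ^ 2 *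
      (h N ^ 2 + k N ^ 2)) + 8 / θ * ∑ i ∈ Finset.range N, (d (i + 1) ^ 2 + e i ^ 2)) := by
  obtain ⟨α, β, hα, hβ, hβ1, hαβ, hd⟩ := exists_unstable_rates (A := -a) hθ hθ' (by linarith)
  have hα0 : 0 < α := by linarith
  have hβ0 : 0 < β := by linarith
  have ha2 : a = -(α * β) := by linarith
  have hcoef : ∀ j < N, h (j + 1) = (2 + α - β) * h j - (1 + α) * (1 - β) * k j
      + d (j + 1) + α * β * e j := by
    intro j hj
    have e1 : (1 - a) * (2 - θ) = 2 + α - β := by linarith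
    have e2 : (1 - a) * (1 - θ) = (1 + α) * (1 - β) := by nlinarith
    rw [hh j hj, ← e1, ← e2, ha2]; ring
  -- Coordinates in which the recursion is diagonal: `W` is multiplied by `1 - β`, `Z` by `1 + α`.
  -- The denominators are chosen so that both have absolute value `|h 0|` at the start and the
  -- forcing keeps bounded coefficients.
  set W : ℕ → ℝ := fun j => (h j - (1 + α) * k j) / α with hW
  set Z : ℕ → ℝ := fun j => (h j - (1 - β) * k j) / β with hZ
  have hWs : ∀ j < N, W (j + 1) = (1 - β) * W j + (-d (j + 1) + β * e j) := by
    intro j hj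
    simp only [hW]; rw [hcoef j hj, hk j hj]; field_simp; ring
  have hZs : ∀ j < N, Z (j + 1) = (1 + α) * Z j + (d (j + 1) + α * e j) := by
    intro j hj
    simp only [hZ]; rw [hcoef j hj, hk j hj]; field_simp; ring
  have hW0 : W 0 ^ 2 = h 0 ^ 2 := by simp only [hW, hk0]; field_simp; ring
  have hWq : ∀ j < N, W (j + 1) ^ 2 ≤ (1 - θ) * W j ^ 2 +
      4 / θ * (d (j + 1) ^ 2 + e j ^ 2) := by
    intro j hj
    rw [hWs j hj]
    have e1 := add_sq_le_weighted ((1 - β) * W j) (-d (j + 1) + β * e j) θ hθ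
    have e2 : (-d (j + 1) + β * e j) ^ 2 ≤ 2 * (d (j + 1) ^ 2 + e j ^ 2) := by
      have : (β * e j) ^ 2 ≤ e j ^ 2 := by
        rw [mul_pow]; exact mul_le_of_le_one_left (sq_nonneg _) (by nlinarith)
      nlinarith [sq_nonneg (d (j + 1) + β * e j)]
    have e3 : (1 + θ) * ((1 - β) * W j) ^ 2 ≤ (1 - θ) * W j ^ 2 := by
      rw [mul_pow, ← mul_assoc]
      refine mul_le_mul_of_nonneg_right ?_ (sq_nonneg _)
      have : (1 - β) ^ 2 ≤ (1 - θ) ^ 2 := by nlinarith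
      nlinarith [mul_nonneg hθ.le hθ.le]
    have e4 : (1 + 1 / θ) ≤ 2 / θ := by
      rw [show 1 + 1 / θ = (θ + 1) / θ by field_simp]
      gcongr; linarith
    have e5 : (1 + 1 / θ) * (-d (j + 1) + β * e j) ^ 2 ≤
        2 / θ * (2 * (d (j + 1) ^ 2 + e j ^ 2)) :=
      (mul_le_mul_of_nonneg_left e2 (by positivity)).trans
        (mul_le_mul_of_nonneg_right e4 (by positivity))
    have e6 : 2 / θ * (2 * (d (j + 1) ^ 2 + e j ^ 2)) = 4 / θ * (d (j + 1) ^ 2 + e j ^ 2) := by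
      ring
    linarith
  -- The expanding coordinate is solved for its earlier value: backwards in time it contracts.
  have hZq : ∀ j < N, Z j ^ 2 ≤ (1 + θ)⁻¹ * Z (j + 1) ^ 2 +
      4 / θ * (d (j + 1) ^ 2 + e j ^ 2) := by
    intro j hj
    have e0 : (1 + α) * Z j = Z (j + 1) + -(d (j + 1) + α * e j) := by rw [hZs j hj]; ring
    have e1 := add_sq_le_weighted (Z (j + 1)) (-(d (j + 1) + α * e j)) θ hθ
    rw [← e0] at e1
    have e2 : (-(d (j + 1) + α * e j)) ^ 2 ≤ 2 * (1 + α) ^ 2 * (d (j + 1) ^ 2 + e j ^ 2) := by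
      have f1 : (-(d (j + 1) + α * e j)) ^ 2 + (α * d (j + 1) - e j) ^ 2 =
          (1 + α ^ 2) * (d (j + 1) ^ 2 + e j ^ 2) := by ring
      have f2 : (1 + α ^ 2) * (d (j + 1) ^ 2 + e j ^ 2) ≤
          2 * (1 + α) ^ 2 * (d (j + 1) ^ 2 + e j ^ 2) :=
        mul_le_mul_of_nonneg_right (by nlinarith) (by positivity)
      linarith [sq_nonneg (α * d (j + 1) - e j)]
    have e4 : (1 + 1 / θ) ≤ 2 / θ := by
      rw [show 1 + 1 / θ = (θ + 1) / θ by field_simp]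
      gcongr; linarith
    have e5 : (1 + 1 / θ) * (-(d (j + 1) + α * e j)) ^ 2 ≤
        2 / θ * (2 * (1 + α) ^ 2 * (d (j + 1) ^ 2 + e j ^ 2)) :=
      (mul_le_mul_of_nonneg_left e2 (by positivity)).trans
        (mul_le_mul_of_nonneg_right e4 (by positivity))
    have e6 : (1 + α) ^ 2 * Z j ^ 2 ≤ (1 + α) ^ 2 * ((1 + θ)⁻¹ * Z (j + 1) ^ 2 +
      4 / θ * (d (j + 1) ^ 2 + e j ^ 2)) := by
      have e7 : (1 + θ) * Z (j + 1) ^ 2 ≤ (1 + α) ^ 2 * ((1 + θ)⁻¹ * Z (j + 1) ^ 2) := by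
        rw [← mul_assoc]
        refine mul_le_mul_of_nonneg_right ?_ (sq_nonneg _)
        rw [← div_eq_mul_inv, le_div_iff₀ (by positivity)]
        nlinarith
      have e8 : (1 + α) ^ 2 * (4 / θ * (d (j + 1) ^ 2 + e j ^ 2)) =
        2 / θ * (2 * (1 + α) ^ 2 * (d (j + 1) ^ 2 + e j ^ 2)) := by ring
      rw [mul_add, e8, ← mul_pow]
      linarith
    exact le_of_mul_le_mul_left e6 (by positivity)
  have hsum0 : ∀ i, 0 ≤ 4 / θ * (d (i + 1) ^ 2 + e i ^ 2) := fun i => by positivity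
  have hWj := le_pow_mul_add_sum (q := fun i => W i ^ 2) (r := 1 - θ) (by linarith) (by linarith) hsum0 hWq j hj
  -- Grönwall in reversed time, run from the final index down to `j`.
  have hZj := le_pow_mul_add_sum (N := N) (q := fun i => Z (N - i) ^ 2)
    (x := fun i => 4 / θ * (d (N - 1 - i + 1) ^ 2 + e (N - 1 - i) ^ 2)) (r := (1 + θ)⁻¹)
    (by positivity) (inv_le_one_of_one_le₀ (by linarith)) (fun i => hsum0 _)
    (fun i hi => by
      have := hZq (N - 1 - i) (by omega)
      rw [show N - 1 - i + 1 = N - i by omega] at this ⊢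
      rw [show N - (i + 1) = N - 1 - i by omega]
      exact this) (N - j) (by omega)
  simp only [Nat.sub_zero, show N - (N - j) = j by omega] at hZj
  have hs1 : ∑ i ∈ Finset.range j, 4 / θ * (d (i + 1) ^ 2 + e i ^ 2) ≤
      ∑ i ∈ Finset.range N, 4 / θ * (d (i + 1) ^ 2 + e i ^ 2) :=
    Finset.sum_le_sum_of_subset_of_nonneg (Finset.range_mono hj) fun i _ _ => hsum0 i
  have hs2 : ∑ i ∈ Finset.range (N - j),
      4 / θ * (d (N - 1 - i + 1) ^ 2 + e (N - 1 - i) ^ 2) ≤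
      ∑ i ∈ Finset.range N, 4 / θ * (d (i + 1) ^ 2 + e i ^ 2) := by
    rw [← Finset.sum_range_reflect (fun i => 4 / θ * (d (i + 1) ^ 2 + e i ^ 2)) N]
    exact Finset.sum_le_sum_of_subset_of_nonneg (Finset.range_mono (by omega))
      fun i _ _ => hsum0 _
  have hZN : Z N ^ 2 ≤ 2 / θ ^ 2 * (h N ^ 2 + k N ^ 2) := by
    simp only [hZ]
    rw [div_pow, div_mul_eq_mul_div]
    refine div_le_div₀ (by positivity) ?_ (by positivity) (by gcongr)
    have : ((1 - β) * k N) ^ 2 ≤ k N ^ 2 := by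
      rw [mul_pow]; exact mul_le_of_le_one_left (sq_nonneg _) (by nlinarith)
    nlinarith [sq_nonneg (h N + (1 - β) * k N)]
  have hZN' := mul_le_mul_of_nonneg_left hZN
    (show 0 ≤ ((1 + θ)⁻¹) ^ (N - j) by positivity)
  -- Inverting the change of coordinates: both coefficients of `(α + β) * h j` are at most `α + β`,
  -- so no factor is lost although `α` and `β` may be as small as `θ`.
  have hh2 : h j ^ 2 ≤ 2 * (Z j ^ 2 + W j ^ 2) := by
    have e1 : (α + β) * h j = (β + α * β) * Z j - (α - α * β) * W j := by
      simp only [hZ, hW]; field_simp; ring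
    have e2 : |(α + β) * h j| ≤ (α + β) * (|Z j| + |W j|) := by
      rw [e1]
      refine (abs_sub _ _).trans ?_
      rw [abs_mul, abs_mul, abs_of_nonneg (show 0 ≤ β + α * β by positivity),
        abs_of_nonneg (show 0 ≤ α - α * β by nlinarith)]
      have f1 : α * β ≤ α := by nlinarith
      have f2 := mul_le_mul_of_nonneg_right f1 (abs_nonneg (Z j))
      have f3 : 0 ≤ (α * β + β) * |W j| := by positivity
      linarith
    rw [abs_mul, abs_of_pos (by positivity)] at e2
    have e3 := le_of_mul_le_mul_left e2 (by positivity)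
    have e4 : h j ^ 2 ≤ (|Z j| + |W j|) ^ 2 := by
      rw [← sq_abs]; gcongr
    nlinarith [sq_nonneg (|Z j| - |W j|), sq_abs (Z j), sq_abs (W j)]
  rw [hW0] at hWj
  have hs3 : (8 / θ) * ∑ i ∈ Finset.range N, (d (i + 1) ^ 2 + e i ^ 2) =
      2 * ∑ i ∈ Finset.range N, 4 / θ * (d (i + 1) ^ 2 + e i ^ 2) := by
    rw [← Finset.mul_sum]; ring
  rw [hs3]
  linarith

end ScalarRecursion

/-! ### Relations between the parameters -/

/-- The universal lower bound for the constant `c`. -/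
def cMin : ℝ := 10 ^ 9

namespace Params

/-- The curvature scale `√(ρ ε)`. -/
def σ (p : Params) : ℝ := √(p.ρ * p.ε)

/-- The length scale `√(ε / ρ)`. -/
def len (p : Params) : ℝ := p.ε / p.σ

/-- Radius in which a run with little decrease stays. -/
def loc (p : Params) : ℝ := 2 * p.len * p.χ⁻¹ ^ 2 * p.c⁻¹ ^ 3

/-- The standing assumptions on the parameters. -/
structure Valid (p : Params) : Prop where
  ε_pos : 0 < p.ε
  ρ_pos : 0 < p.ρ
  b_pos : 0 < p.b
  le_ℓ : √(p.ρ * p.ε) ≤ 1 / 2 * p.ℓ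
  ε_le : p.ε ≤ p.b ^ 2 * p.ρ
  le_c : cMin ≤ p.c
  logb_le : Real.logb 2 (p.θ⁻¹) ≤ p.χ
  exists_T : ∃ m : ℕ, 0 < m ∧ p.T = 4 * m

namespace Valid

variable {p : Params}

theorem σ_pos (h : p.Valid) : 0 < p.σ := Real.sqrt_pos.2 (mul_pos h.ρ_pos h.ε_pos)

theorem σ_sq (h : p.Valid) : p.σ ^ 2 = p.ρ * p.ε := Real.sq_sqrt (mul_pos h.ρ_pos h.ε_pos).le

theorem len_pos (h : p.Valid) : 0 < p.len := div_pos h.ε_pos h.σ_pos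

theorem ε_eq (h : p.Valid) : p.ε = p.σ * p.len := by
  have := h.σ_pos
  rw [len]; field_simp

theorem ρ_mul_len (h : p.Valid) : p.ρ * p.len = p.σ := by
  have := h.σ_pos
  rw [len, ← mul_div_assoc, ← h.σ_sq]; field_simp

theorem ρ_eq (h : p.Valid) : p.ρ = p.σ / p.len := by
  have := h.len_pos
  rw [← h.ρ_mul_len]; field_simp

theorem ℓ_pos (h : p.Valid) : 0 < p.ℓ := by
  have := h.le_ℓ
  have h2 := h.σ_pos
  rw [σ] at h2
  linarith

theorem κ_eq (_ : p.Valid) : p.κ = p.ℓ / p.σ := rfl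

theorem two_le_κ (h : p.Valid) : 2 ≤ p.κ := by
  rw [h.κ_eq, le_div_iff₀ h.σ_pos]
  have := h.le_ℓ
  rw [σ]; linarith

theorem θ_pos (h : p.Valid) : 0 < p.θ := by
  have : 0 < √p.κ := Real.sqrt_pos.2 (by linarith [h.two_le_κ])
  rw [θ]; positivity

theorem sqrt_κ_eq (h : p.Valid) : √p.κ = 1 / (4 * p.θ) := by
  have : 0 < √p.κ := Real.sqrt_pos.2 (by linarith [h.two_le_κ])
  rw [θ]; field_simp

theorem θ_sq (h : p.Valid) : p.θ ^ 2 = p.σ / (16 * p.ℓ) := by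
  have h1 : √p.κ ^ 2 = p.ℓ / p.σ := by
    rw [Real.sq_sqrt (by linarith [h.two_le_κ]), h.κ_eq]
  have h2 := h.σ_pos
  have h3 := h.ℓ_pos
  rw [θ, div_pow, mul_pow, h1]; field_simp; norm_num

theorem θ_sq_le (h : p.Valid) : p.θ ^ 2 ≤ 1 / 32 := by
  rw [h.θ_sq, div_le_div_iff₀ (by linarith [h.ℓ_pos]) (by norm_num)]
  have := h.le_ℓ
  rw [σ]; linarith

theorem θ_le (h : p.Valid) : p.θ ≤ 1 / 5 := by
  have := h.θ_sq_le
  nlinarith [h.θ_pos]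

theorem ℓ_eq (h : p.Valid) : p.ℓ = p.σ / (16 * p.θ ^ 2) := by
  have h2 := h.σ_pos
  have h3 := h.ℓ_pos
  rw [h.θ_sq]; field_simp

theorem η_pos (h : p.Valid) : 0 < p.η := by
  have := h.ℓ_pos
  rw [η]; positivity

theorem η_eq (h : p.Valid) : p.η = 4 * p.θ ^ 2 / p.σ := by
  have h2 := h.σ_pos
  have h3 := h.θ_pos
  rw [η, h.ℓ_eq]; field_simp; norm_num

/-- With `a = η λ`, the curvature threshold `|λ| = σ` is exactly the threshold `|a| = 4 θ²` of the
scalar recursions. -/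
theorem η_mul_σ (h : p.Valid) : p.η * p.σ = 4 * p.θ ^ 2 := by
  have h2 := h.σ_pos
  rw [h.η_eq]; field_simp

theorem η_mul_ℓ (h : p.Valid) : p.η * p.ℓ = 1 / 4 := by
  have := h.ℓ_pos
  rw [η]; field_simp

theorem γ_eq (_ : p.Valid) : p.γ = p.σ / 4 := rfl

theorem sqrt_div (h : p.Valid) : √(p.ε / p.ρ) = p.len := by
  have h2 := h.σ_pos
  have h3 := h.len_pos
  rw [h.ε_eq, h.ρ_eq, show p.σ * p.len / (p.σ / p.len) = p.len ^ 2 by field_simp,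
    Real.sqrt_sq h3.le]

theorem s_eq (h : p.Valid) : p.s = p.len / 32 := by rw [s, h.sqrt_div]; ring

/-- This is how `ε ≤ b² ρ` enters: motion at scale `len` stays where the pullback is regular. -/
theorem len_le_b (h : p.Valid) : p.len ≤ p.b := by
  rw [← h.sqrt_div]
  refine Real.sqrt_le_iff.2 ⟨h.b_pos.le, ?_⟩
  rw [div_le_iff₀ h.ρ_pos]
  exact h.ε_le

theorem sqrt_cube_div (h : p.Valid) : √(p.ε ^ 3 / p.ρ) = p.σ * p.len ^ 2 := by
  have h2 := h.σ_pos
  have h3 := h.len_pos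
  rw [h.ε_eq, h.ρ_eq, show (p.σ * p.len) ^ 3 / (p.σ / p.len) = (p.σ * p.len ^ 2) ^ 2 by
    field_simp, Real.sqrt_sq (by positivity)]

theorem E_eq (h : p.Valid) : p.E = p.σ * p.len ^ 2 * p.χ⁻¹ ^ 5 * p.c⁻¹ ^ 7 := by
  rw [E, h.sqrt_cube_div]
  simp [zpow_neg, inv_pow]

theorem r_eq (h : p.Valid) : p.r = 4 * p.θ ^ 2 * p.len * p.χ⁻¹ ^ 5 * p.c⁻¹ ^ 8 := by
  have h2 := h.σ_pos
  rw [r, h.η_eq, h.ε_eq, zpow_neg, zpow_neg, inv_pow, inv_pow]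
  norm_cast
  field_simp

theorem T_eq (h : p.Valid) : p.T = p.χ * p.c / (4 * p.θ) := by
  rw [T, h.sqrt_κ_eq]; ring

theorem two_ℓ_M_eq (h : p.Valid) : 2 * p.ℓ * p.M = p.σ * p.len * p.c⁻¹ / (2 * p.θ) := by
  have h2 := h.ℓ_pos
  rw [M, h.sqrt_κ_eq, h.ε_eq]
  field_simp; ring

theorem c_pos (h : p.Valid) : 0 < p.c := by
  have := h.le_c
  rw [cMin] at this; linarith

theorem inv_c_pos (h : p.Valid) : 0 < p.c⁻¹ := inv_pos.2 h.c_pos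

theorem inv_c_le (h : p.Valid) : p.c⁻¹ ≤ 1 / 10 ^ 9 := by
  rw [← one_div]
  exact one_div_le_one_div_of_le (by norm_num) h.le_c

theorem θ_inv_le (h : p.Valid) : p.θ⁻¹ ≤ (2 : ℝ) ^ p.χ :=
  (Real.logb_le_iff_le_rpow (by norm_num) (inv_pos.2 h.θ_pos)).1 h.logb_le

theorem two_le_χ (h : p.Valid) : 2 ≤ p.χ := by
  refine le_trans ?_ h.logb_le
  rw [Real.le_logb_iff_rpow_le (by norm_num) (inv_pos.2 h.θ_pos)]
  rw [le_inv_comm₀ (by positivity) h.θ_pos]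
  have := h.θ_le
  norm_num; linarith

theorem χ_pos (h : p.Valid) : 0 < p.χ := by linarith [h.two_le_χ]

theorem inv_χ_pos (h : p.Valid) : 0 < p.χ⁻¹ := inv_pos.2 h.χ_pos

theorem inv_χ_le (h : p.Valid) : p.χ⁻¹ ≤ 1 / 2 := by
  rw [← one_div]
  exact one_div_le_one_div_of_le (by norm_num) h.two_le_χ

theorem E_pos (h : p.Valid) : 0 < p.E := by
  have h1 := h.σ_pos
  have h2 := h.len_pos
  have h3 := h.inv_χ_pos
  have h4 := h.inv_c_pos
  rw [h.E_eq]; positivity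

theorem r_pos (h : p.Valid) : 0 < p.r := by
  have h1 := h.θ_pos
  have h2 := h.len_pos
  have h3 := h.inv_χ_pos
  have h4 := h.inv_c_pos
  rw [h.r_eq]; positivity

theorem loc_pos (h : p.Valid) : 0 < p.loc := by
  have h2 := h.len_pos
  have h3 := h.inv_χ_pos
  have h4 := h.inv_c_pos
  rw [loc]; positivity

theorem T_pos (h : p.Valid) : 0 < p.T := by
  have h1 := h.θ_pos
  have h3 := h.χ_pos
  have h4 := h.c_pos
  rw [h.T_eq]; positivity

/-- The reason for the value of `loc`: losing energy `E` bounds the sum of the squared momenta by `4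
η / θ * E`, and Cauchy–Schwarz over `T` steps turns this into a bound for the squared displacement.
-/
theorem loc_sq (h : p.Valid) : p.loc ^ 2 = 4 * p.η / p.θ * p.T * p.E := by
  have h1 := h.θ_pos
  have h2 := h.σ_pos
  have h3 := h.χ_pos
  have h4 := h.c_pos
  rw [h.T_eq, h.E_eq, h.η_eq, loc]
  field_simp; ring

theorem steps_eq (h : p.Valid) : (p.steps : ℝ) = p.T := by
  obtain ⟨m, -, hm⟩ := h.exists_T
  have : p.T = ((4 * m : ℕ) : ℝ) := by rw [hm]; push_cast; ring
  rw [steps, this, Nat.floor_natCast]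

theorem exists_steps (h : p.Valid) : ∃ m : ℕ, 0 < m ∧ p.steps = 4 * m := by
  obtain ⟨m, h0, hm⟩ := h.exists_T
  refine ⟨m, h0, ?_⟩
  have := h.steps_eq
  rw [hm] at this
  exact_mod_cast this

theorem loc_le (h : p.Valid) : p.loc ≤ p.len / 10 ^ 20 := by
  have h2 := h.len_pos
  have h3 := h.inv_χ_pos
  have h4 := h.inv_c_pos
  have h5 : p.χ⁻¹ ^ 2 ≤ (1 / 2) ^ 2 := by gcongr; exact h.inv_χ_le
  have h6 : p.c⁻¹ ^ 3 ≤ (1 / 10 ^ 9) ^ 3 := by gcongr; exact h.inv_c_le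
  calc p.loc = 2 * p.len * (p.χ⁻¹ ^ 2 * p.c⁻¹ ^ 3) := by rw [loc]; ring
    _ ≤ 2 * p.len * ((1 / 2) ^ 2 * (1 / 10 ^ 9) ^ 3) := by gcongr
    _ ≤ p.len / 10 ^ 20 := by
      linarith

theorem E_le (h : p.Valid) : p.E ≤ p.σ * p.len ^ 2 / 10 ^ 20 := by
  have h1 := h.σ_pos
  have h2 := h.len_pos
  have h3 := h.inv_χ_pos
  have h4 := h.inv_c_pos
  have h5 : p.χ⁻¹ ^ 5 ≤ (1 / 2) ^ 5 := by gcongr; exact h.inv_χ_le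
  have h6 : p.c⁻¹ ^ 7 ≤ (1 / 10 ^ 9) ^ 7 := by gcongr; exact h.inv_c_le
  calc p.E = p.σ * p.len ^ 2 * (p.χ⁻¹ ^ 5 * p.c⁻¹ ^ 7) := by rw [h.E_eq]; ring
    _ ≤ p.σ * p.len ^ 2 * ((1 / 2) ^ 5 * (1 / 10 ^ 9) ^ 7) := by gcongr
    _ ≤ p.σ * p.len ^ 2 / 10 ^ 20 := by
      have : 0 < p.σ * p.len ^ 2 := by positivity
      linarith

theorem r_le_loc (h : p.Valid) : p.r ≤ p.loc := by
  have h1 := h.θ_pos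
  have h2 := h.len_pos
  have h3 := h.inv_χ_pos
  have h4 := h.inv_c_pos
  have h5 : p.χ⁻¹ ^ 3 ≤ 1 := pow_le_one₀ h3.le (by linarith [h.inv_χ_le])
  have h6 : p.c⁻¹ ^ 5 ≤ 1 := pow_le_one₀ h4.le (by linarith [h.inv_c_le])
  calc p.r = 4 * p.θ ^ 2 * p.len * (p.χ⁻¹ ^ 2 * p.c⁻¹ ^ 3) * (p.χ⁻¹ ^ 3 * p.c⁻¹ ^ 5) := by
        rw [h.r_eq]; ring
    _ ≤ 4 * (1 / 32) * p.len * (p.χ⁻¹ ^ 2 * p.c⁻¹ ^ 3) * (1 * 1) := by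
        gcongr
        exact h.θ_sq_le
    _ ≤ p.loc := by
        rw [loc]
        have : 0 ≤ p.len * (p.χ⁻¹ ^ 2 * p.c⁻¹ ^ 3) := by positivity
        linarith

/-- Tangent space steps are taken only from points with gradient at most `2 ℓ M`, so this places
them where the local regularity assumptions hold. -/
theorem two_ℓ_M_le (h : p.Valid) : 2 * p.ℓ * p.M ≤ 1 / 2 * p.ℓ * p.b := by
  have h1 := h.θ_pos
  have h2 := h.len_pos
  have h3 := h.σ_pos
  calc 2 * p.ℓ * p.M = p.σ * p.len * p.c⁻¹ / (2 * p.θ) := h.two_ℓ_M_eq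
    _ ≤ p.σ * p.len * (1 / 10 ^ 9) / (2 * p.θ) := by gcongr; exact h.inv_c_le
    _ ≤ 1 / 2 * (p.σ / (16 * p.θ ^ 2)) * p.len := by
        rw [div_le_iff₀ (by positivity)]
        have : 1 / 2 * (p.σ / (16 * p.θ ^ 2)) * p.len * (2 * p.θ) =
          p.σ * p.len * (1 / (16 * p.θ)) := by field_simp
        rw [this]
        gcongr
        linarith [h.θ_le]
    _ ≤ 1 / 2 * p.ℓ * p.b := by
        rw [← h.ℓ_eq]
        have := h.ℓ_pos
        have := h.len_le_b
        gcongr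

theorem ε_le_half_ℓ_b (h : p.Valid) : p.ε ≤ 1 / 2 * p.ℓ * p.b := by
  have h1 := h.le_ℓ
  have h2 := h.len_pos
  have h3 := h.σ_pos
  have h4 := h.len_le_b
  rw [h.ε_eq]
  exact mul_le_mul h1 h4 h2.le (by linarith [h.ℓ_pos])

end Valid
end Params

/-! ### Linear and quadratic models of the pullback. -/

section Regularity

variable {V : Type*} [NormedAddCommGroup V] [InnerProductSpace ℝ V]

/-- A function on a convex set whose gradient is `K`-Lipschitz there agrees with its linearization
up to `K / 2` times the squared distance. -/
theorem abs_sub_linearization_le {φ : V → ℝ} {Φ : V → V}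
    (hφ : ∀ u, HasFDerivAt φ (innerSL ℝ (Φ u)) u) {S : Set V} (hS : Convex ℝ S) {K : ℝ}
    (hK : ∀ u ∈ S, ∀ u' ∈ S, ‖Φ u - Φ u'‖ ≤ K * ‖u - u'‖) {x y : V} (hx : x ∈ S) (hy : y ∈ S) :
    |φ y - φ x - ⟪Φ x, y - x⟫_ℝ| ≤ K / 2 * ‖y - x‖ ^ 2 := by
  set w := y - x with hw
  have key : ∀ c : ℝ, (c = 1 ∨ c = -1) → c * (φ y - φ x - ⟪Φ x, w⟫_ℝ) ≤ K / 2 * ‖w‖ ^ 2 := by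
    intro c hc
    -- Along the segment this function is antitone by the Lipschitz bound; comparing its end values
    -- gives one side of the estimate, and the sign `c` covers both sides.
    let F : ℝ → ℝ := fun t => c * (φ (x + t • w) - t * ⟪Φ x, w⟫_ℝ) - K / 2 * ‖w‖ ^ 2 * t ^ 2
    have hderiv : ∀ t, HasDerivAt F
        (c * (⟪Φ (x + t • w), w⟫_ℝ - ⟪Φ x, w⟫_ℝ) - K * ‖w‖ ^ 2 * t) t := by
      intro t
      have h1 : HasDerivAt (fun t : ℝ => x + t • w) w t := by
        simpa using ((hasDerivAt_id t).smul_const w).const_add x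
      have h2 : HasDerivAt (fun t : ℝ => φ (x + t • w)) (⟪Φ (x + t • w), w⟫_ℝ) t := by
        exact (hφ (x + t • w)).comp_hasDerivAt t h1
      have h3 : HasDerivAt (fun t : ℝ => t * ⟪Φ x, w⟫_ℝ) (⟪Φ x, w⟫_ℝ) t := by
        simpa using (hasDerivAt_id t).mul_const (⟪Φ x, w⟫_ℝ)
      have h4 : HasDerivAt (fun t : ℝ => K / 2 * ‖w‖ ^ 2 * t ^ 2) (K * ‖w‖ ^ 2 * t) t := by
        have := (hasDerivAt_pow 2 t).const_mul (K / 2 * ‖w‖ ^ 2)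
        refine this.congr_deriv ?_
        simp; ring
      exact ((h2.sub h3).const_mul c).sub h4
    have hanti : AntitoneOn F (Set.Icc 0 1) := by
      refine antitoneOn_of_deriv_nonpos (convex_Icc 0 1)
        (fun t _ => (hderiv t).continuousAt.continuousWithinAt)
        (fun t _ => (hderiv t).differentiableAt.differentiableWithinAt) ?_
      intro t ht
      rw [interior_Icc] at ht
      rw [(hderiv t).deriv]
      have hmem : x + t • w ∈ S := by
        have := hS hx hy (a := 1 - t) (b := t) (by linarith [ht.2]) ht.1.le (by ring)
        convert this using 1
        rw [hw, smul_sub, sub_smul, one_smul]; abel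
      have h1 : |⟪Φ (x + t • w) - Φ x, w⟫_ℝ| ≤ K * ‖w‖ ^ 2 * t := by
        refine (abs_real_inner_le_norm _ _).trans ?_
        have h2 := hK _ hmem _ hx
        rw [add_sub_cancel_left, norm_smul, Real.norm_of_nonneg ht.1.le] at h2
        nlinarith [mul_le_mul_of_nonneg_right h2 (norm_nonneg w)]
      rw [inner_sub_left] at h1
      obtain ⟨h3, h4⟩ := abs_le.1 h1
      rcases hc with rfl | rfl <;> linarith
    have h01 := hanti (Set.left_mem_Icc.2 zero_le_one) (Set.right_mem_Icc.2 zero_le_one) zero_le_one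
    simp only [F, one_smul, zero_smul, add_zero, hw, add_sub_cancel] at h01
    rw [hw]
    linarith
  rw [abs_le]
  constructor
  · linarith [key (-1) (Or.inr rfl)]
  · linarith [key 1 (Or.inl rfl)]

variable [FiniteDimensional ℝ V]

/-- The regularity of the pullback of the cost function to a tangent space that the analysis of
the tangent space steps uses. -/
structure RegularModel (p : Params) (g : V → ℝ) : Prop where
  contDiff : ContDiff ℝ 2 g
  grad_zero : ‖euclGrad g 0‖ ≤ 1 / 2 * p.ℓ * p.b
  grad_lipschitz : ∀ u ∈ Metric.closedBall (0 : V) (3 * p.b),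
    ∀ u' ∈ Metric.closedBall (0 : V) (3 * p.b),
      ‖euclGrad g u - euclGrad g u'‖ ≤ p.ℓ * ‖u - u'‖
  hess_lipschitz : ∀ u ∈ Metric.closedBall (0 : V) (3 * p.b),
    ‖euclHess g u - euclHess g 0‖ ≤ p.ρ * ‖u‖

theorem hasFDerivAt_euclGrad {g : V → ℝ} (hg : ContDiff ℝ 2 g) (u : V) :
    HasFDerivAt g (innerSL ℝ (euclGrad g u)) u := by
  have h1 := (hg.differentiable (by norm_num) u).hasFDerivAt
  refine h1.congr_fderiv ?_
  ext v
  rw [innerSL_apply_apply]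
  exact (inner_euclGrad g u v).symm

theorem contDiff_euclGrad {g : V → ℝ} (hg : ContDiff ℝ 2 g) : ContDiff ℝ 1 (euclGrad g) := by
  have : CompleteSpace V := FiniteDimensional.complete ℝ V
  have h1 : ContDiff ℝ 1 (fderiv ℝ g) := hg.fderiv_right (by norm_num)
  exact (InnerProductSpace.toDual ℝ V).symm.toContinuousLinearEquiv.contDiff.comp h1

theorem hasFDerivAt_euclHess {g : V → ℝ} (hg : ContDiff ℝ 2 g) (u : V) :
    HasFDerivAt (euclGrad g) (euclHess g u) u :=
  ((contDiff_euclGrad hg).differentiable (by norm_num) u).hasFDerivAt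

/-- Testing the gradient on a fixed vector gives a directional derivative of `g`, so this is the
symmetry of the second derivative of a `C²` function. -/
theorem inner_euclHess_comm {g : V → ℝ} (hg : ContDiff ℝ 2 g) (u x y : V) :
    ⟪euclHess g u x, y⟫_ℝ = ⟪x, euclHess g u y⟫_ℝ := by
  have h1 : ∀ z w : V, ⟪euclHess g u z, w⟫_ℝ = fderiv ℝ (fderiv ℝ g) u z w := by
    intro z w
    have h2 : HasFDerivAt (fun v => ⟪euclGrad g v, w⟫_ℝ)
        ((innerSL ℝ w).comp (euclHess g u)) u := by
      have := ((innerSL ℝ w).hasFDerivAt (x := euclGrad g u)).comp u (hasFDerivAt_euclHess hg u)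
      refine this.congr_of_eventuallyEq (Filter.Eventually.of_forall fun v => ?_)
      simp [real_inner_comm]
    have h3 : HasFDerivAt (fun v => fderiv ℝ g v w)
        ((ContinuousLinearMap.apply ℝ ℝ w).comp (fderiv ℝ (fderiv ℝ g) u)) u := by
      have h4 : ContDiff ℝ 1 (fderiv ℝ g) := hg.fderiv_right (by norm_num)
      exact ((ContinuousLinearMap.apply ℝ ℝ w).hasFDerivAt).comp u
        (h4.differentiable (by norm_num) u).hasFDerivAt
    have h5 : (fun v => ⟪euclGrad g v, w⟫_ℝ) = fun v => fderiv ℝ g v w :=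
      funext fun v => inner_euclGrad g v w
    rw [h5] at h2
    have h6 := congrArg (fun L => L z) (h2.unique h3)
    simp only [ContinuousLinearMap.comp_apply, innerSL_apply_apply,
      ContinuousLinearMap.apply_apply] at h6
    rw [← h6, real_inner_comm]
  rw [h1, ← real_inner_comm x, h1]
  have h2 : IsSymmSndFDerivAt ℝ g u := hg.contDiffAt.isSymmSndFDerivAt (by simp)
  exact h2 x y

namespace RegularModel

variable {p : Params} {g : V → ℝ}

theorem norm_euclHess_zero_le (hg : RegularModel p g) (hp : p.Valid) :
    ‖euclHess g 0‖ ≤ p.ℓ := by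
  have hb := hp.b_pos
  refine (hasFDerivAt_euclHess hg.contDiff 0).le_of_lip' hp.ℓ_pos.le ?_
  have : Metric.closedBall (0 : V) (3 * p.b) ∈ nhds (0 : V) :=
    Metric.closedBall_mem_nhds _ (by positivity)
  filter_upwards [this] with u hu
  exact hg.grad_lipschitz u hu 0 (by simp; positivity)

/-- In a small ball, the gradient is close to its linearization with the Hessian at the origin. -/
theorem norm_grad_sub_hess_le (hg : RegularModel p g) (hp : p.Valid) {r : ℝ} (hr : r ≤ 3 * p.b)
    {u u' : V} (hu : ‖u‖ ≤ r) (hu' : ‖u'‖ ≤ r) :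
    ‖euclGrad g u - euclGrad g u' - euclHess g 0 (u - u')‖ ≤ p.ρ * r * ‖u - u'‖ := by
  refine (convex_closedBall (0 : V) r).norm_image_sub_le_of_norm_hasFDerivWithin_le'
    (f := euclGrad g) (f' := euclHess g)
    (fun z _ => (hasFDerivAt_euclHess hg.contDiff z).hasFDerivWithinAt) ?_
    (by simpa using hu') (by simpa using hu)
  intro z hz
  rw [mem_closedBall_zero_iff] at hz
  refine (hg.hess_lipschitz z (by rw [mem_closedBall_zero_iff]; linarith)).trans ?_
  exact mul_le_mul_of_nonneg_left hz hp.ρ_pos.le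

theorem le_descent (hg : RegularModel p g) {x y : V} (hx : ‖x‖ ≤ 3 * p.b) (hy : ‖y‖ ≤ 3 * p.b) :
    g y ≤ g x + ⟪euclGrad g x, y - x⟫_ℝ + p.ℓ / 2 * ‖y - x‖ ^ 2 := by
  have := abs_sub_linearization_le (hasFDerivAt_euclGrad hg.contDiff)
    (convex_closedBall (0 : V) (3 * p.b)) hg.grad_lipschitz
    (mem_closedBall_zero_iff.2 hx) (mem_closedBall_zero_iff.2 hy)
  linarith [(abs_le.1 this).2]

/-- After subtracting the quadratic form of the Hessian at the origin, the gradient of the remainder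
is `ρ r`-Lipschitz on the ball, and the linearization bound applies. Freezing the Hessian at the
origin lets all points share one quadratic model. -/
theorem abs_sub_quadratic_le (hg : RegularModel p g) (hp : p.Valid) {r : ℝ} (hr : r ≤ 3 * p.b)
    {x y : V} (hx : ‖x‖ ≤ r) (hy : ‖y‖ ≤ r) :
    |g y - g x - ⟪euclGrad g x, y - x⟫_ℝ - 1 / 2 * ⟪y - x, euclHess g 0 (y - x)⟫_ℝ| ≤
      p.ρ * r / 2 * ‖y - x‖ ^ 2 := by
  set H := euclHess g 0 with hH
  have hsymm : ∀ a b : V, ⟪H a, b⟫_ℝ = ⟪a, H b⟫_ℝ := inner_euclHess_comm hg.contDiff 0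
  have h1 : ∀ u, HasFDerivAt (fun z => g z - 1 / 2 * ⟪z, H z⟫_ℝ)
      (innerSL ℝ (euclGrad g u - H u)) u := by
    intro u
    have e1 := (hasFDerivAt_id (𝕜 := ℝ) u).inner ℝ (H.hasFDerivAt (x := u))
    have e2 := (hasFDerivAt_euclGrad hg.contDiff u).sub (e1.const_mul (1 / 2))
    refine e2.congr_fderiv ?_
    ext v
    simp only [sub_apply, innerSL_apply_apply, inner_sub_left,
      smul_apply, ContinuousLinearMap.comp_apply, smul_eq_mul,
      fderivInnerCLM_apply, ContinuousLinearMap.prod_apply, id_eq]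
    have e3 : ⟪(ContinuousLinearMap.id ℝ V) v, H u⟫_ℝ = ⟪H u, v⟫_ℝ := real_inner_comm _ _
    rw [e3, ← hsymm u v]
    ring
  have h2 := abs_sub_linearization_le h1 (convex_closedBall (0 : V) r) (K := p.ρ * r)
    (fun u hu u' hu' => by
      have := hg.norm_grad_sub_hess_le hp hr (mem_closedBall_zero_iff.1 hu)
        (mem_closedBall_zero_iff.1 hu')
      rwa [show euclGrad g u - H u - (euclGrad g u' - H u') =
        euclGrad g u - euclGrad g u' - H (u - u') by rw [map_sub]; abel])
    (mem_closedBall_zero_iff.2 hx) (mem_closedBall_zero_iff.2 hy)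
  convert h2 using 2
  simp only [map_sub, inner_sub_left, inner_sub_right]
  rw [hsymm x y, hsymm x x, real_inner_comm (H x) y, hsymm x y]
  ring

end RegularModel

end Regularity

/-! ### The accelerated iteration and its energy. -/

section Trajectory

variable {V : Type*} [NormedAddCommGroup V] [InnerProductSpace ℝ V] [FiniteDimensional ℝ V]

/-- The extrapolated point from the iterate and momentum `z`. -/
def extrapolate (p : Params) (z : V × V) : V := z.1 + (1 - cappedTheta p z.1 z.2) • z.2

/-- One accelerated gradient step. -/
def agdStep (p : Params) (g : V → ℝ) (z : V × V) : V × V :=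
  (extrapolate p z - p.η • euclGrad g (extrapolate p z),
    extrapolate p z - p.η • euclGrad g (extrapolate p z) - z.1)

/-- Iterate and momentum after `j` accelerated gradient steps from `z`. -/
def traj (p : Params) (g : V → ℝ) (z : V × V) (j : ℕ) : V × V := (agdStep p g)^[j] z

/-- The condition under which the loop returns the new iterate. -/
def Exits (p : Params) (g : V → ℝ) (perturbed : Bool) (s : V) : Prop :=
  p.b < ‖s‖ ∨ (perturbed = false ∧ ‖euclGrad g s‖ ≤ p.ε / 2)

open Classical in
theorem tssLoop_succ_fst (p : Params) (g : V → ℝ) (perturbed : Bool) (n : ℕ) (z : V × V) :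
    (tssLoop p g perturbed (n + 1) z.1 z.2).1 =
      if NCC p g z.1 (extrapolate p z) then (nce p g z.1 z.2).1
      else if Exits p g perturbed (agdStep p g z).1 then (agdStep p g z).1
      else (tssLoop p g perturbed n (agdStep p g z).1 (agdStep p g z).2).1 := by
  rw [tssLoop]
  simp only [apply_ite Prod.fst]
  refine if_congr Iff.rfl rfl ?_
  exact if_congr Iff.rfl rfl rfl

/-- Separates control flow from dynamics: up to the exit the loop follows `traj`, whose definition
ignores all stopping tests, so estimates can be proved for `traj` alone. -/
theorem tssLoop_spec (p : Params) (g : V → ℝ) (perturbed : Bool) (n : ℕ) (z : V × V) :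
    ∃ k ≤ n, (∀ j < k, ¬ NCC p g (traj p g z j).1 (extrapolate p (traj p g z j)) ∧
        ¬ Exits p g perturbed (traj p g z (j + 1)).1) ∧
      ((k < n ∧ NCC p g (traj p g z k).1 (extrapolate p (traj p g z k)) ∧
          (tssLoop p g perturbed n z.1 z.2).1 = (nce p g (traj p g z k).1 (traj p g z k).2).1) ∨
        (k < n ∧ ¬ NCC p g (traj p g z k).1 (extrapolate p (traj p g z k)) ∧
          Exits p g perturbed (traj p g z (k + 1)).1 ∧
          (tssLoop p g perturbed n z.1 z.2).1 = (traj p g z (k + 1)).1) ∨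
        (k = n ∧ (tssLoop p g perturbed n z.1 z.2).1 = (traj p g z n).1)) := by
  induction n generalizing z with
  | zero => exact ⟨0, le_rfl, by simp, Or.inr (Or.inr ⟨rfl, rfl⟩)⟩
  | succ n ih =>
    by_cases h1 : NCC p g z.1 (extrapolate p z)
    · refine ⟨0, by omega, by simp, Or.inl ⟨by omega, h1, ?_⟩⟩
      rw [tssLoop_succ_fst, if_pos h1]; rfl
    · by_cases h2 : Exits p g perturbed (agdStep p g z).1
      · refine ⟨0, by omega, by simp, Or.inr (Or.inl ⟨by omega, h1, h2, ?_⟩)⟩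
        rw [tssLoop_succ_fst, if_neg h1, if_pos h2]; rfl
      · obtain ⟨k, hk, hbefore, hcases⟩ := ih (agdStep p g z)
        have hout : (tssLoop p g perturbed (n + 1) z.1 z.2).1 =
            (tssLoop p g perturbed n (agdStep p g z).1 (agdStep p g z).2).1 := by
          rw [tssLoop_succ_fst, if_neg h1, if_neg h2]
        have hshift : ∀ j, traj p g (agdStep p g z) j = traj p g z (j + 1) := fun j => rfl
        refine ⟨k + 1, by omega, ?_, ?_⟩
        · intro j hj
          rcases j with _ | j
          · exact ⟨h1, h2⟩
          · exact hbefore j (by omega)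
        · rw [hout]
          rcases hcases with ⟨a, b⟩ | ⟨a, b⟩ | ⟨a, b⟩
          · exact Or.inl ⟨by omega, b⟩
          · exact Or.inr (Or.inl ⟨by omega, b⟩)
          · exact Or.inr (Or.inr ⟨by omega, b⟩)

theorem nce_cost_le {V : Type*} [NormedAddCommGroup V] [InnerProductSpace ℝ V]
    (p : Params) (g : V → ℝ) (s v : V) :
    (nce p g s v).2.grad ≤ 0 ∧ (nce p g s v).2.fn ≤ 3 ∧ (nce p g s v).2.retr ≤ 3 := by
  unfold nce
  split_ifs
  · exact ⟨le_rfl, Nat.zero_le _, Nat.zero_le _⟩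
  · exact ⟨le_rfl, le_rfl, le_rfl⟩

/-- The additive `3` is negative curvature exploitation, which ends the loop and so is paid at most
once. -/
theorem tssLoop_cost_le (p : Params) (g : V → ℝ) (perturbed : Bool) (n : ℕ) (s v : V) :
    (tssLoop p g perturbed n s v).2.grad ≤ (if perturbed then 1 else 2) * n ∧
      (tssLoop p g perturbed n s v).2.fn ≤ 2 * n + 3 ∧
      (tssLoop p g perturbed n s v).2.retr ≤ (if perturbed then 3 else 4) * n + 3 := by
  have hadd : ∀ k k' : Cost, (k + k').grad = k.grad + k'.grad ∧ (k + k').fn = k.fn + k'.fn ∧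
    (k + k').retr = k.retr + k'.retr := fun _ _ => ⟨rfl, rfl, rfl⟩
  induction n generalizing s v with
  | zero => exact ⟨Nat.zero_le _, Nat.zero_le _, Nat.zero_le _⟩
  | succ n ih =>
    rw [tssLoop]
    obtain ⟨c1, c2, c3⟩ := nce_cost_le p g s v
    simp only
    obtain ⟨i1, i2, i3⟩ := ih (s + (1 - cappedTheta p s v) • v -
      p.η • euclGrad g (s + (1 - cappedTheta p s v) • v))
      (s + (1 - cappedTheta p s v) • v -
      p.η • euclGrad g (s + (1 - cappedTheta p s v) • v) - s)
    clear ih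
    cases perturbed <;> split_ifs <;>
      simp_all [Cost.pullbackFn, Cost.pullbackGrad] <;> omega

/-- If the cap is active, the norm exceeds `2b` at parameter `θ` and is at most `b` at parameter
`1`. By the intermediate value theorem the set of admissible parameters is nonempty, and it is
closed, so the infimum belongs to it. -/
theorem cappedTheta_spec {V : Type*} [NormedAddCommGroup V] [InnerProductSpace ℝ V] (p : Params) (hp : p.Valid) {s v : V} (hs : ‖s‖ ≤ p.b) :
    p.θ ≤ cappedTheta p s v ∧ cappedTheta p s v ≤ 1 ∧
      ‖s + (1 - cappedTheta p s v) • v‖ ≤ 2 * p.b := by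
  have hθ := hp.θ_le
  have hb := hp.b_pos
  unfold cappedTheta
  split_ifs with h
  · exact ⟨le_rfl, by linarith, h⟩
  · set S := {t : ℝ | t ∈ Set.Icc p.θ 1 ∧ ‖s + (1 - t) • v‖ = 2 * p.b} with hS
    have hcont : Continuous fun t : ℝ => ‖s + (1 - t) • v‖ := by fun_prop
    have hne : S.Nonempty := by
      have h1 := intermediate_value_Icc' (show p.θ ≤ 1 by linarith) hcont.continuousOn
      have h2 : 2 * p.b ∈ Set.Icc ‖s + (1 - (1 : ℝ)) • v‖ ‖s + (1 - p.θ) • v‖ := by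
        constructor
        · simp; linarith
        · push Not at h; exact h.le
      obtain ⟨t, ht, hteq⟩ := h1 h2
      exact ⟨t, ht, hteq⟩
    have hclosed : IsClosed S := isClosed_Icc.inter (isClosed_eq hcont continuous_const)
    have hbdd : BddBelow S := ⟨p.θ, fun t ht => ht.1.1⟩
    obtain ⟨⟨h1, h2⟩, h3⟩ := hclosed.csInf_mem hne hbdd
    exact ⟨h1, h2, h3.le⟩

/-- The Hamiltonian of an iterate and momentum. -/
def energy (p : Params) (g : V → ℝ) (z : V × V) : ℝ := g z.1 + 1 / (2 * p.η) * ‖z.2‖ ^ 2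

variable {p : Params} {g : V → ℝ}

/-- Failure of the negative curvature condition bounds `g u - g s` by `(1 - t) ⟪w, v⟫` plus a term
of weight `γ`. The change in kinetic energy contains the same inner product with the opposite sign,
so it cancels. What is left of the momentum has coefficient `(1 - t)² (1 + γ η)`, which is at most
`1 - θ` because `γ η = θ²`. The gradient step gains `7/8 η ‖w‖²`, of which the new kinetic energy
takes `1/2`. -/
theorem energy_agdStep_le (hg : RegularModel p g) (hp : p.Valid) {z : V × V} (hz : ‖z.1‖ ≤ p.b)
    (hN : ¬ NCC p g z.1 (extrapolate p z)) :
    energy p g (agdStep p g z) + p.θ / (2 * p.η) * ‖z.2‖ ^ 2 +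
      3 / 8 * p.η * ‖euclGrad g (extrapolate p z)‖ ^ 2 ≤ energy p g z := by
  obtain ⟨s, v⟩ := z
  obtain ⟨t1, t2, t3⟩ := cappedTheta_spec p hp (v := v) hz
  set t := cappedTheta p s v with ht
  have hu : extrapolate p (s, v) = s + (1 - t) • v := rfl
  rw [hu] at hN ⊢
  set u := s + (1 - t) • v with hu'
  set w := euclGrad g u with hw
  have hη := hp.η_pos
  have hb := hp.b_pos
  have hℓ := hp.ℓ_pos
  have hθ := hp.θ_pos
  have hθle := hp.θ_le
  have hγη : p.γ * p.η = p.θ ^ 2 := by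
    have := hp.η_mul_σ
    rw [hp.γ_eq]; linarith
  have hηℓ := hp.η_mul_ℓ
  have hagd : agdStep p g (s, v) = (u - p.η • w, u - p.η • w - s) := rfl
  rw [hagd]
  simp only [energy]
  have hNCC : g u ≤ g s + (1 - t) * ⟪w, v⟫_ℝ + p.γ / 2 * ((1 - t) ^ 2 * ‖v‖ ^ 2) := by
    unfold NCC at hN
    push Not at hN
    have e1 : s - u = -((1 - t) • v) := by rw [hu']; abel
    rw [e1, inner_neg_right, inner_smul_right, norm_neg, norm_smul, mul_pow, Real.norm_eq_abs,
      sq_abs] at hN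
    linarith
  -- Needed to keep the gradient step in the ball of radius `3b`: it has length at most `5/8 b` and
  -- starts within `2b`.
  have hwnorm : ‖w‖ ≤ 1 / 2 * p.ℓ * p.b + p.ℓ * (2 * p.b) := by
    have e1 := hg.grad_lipschitz u (by simp; linarith) 0 (by simp; positivity)
    rw [sub_zero] at e1
    have e2 := norm_sub_norm_le w (euclGrad g 0)
    have e3 := hg.grad_zero
    nlinarith
  have hdesc : g (u - p.η • w) ≤ g u - 7 / 8 * p.η * ‖w‖ ^ 2 := by
    have e1 : ‖u - p.η • w‖ ≤ 3 * p.b := by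
      refine (norm_sub_le _ _).trans ?_
      rw [norm_smul, Real.norm_of_nonneg hη.le]
      have : p.η * ‖w‖ ≤ p.η * (1 / 2 * p.ℓ * p.b + p.ℓ * (2 * p.b)) :=
        mul_le_mul_of_nonneg_left hwnorm hη.le
      have e2 : p.η * (1 / 2 * p.ℓ * p.b + p.ℓ * (2 * p.b)) = p.η * p.ℓ * (5 / 2 * p.b) := by ring
      rw [e2, hηℓ] at this
      linarith
    have e2 := hg.le_descent (x := u) (y := u - p.η • w) (by linarith) e1
    rw [sub_sub_cancel_left, inner_neg_right, inner_smul_right, norm_neg, norm_smul, mul_pow,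
      Real.norm_eq_abs, sq_abs, ← hw, real_inner_self_eq_norm_sq] at e2
    have e3 : p.ℓ / 2 * (p.η ^ 2 * ‖w‖ ^ 2) = (p.η * p.ℓ) * (p.η / 2 * ‖w‖ ^ 2) := by ring
    rw [e3, hηℓ] at e2
    linarith
  have hv' : ‖u - p.η • w - s‖ ^ 2 =
      (1 - t) ^ 2 * ‖v‖ ^ 2 - 2 * p.η * ((1 - t) * ⟪w, v⟫_ℝ) + p.η ^ 2 * ‖w‖ ^ 2 := by
    have e1 : u - p.η • w - s = (1 - t) • v - p.η • w := by rw [hu']; abel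
    rw [e1, norm_sub_sq_real, norm_smul, norm_smul, mul_pow, mul_pow, Real.norm_eq_abs,
      Real.norm_eq_abs, sq_abs, sq_abs, inner_smul_left, inner_smul_right, real_inner_comm v w]
    simp only [conj_trivial]; ring
  have hkin : 1 / (2 * p.η) * ‖u - p.η • w - s‖ ^ 2 =
      1 / (2 * p.η) * ((1 - t) ^ 2 * ‖v‖ ^ 2) - (1 - t) * ⟪w, v⟫_ℝ + p.η / 2 * ‖w‖ ^ 2 := by
    rw [hv']; field_simp
  have hcoef : (1 - t) ^ 2 * (1 + p.θ ^ 2) ≤ 1 - p.θ := by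
    have e1 : (1 - t) * (1 + p.θ ^ 2) ≤ 1 := by nlinarith
    nlinarith
  have hfin : p.γ / 2 * ((1 - t) ^ 2 * ‖v‖ ^ 2) + 1 / (2 * p.η) * ((1 - t) ^ 2 * ‖v‖ ^ 2) +
      p.θ / (2 * p.η) * ‖v‖ ^ 2 ≤ 1 / (2 * p.η) * ‖v‖ ^ 2 := by
    have e1 : p.γ / 2 * ((1 - t) ^ 2 * ‖v‖ ^ 2) + 1 / (2 * p.η) * ((1 - t) ^ 2 * ‖v‖ ^ 2) +
      p.θ / (2 * p.η) * ‖v‖ ^ 2 =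
        1 / (2 * p.η) * (((1 - t) ^ 2 * (1 + p.γ * p.η) + p.θ) * ‖v‖ ^ 2) := by
      field_simp; ring
    rw [e1, hγη]
    refine mul_le_mul_of_nonneg_left ?_ (by positivity)
    exact mul_le_of_le_one_left (sq_nonneg _) (by linarith)
  rw [hkin]
  linarith

/-- The new momentum is `(1 - t) v - η w`, and the energy drop pays for both squares. The momentum
term is the expensive one and fixes the factor `4 η / θ`. -/
theorem sq_norm_agdStep_le (hg : RegularModel p g) (hp : p.Valid) {z : V × V} (hz : ‖z.1‖ ≤ p.b)
    (hN : ¬ NCC p g z.1 (extrapolate p z)) :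
    ‖(agdStep p g z).2‖ ^ 2 ≤ 4 * p.η / p.θ * (energy p g z - energy p g (agdStep p g z)) := by
  have h := energy_agdStep_le hg hp hz hN
  obtain ⟨s, v⟩ := z
  obtain ⟨t1, t2, t3⟩ := cappedTheta_spec p hp (v := v) hz
  have hη := hp.η_pos
  have hθ := hp.θ_pos
  have hθle := hp.θ_le
  set w := euclGrad g (extrapolate p (s, v)) with hw
  set t := cappedTheta p s v with ht
  have e1 : (agdStep p g (s, v)).2 = (1 - t) • v - p.η • w := by
    simp only [agdStep, ← hw]; rw [extrapolate]; abel
  have e2 : ‖(agdStep p g (s, v)).2‖ ≤ ‖v‖ + p.η * ‖w‖ := by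
    rw [e1]
    refine (norm_sub_le _ _).trans ?_
    rw [norm_smul, norm_smul, Real.norm_of_nonneg hη.le, Real.norm_of_nonneg (by linarith)]
    nlinarith [norm_nonneg v]
  have e3 : ‖(agdStep p g (s, v)).2‖ ^ 2 ≤ 2 * ‖v‖ ^ 2 + 2 * p.η ^ 2 * ‖w‖ ^ 2 := by
    have := pow_le_pow_left₀ (norm_nonneg _) e2 2
    nlinarith [sq_nonneg (‖v‖ - p.η * ‖w‖)]
  have e4 : 4 * p.η / p.θ * (p.θ / (2 * p.η) * ‖v‖ ^ 2 + 3 / 8 * p.η * ‖w‖ ^ 2) =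
      2 * ‖v‖ ^ 2 + 3 / 2 / p.θ * (p.η ^ 2 * ‖w‖ ^ 2) := by field_simp; ring
  have e5 : (2 : ℝ) ≤ 3 / 2 / p.θ := by rw [le_div_iff₀ hθ]; linarith
  have e6 := mul_le_mul_of_nonneg_right e5 (show 0 ≤ p.η ^ 2 * ‖w‖ ^ 2 by positivity)
  have e7 : 4 * p.η / p.θ * (p.θ / (2 * p.η) * ‖v‖ ^ 2 + 3 / 8 * p.η * ‖w‖ ^ 2) ≤
      4 * p.η / p.θ * (energy p g (s, v) - energy p g (agdStep p g (s, v))) := by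
    refine mul_le_mul_of_nonneg_left ?_ (by positivity)
    simp only at h
    linarith
  linarith

theorem traj_succ (z : V × V) (j : ℕ) : traj p g z (j + 1) = agdStep p g (traj p g z j) :=
  Function.iterate_succ_apply' _ _ _

theorem traj_succ_snd (z : V × V) (j : ℕ) :
    (traj p g z (j + 1)).2 = (traj p g z (j + 1)).1 - (traj p g z j).1 := by
  rw [traj_succ]; rfl

theorem sum_sq_momentum_le (hg : RegularModel p g) (hp : p.Valid) {z : V × V} {k : ℕ}
    (hk : ∀ j < k, ‖(traj p g z j).1‖ ≤ p.b ∧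
      ¬ NCC p g (traj p g z j).1 (extrapolate p (traj p g z j))) :
    ∑ j ∈ Finset.range k, ‖(traj p g z (j + 1)).2‖ ^ 2 ≤
      4 * p.η / p.θ * (energy p g z - energy p g (traj p g z k)) := by
  induction k with
  | zero => simp [traj]
  | succ k ih =>
    rw [Finset.sum_range_succ]
    have h1 := ih fun j hj => hk j (by omega)
    have h2 := sq_norm_agdStep_le hg hp (hk k (by omega)).1 (hk k (by omega)).2
    rw [← traj_succ] at h2
    linarith

theorem energy_traj_antitone (hg : RegularModel p g) (hp : p.Valid) {z : V × V} {k : ℕ}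
    (hk : ∀ j < k, ‖(traj p g z j).1‖ ≤ p.b ∧
      ¬ NCC p g (traj p g z j).1 (extrapolate p (traj p g z j))) {i : ℕ} (hi : i ≤ k) :
    energy p g (traj p g z k) ≤ energy p g (traj p g z i) := by
  have hη := hp.η_pos
  have hθ := hp.θ_pos
  induction k, hi using Nat.le_induction with
  | base => exact le_rfl
  | succ k hik ih =>
    refine le_trans ?_ (ih fun j hj => hk j (by omega))
    have h2 := energy_agdStep_le hg hp (hk k (by omega)).1 (hk k (by omega)).2
    rw [← traj_succ] at h2
    have : 0 ≤ p.θ / (2 * p.η) * ‖(traj p g z k).2‖ ^ 2 := by positivity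
    have : 0 ≤ 3 / 8 * p.η * ‖euclGrad g (extrapolate p (traj p g z k))‖ ^ 2 := by positivity
    linarith

theorem sq_dist_traj_le (z : V × V) (k : ℕ) :
    ‖(traj p g z k).1 - z.1‖ ^ 2 ≤
      k * ∑ j ∈ Finset.range k, ‖(traj p g z (j + 1)).2‖ ^ 2 := by
  have h1 : (traj p g z k).1 - z.1 = ∑ j ∈ Finset.range k, (traj p g z (j + 1)).2 := by
    have := Finset.sum_range_sub (fun j => (traj p g z j).1) k
    rw [Finset.sum_congr rfl fun j _ => traj_succ_snd (p := p) (g := g) z j, this]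
    rfl
  rw [h1]
  refine (pow_le_pow_left₀ (norm_nonneg _) (norm_sum_le _ _) 2).trans ?_
  simpa using sq_sum_le_card_mul_sum_sq (s := Finset.range k)
    (f := fun j => ‖(traj p g z (j + 1)).2‖)

/-- Improve or localize: as long as the energy has decreased by less than `ℰ`, the iterates stay
close to the starting point. -/
theorem dist_traj_le_loc (hg : RegularModel p g) (hp : p.Valid) {z : V × V} {k : ℕ}
    (hk : ∀ j < k, ‖(traj p g z j).1‖ ≤ p.b ∧
      ¬ NCC p g (traj p g z j).1 (extrapolate p (traj p g z j))) (hkn : k ≤ p.steps)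
    (hE : energy p g z - energy p g (traj p g z k) ≤ p.E) :
    ‖(traj p g z k).1 - z.1‖ ≤ p.loc := by
  have hη := hp.η_pos
  have hθ := hp.θ_pos
  refine abs_le_of_sq_le_sq' ?_ hp.loc_pos.le |>.2
  refine (sq_dist_traj_le z k).trans ?_
  have h1 : (k : ℝ) ≤ p.T := by rw [← hp.steps_eq]; exact_mod_cast hkn
  have h2 : 4 * p.η / p.θ * (energy p g z - energy p g (traj p g z k)) ≤
      4 * p.η / p.θ * p.E := mul_le_mul_of_nonneg_left hE (by positivity)
  have h3 := (sum_sq_momentum_le hg hp hk).trans h2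
  have h4 : 0 ≤ ∑ j ∈ Finset.range k, ‖(traj p g z (j + 1)).2‖ ^ 2 := by positivity
  rw [hp.loc_sq]
  calc (k : ℝ) * ∑ j ∈ Finset.range k, ‖(traj p g z (j + 1)).2‖ ^ 2
      ≤ p.T * (4 * p.η / p.θ * p.E) := mul_le_mul h1 h3 h4 hp.T_pos.le
    _ = _ := by ring

end Trajectory

/-! ### Runs of the tangent space steps: large decrease or localization. -/

section Dichotomy

variable {V : Type*} [NormedAddCommGroup V] [InnerProductSpace ℝ V]

theorem nce_le (p : Params) (g : V → ℝ) (s v : V) : g (nce p g s v).1 ≤ g s := by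
  unfold nce
  simp only
  split_ifs with h1 h2 h3
  · exact le_rfl
  · exact le_rfl
  · rw [not_and_or, not_le, not_le] at h2
    rcases h2 with h2 | h2 <;> simp only <;> linarith
  · rw [not_and_or, not_le, not_le] at h2
    push Not at h3
    rcases h2 with h2 | h2 <;> simp only <;> linarith

theorem nce_le_of_lt (p : Params) (g : V → ℝ) {s v : V} (hv : ‖v‖ < p.s) :
    g (nce p g s v).1 ≤ g (s + (p.s / ‖v‖) • v) ∧ g (nce p g s v).1 ≤ g (s - (p.s / ‖v‖) • v) := by
  unfold nce
  rw [if_neg (not_le.2 hv)]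
  simp only
  split_ifs with h2 h3
  · exact h2
  · exact ⟨le_rfl, h3⟩
  · push Not at h3
    exact ⟨h3.le, le_rfl⟩

variable [FiniteDimensional ℝ V] {p : Params} {g : V → ℝ}

/-- Negative curvature exploitation near the origin decreases the energy by at least `ℰ`. -/
theorem nce_le_energy_sub (hg : RegularModel p g) (hp : p.Valid) {z : V × V}
    (hz : ‖z.1‖ ≤ 2 * p.loc) (hN : NCC p g z.1 (extrapolate p z)) :
    g (nce p g z.1 z.2).1 ≤ energy p g z - p.E := by
  obtain ⟨s, v⟩ := z
  simp only at hz hN ⊢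
  have hη := hp.η_pos
  have hσ := hp.σ_pos
  have hlen := hp.len_pos
  have hθ := hp.θ_pos
  have hs := hp.s_eq
  have hloc := hp.loc_le
  have hE := hp.E_le
  have hlb := hp.len_le_b
  have hlocpos := hp.loc_pos
  have hbig : 0 < p.σ * p.len ^ 2 := by positivity
  -- With large momentum, dropping the kinetic energy already accounts for `E`. With small momentum,
  -- all points involved lie within `len / 16` of the origin and the quadratic model applies.
  rcases le_or_gt p.s ‖v‖ with hv | hv
  · have h1 := nce_le p g s v
    have h2 : p.E ≤ 1 / (2 * p.η) * ‖v‖ ^ 2 := by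
      have e1 : 1 / (2 * p.η) * p.s ^ 2 ≤ 1 / (2 * p.η) * ‖v‖ ^ 2 := by
        have : 0 ≤ p.s := by rw [hs]; positivity
        gcongr
      have e2 : 1 / (2 * p.η) * p.s ^ 2 = p.σ * p.len ^ 2 * (1 / (8192 * p.θ ^ 2)) := by
        rw [hs, hp.η_eq]; field_simp; norm_num
      have e3 : (1 : ℝ) / 10 ^ 20 ≤ 1 / (8192 * p.θ ^ 2) := by
        have := hp.θ_sq_le
        apply one_div_le_one_div_of_le (by positivity)
        linarith
      have e4 := mul_le_mul_of_nonneg_left e3 hbig.le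
      linarith
    simp only [energy]
    linarith
  · have hvne : v ≠ 0 := by
      -- With zero momentum the extrapolated point is the iterate itself, and the strict inequality
      -- in `NCC` fails.
      rintro rfl
      simp [NCC, extrapolate] at hN
    have hvpos : 0 < ‖v‖ := norm_pos_iff.2 hvne
    have hspos : 0 < p.s := by rw [hs]; positivity
    have hsb : ‖s‖ ≤ p.b := by linarith
    obtain ⟨t1, t2, t3⟩ := cappedTheta_spec p hp (v := v) hsb
    have hu : extrapolate p (s, v) = s + (1 - cappedTheta p s v) • v := rfl
    rw [hu] at hN
    set t := cappedTheta p s v with ht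
    set u := s + (1 - t) • v with hu'
    have hsu : s - u = -((1 - t) • v) := by rw [hu']; abel
    set Λ : ℝ := p.len / 16 with hΛ
    have hΛb : Λ ≤ 3 * p.b := by linarith
    have hρΛ : p.ρ * Λ = p.σ / 16 := by rw [hΛ, ← hp.ρ_mul_len]; ring
    have hsΛ : ‖s‖ ≤ Λ := by linarith
    have huΛ : ‖u‖ ≤ Λ := by
      have e1 : ‖u‖ ≤ ‖s‖ + ‖(1 - t) • v‖ := norm_add_le _ _
      rw [norm_smul, Real.norm_of_nonneg (by linarith)] at e1
      have e2 : (1 - t) * ‖v‖ ≤ ‖v‖ := mul_le_of_le_one_left hvpos.le (by linarith)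
      rw [hs] at hv
      linarith
    set H := euclHess g 0 with hH
    -- The condition certifies curvature `-γ = -σ / 4`, up to the model error `ρ Λ = σ / 16`.
    have hcurv : ⟪v, H v⟫_ℝ ≤ -(3 / 16 * p.σ) * ‖v‖ ^ 2 := by
      unfold NCC at hN
      have e1 := (abs_le.1 (hg.abs_sub_quadratic_le hp hΛb huΛ hsΛ)).1
      rw [hρΛ] at e1
      have e2 : 1 / 2 * ⟪s - u, H (s - u)⟫_ℝ < -(p.γ / 2 - p.σ / 16 / 2) * ‖s - u‖ ^ 2 := by
        linarith
      rw [hsu, map_neg, inner_neg_neg, norm_neg, map_smul, inner_smul_left, inner_smul_right,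
        norm_smul, mul_pow, Real.norm_eq_abs, sq_abs, hp.γ_eq, conj_trivial] at e2
      have e3 : (1 - t) ^ 2 * ⟪v, H v⟫_ℝ < (1 - t) ^ 2 * (-(3 / 16 * p.σ) * ‖v‖ ^ 2) := by
        linarith
      exact (lt_of_mul_lt_mul_left e3 (sq_nonneg _)).le
    set v' := (p.s / ‖v‖) • v with hv'
    have hv'norm : ‖v'‖ = p.s := by
      rw [hv', norm_smul, Real.norm_of_nonneg (by positivity)]; field_simp
    have hcurv' : ⟪v', H v'⟫_ℝ ≤ -(3 / 16 * p.σ) * p.s ^ 2 := by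
      rw [hv', map_smul, inner_smul_left, inner_smul_right, conj_trivial, ← mul_assoc]
      have e1 := mul_le_mul_of_nonneg_left hcurv (show 0 ≤ p.s / ‖v‖ * (p.s / ‖v‖) by positivity)
      refine e1.trans_eq ?_
      field_simp
    have hplus : ‖s + v'‖ ≤ Λ := by
      have := norm_add_le s v'
      rw [hv'norm, hs] at this; linarith
    have hminus : ‖s - v'‖ ≤ Λ := by
      have := norm_sub_le s v'
      rw [hv'norm, hs] at this; linarith
    obtain ⟨n1, n2⟩ := nce_le_of_lt p g (s := s) hv
    have q1 := (abs_le.1 (hg.abs_sub_quadratic_le hp hΛb hsΛ hplus)).2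
    have q2 := (abs_le.1 (hg.abs_sub_quadratic_le hp hΛb hsΛ hminus)).2
    rw [hρΛ, add_sub_cancel_left, hv'norm] at q1
    rw [hρΛ, sub_sub_cancel_left, norm_neg, hv'norm, map_neg, inner_neg_neg, inner_neg_right] at q2
    -- Averaging the models at `s + v'` and `s - v'` cancels the first-order term. The gain is half
    -- of `3/16 - 1/16` times `σ s²`.
    have h3 : g (nce p g s v).1 ≤ g s - p.σ / 16 * p.s ^ 2 := by
      rw [← hv'] at n1 n2
      linarith
    have h4 : p.E ≤ p.σ / 16 * p.s ^ 2 := by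
      rw [hs]
      linarith
    have h5 : g s ≤ energy p g (s, v) := by
      simp only [energy]
      have : 0 ≤ 1 / (2 * p.η) * ‖v‖ ^ 2 := by positivity
      linarith
    linarith

/-- A sequence of `𝒯` accelerated gradient steps that stays close to its starting point `s₀`. -/
structure SlowRun (p : Params) (g : V → ℝ) (s₀ : V) (s v : ℕ → V) : Prop where
  s_zero : s 0 = s₀
  v_zero : v 0 = 0
  v_succ : ∀ j, v (j + 1) = s (j + 1) - s j
  s_succ : ∀ j < p.steps, s (j + 1) =
    s j + (1 - p.θ) • v j - p.η • euclGrad g (s j + (1 - p.θ) • v j)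
  dist_le : ∀ j ≤ p.steps, ‖s j - s₀‖ ≤ p.loc
  sum_le : ∑ j ∈ Finset.range p.steps, ‖v (j + 1)‖ ^ 2 ≤ p.loc ^ 2 / p.T

/-- The start has zero momentum, so its energy is its cost. If the energy drop stays below `E`,
`dist_traj_le_loc` confines the iterates far inside radius `b`: leaving the ball is then impossible,
and by `nce_le_energy_sub` so is ending through negative curvature without gaining `E`. Only a
small-gradient exit or a complete localized run remains. -/
theorem tssLoop_cases (hg : RegularModel p g) (hp : p.Valid) (perturbed : Bool) {s₀ : V}
    (hs₀ : ‖s₀‖ ≤ p.loc) :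
    g (tssLoop p g perturbed p.steps s₀ 0).1 ≤ g s₀ - p.E ∨
      (perturbed = false ∧ ‖euclGrad g (tssLoop p g perturbed p.steps s₀ 0).1‖ ≤ p.ε / 2 ∧
        g (tssLoop p g perturbed p.steps s₀ 0).1 ≤ g s₀ ∧
        ‖(tssLoop p g perturbed p.steps s₀ 0).1‖ ≤ p.b) ∨
      ∃ s v : ℕ → V, SlowRun p g s₀ s v ∧
        (perturbed = false → ∀ j < p.steps, p.ε / 2 < ‖euclGrad g (s (j + 1))‖) := by
  have hη := hp.η_pos
  have hθ := hp.θ_pos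
  have hloc := hp.loc_le
  have hlb := hp.len_le_b
  have hb := hp.b_pos
  have hlen := hp.len_pos
  have hle : ∀ z : V × V, g z.1 ≤ energy p g z := by
    intro z
    have : 0 ≤ 1 / (2 * p.η) * ‖z.2‖ ^ 2 := by positivity
    simp only [energy]; linarith
  set z : V × V := (s₀, 0) with hz
  have hz0 : energy p g z = g s₀ := by simp [energy, hz]
  obtain ⟨k, hk, hbefore, hcases⟩ := tssLoop_spec p g perturbed p.steps z
  set out := (tssLoop p g perturbed p.steps s₀ 0).1 with hout
  have hin : ∀ j ≤ k, ‖(traj p g z j).1‖ ≤ p.b := by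
    intro j hj
    rcases j with _ | j
    · simp [traj, hz]; linarith
    · have := (hbefore j (by omega)).2
      rw [Exits, not_or] at this
      exact not_lt.1 this.1
  have hok : ∀ i ≤ k, ∀ j < i, ‖(traj p g z j).1‖ ≤ p.b ∧
      ¬ NCC p g (traj p g z j).1 (extrapolate p (traj p g z j)) :=
    fun i hi j hj => ⟨hin j (by omega), (hbefore j (by omega)).1⟩
  rcases hcases with ⟨hkn, hN, ho⟩ | ⟨hkn, hN, hex, ho⟩ | ⟨hkn, ho⟩
  · left
    change out = _ at ho
    rw [ho]
    rcases le_or_gt p.E (energy p g z - energy p g (traj p g z k)) with hE | hE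
    · have h1 := nce_le p g (traj p g z k).1 (traj p g z k).2
      have h2 := hle (traj p g z k)
      linarith
    · have h1 := dist_traj_le_loc hg hp (hok k le_rfl) hk hE.le
      have h2 : ‖(traj p g z k).1‖ ≤ 2 * p.loc := by
        have := norm_sub_norm_le (traj p g z k).1 z.1
        simp only [hz] at this h1
        linarith
      have h3 := nce_le_energy_sub hg hp h2 hN
      have h4 := energy_traj_antitone hg hp (hok k le_rfl) (Nat.zero_le k)
      have h5 : energy p g (traj p g z 0) = g s₀ := hz0
      linarith
  · change out = _ at ho
    rw [ho]
    have hok' : ∀ j < k + 1, ‖(traj p g z j).1‖ ≤ p.b ∧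
        ¬ NCC p g (traj p g z j).1 (extrapolate p (traj p g z j)) := by
      intro j hj
      refine ⟨hin j (by omega), ?_⟩
      rcases Nat.lt_succ_iff_lt_or_eq.1 hj with hj | rfl
      · exact (hbefore j hj).1
      · exact hN
    have h4 := energy_traj_antitone hg hp hok' (Nat.zero_le (k + 1))
    have h5 : energy p g (traj p g z 0) = g s₀ := hz0
    have h6 := hle (traj p g z (k + 1))
    rcases le_or_gt p.E (energy p g z - energy p g (traj p g z (k + 1))) with hE | hE
    · left; linarith
    · have h1 := dist_traj_le_loc hg hp hok' (by omega) hE.le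
      have h2 : ‖(traj p g z (k + 1)).1‖ ≤ p.b := by
        have := norm_sub_norm_le (traj p g z (k + 1)).1 z.1
        simp only [hz] at this h1
        linarith
      rcases hex with hex | ⟨hex1, hex2⟩
      · exact absurd hex (not_lt.2 h2)
      · exact Or.inr (Or.inl ⟨hex1, hex2, by linarith, h2⟩)
  · change out = _ at ho
    subst hkn
    rcases le_or_gt p.E (energy p g z - energy p g (traj p g z p.steps)) with hE | hE
    · left
      rw [ho]
      linarith [hle (traj p g z p.steps)]
    · right; right
      have hEj : ∀ j ≤ p.steps, energy p g z - energy p g (traj p g z j) ≤ p.E := by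
        intro j hj
        have := energy_traj_antitone hg hp (hok _ le_rfl) hj
        linarith
      have hdist : ∀ j ≤ p.steps, ‖(traj p g z j).1 - s₀‖ ≤ p.loc := fun j hj =>
        dist_traj_le_loc hg hp (hok j hj) hj (hEj j hj)
      have hnorm : ∀ j ≤ p.steps, ‖(traj p g z j).1‖ ≤ 2 * p.loc := by
        intro j hj
        have := norm_sub_norm_le (traj p g z j).1 s₀
        linarith [hdist j hj]
      refine ⟨fun j => (traj p g z j).1, fun j => (traj p g z j).2,
        ⟨rfl, rfl, fun j => traj_succ_snd z j, ?_, hdist, ?_⟩, ?_⟩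
      · intro j hj
        -- Near the start both iterate and momentum are of size `loc`, so the cap on the
        -- extrapolation is inactive and the iteration is the plain momentum recursion.
        have hcap : extrapolate p (traj p g z j) =
            (traj p g z j).1 + (1 - p.θ) • (traj p g z j).2 := by
          have h1 : ‖(traj p g z j).2‖ ≤ 4 * p.loc := by
            rcases j with _ | j
            · simp [traj, hz]; exact hp.loc_pos.le
            · rw [traj_succ_snd]
              refine (norm_sub_le _ _).trans ?_
              linarith [hnorm (j + 1) (by omega), hnorm j (by omega)]
          have h2 : ‖(traj p g z j).1 + (1 - p.θ) • (traj p g z j).2‖ ≤ 2 * p.b := by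
            refine (norm_add_le _ _).trans ?_
            rw [norm_smul, Real.norm_of_nonneg (by linarith [hp.θ_le])]
            have : (1 - p.θ) * ‖(traj p g z j).2‖ ≤ ‖(traj p g z j).2‖ :=
              mul_le_of_le_one_left (norm_nonneg _) (by linarith)
            linarith [hnorm j (by omega)]
          rw [extrapolate, cappedTheta, if_pos h2]
        rw [traj_succ, agdStep, hcap]
      · refine (sum_sq_momentum_le hg hp (hok _ le_rfl)).trans ?_
        have h1 := mul_le_mul_of_nonneg_left hE.le (show 0 ≤ 4 * p.η / p.θ by positivity)
        refine h1.trans_eq ?_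
        rw [hp.loc_sq]
        have := hp.T_pos
        field_simp
      · intro hpert j hj
        have := (hbefore j hj).2
        rw [Exits, not_or, not_and] at this
        exact not_le.1 (this.2 hpert)

end Dichotomy

/-! ### Eigenbases of symmetric operators. -/

section Spectral

variable {V : Type*} [NormedAddCommGroup V] [InnerProductSpace ℝ V]

/-- `lam` lists the eigenvalues of `H` on the orthonormal basis `e`. -/
structure IsEigenbasis {ι : Type*} [Fintype ι] (e : OrthonormalBasis ι ℝ V) (H : V →L[ℝ] V)
    (lam : ι → ℝ) : Prop where
  inner_map : ∀ i x, ⟪e i, H x⟫_ℝ = lam i * ⟪e i, x⟫_ℝ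

theorem exists_isEigenbasis [FiniteDimensional ℝ V] {H : V →L[ℝ] V} (hH : ∀ x y : V, ⟪H x, y⟫_ℝ = ⟪x, H y⟫_ℝ) :
    ∃ (e : OrthonormalBasis (Fin (Module.finrank ℝ V)) ℝ V)
      (lam : Fin (Module.finrank ℝ V) → ℝ), IsEigenbasis e H lam ∧
      ∀ μ : ℝ, Module.End.HasEigenvalue (H : V →ₗ[ℝ] V) μ → ∃ i, lam i = μ := by
  have hsymm : (H : V →ₗ[ℝ] V).IsSymmetric := hH
  refine ⟨hsymm.eigenvectorBasis rfl, hsymm.eigenvalues rfl, ⟨fun i x => ?_⟩, fun μ hμ => ?_⟩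
  · rw [← hH]
    have := hsymm.apply_eigenvectorBasis rfl i
    change H _ = _ at this
    rw [this, inner_smul_left]
    simp
  · obtain ⟨i, hi⟩ := hsymm.exists_eigenvalues_eq rfl hμ
    exact ⟨i, hi⟩

theorem sum_sq_inner {ι : Type*} [Fintype ι] (e : OrthonormalBasis ι ℝ V) (x : V) :
    ∑ i, ⟪e i, x⟫_ℝ ^ 2 = ‖x‖ ^ 2 := by
  simpa using e.sum_sq_norm_inner_right x

theorem IsEigenbasis.abs_le {ι : Type*} [Fintype ι] {e : OrthonormalBasis ι ℝ V} {H : V →L[ℝ] V}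
    {lam : ι → ℝ} (h : IsEigenbasis e H lam) {K : ℝ} (hK : ‖H‖ ≤ K) (i : ι) : |lam i| ≤ K := by
  have h1 := h.inner_map i (e i)
  rw [real_inner_self_eq_norm_sq, e.norm_eq_one, one_pow, mul_one] at h1
  rw [← h1]
  refine (abs_real_inner_le_norm _ _).trans ?_
  have := H.le_opNorm (e i)
  rw [e.norm_eq_one] at this ⊢
  linarith

end Spectral

/-! ### Exponential decay over half a run. -/

section Numeric

/-- `N` is half of `T`, and `θ T = χ c / 4`. -/
theorem Params.Valid.pow_le_exp {p : Params} (hp : p.Valid) (N : ℕ) (hN : p.T = 2 * N) :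
    (1 - p.θ / 2) ^ N ≤ Real.exp (-(p.χ * p.c / 16)) := by
  have hθ := hp.θ_pos
  have hθ' := hp.θ_le
  have h1 : 1 - p.θ / 2 ≤ Real.exp (-(p.θ / 2)) := by
    have := Real.add_one_le_exp (-(p.θ / 2)); linarith
  refine (pow_le_pow_left₀ (by linarith) h1 N).trans_eq ?_
  rw [← Real.exp_nat_mul]
  congr 1
  have h2 : (N : ℝ) = p.T / 2 := by linarith
  rw [h2, hp.T_eq]
  field_simp; ring

/-- Because `θ⁻¹ ≤ 2 ^ χ`, any fixed power of `θ⁻¹` is absorbed by the decay once `c` is large. -/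
theorem Params.Valid.exp_neg_mul_le {p : Params} (hp : p.Valid) :
    Real.exp (-(p.χ * p.c / 16)) * p.θ⁻¹ ^ 6 ≤ 1 / 10 ^ 6 := by
  have hχ := hp.two_le_χ
  have hc := hp.le_c
  rw [cMin] at hc
  have h1 : p.θ⁻¹ ≤ Real.exp p.χ := by
    refine hp.θ_inv_le.trans ?_
    rw [← Real.exp_one_rpow]
    exact Real.rpow_le_rpow (by norm_num) (by linarith [Real.add_one_le_exp (1 : ℝ)]) (by linarith)
  have h2 : p.θ⁻¹ ^ 6 ≤ Real.exp (6 * p.χ) := by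
    have := pow_le_pow_left₀ (inv_pos.2 hp.θ_pos).le h1 6
    rwa [← Real.exp_nat_mul, Nat.cast_ofNat] at this
  have h3 : Real.exp (-(p.χ * p.c / 16)) * p.θ⁻¹ ^ 6 ≤ Real.exp (-(10 ^ 6 : ℝ)) := by
    refine (mul_le_mul_of_nonneg_left h2 (Real.exp_pos _).le).trans ?_
    rw [← Real.exp_add]
    refine Real.exp_le_exp.2 ?_
    nlinarith
  refine h3.trans ?_
  rw [Real.exp_neg, ← one_div]
  exact one_div_le_one_div_of_le (by norm_num)
    (by have := Real.add_one_le_exp (10 ^ 6 : ℝ); linarith)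

end Numeric

/-! ### Gradient components along a localized run. -/

section UnperturbedRun

variable {V : Type*} [NormedAddCommGroup V] [InnerProductSpace ℝ V] [FiniteDimensional ℝ V]
  {p : Params} {g : V → ℝ} {s v : ℕ → V}

namespace SlowRun

theorem norm_le {s₀ : V} (run : SlowRun p g s₀ s v) {j : ℕ} (hj : j ≤ p.steps) :
    ‖s j‖ ≤ ‖s₀‖ + p.loc := by
  have := norm_sub_norm_le (s j) s₀
  linarith [run.dist_le j hj]

theorem norm_momentum_le {s₀ : V} (run : SlowRun p g s₀ s v) (hp : p.Valid) {j : ℕ}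
    (hj : j ≤ p.steps) : ‖v j‖ ≤ 2 * p.loc := by
  rcases j with _ | j
  · rw [run.v_zero, norm_zero]
    linarith [hp.loc_pos]
  · rw [run.v_succ, ← sub_sub_sub_cancel_right _ _ s₀]
    refine (norm_sub_le _ _).trans ?_
    linarith [run.dist_le (j + 1) hj, run.dist_le j (by omega)]

theorem norm_extrapolate_le {s₀ : V} (run : SlowRun p g s₀ s v) (hp : p.Valid) {j : ℕ}
    (hj : j ≤ p.steps) : ‖s j + (1 - p.θ) • v j‖ ≤ ‖s₀‖ + 3 * p.loc := by
  refine (norm_add_le _ _).trans ?_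
  have hθ := hp.θ_le
  have hθ0 := hp.θ_pos
  rw [norm_smul, Real.norm_of_nonneg (by linarith)]
  have : (1 - p.θ) * ‖v j‖ ≤ ‖v j‖ := mul_le_of_le_one_left (norm_nonneg _) (by linarith)
  linarith [run.norm_momentum_le hp hj, run.norm_le hj]

/-- Each scaled gradient is `(1 - θ) v j - v (j + 1)`, and the momenta add up to the displacement.
So the average gradient is small as soon as the position and the last momentum are. -/
theorem sum_grad (run : SlowRun p g 0 s v) {n : ℕ} (hn : n ≤ p.steps) :
    p.η • ∑ j ∈ Finset.range n, euclGrad g (s j + (1 - p.θ) • v j) =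
      -((1 - p.θ) • v n) - p.θ • s n := by
  induction n with
  | zero => simp [run.v_zero, run.s_zero]
  | succ n ih =>
    rw [Finset.sum_range_succ, smul_add, ih (by omega)]
    have h1 := run.s_succ n (by omega)
    have h2 : p.η • euclGrad g (s n + (1 - p.θ) • v n) = s n + (1 - p.θ) • v n - s (n + 1) := by
      rw [h1]; abel
    rw [h2, run.v_succ]
    module

variable {ι : Type*} [Fintype ι] {e : OrthonormalBasis ι ℝ V} {lam : ι → ℝ}

/-- Deviations of the gradients along a run from the linear model: at the iterates, and at the
extrapolated points. -/
def gradDev (g : V → ℝ) (s v : ℕ → V) (j : ℕ) : V :=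
  euclGrad g (s j) - euclGrad g (s (j - 1)) - euclHess g 0 (v j)

def extraDev (p : Params) (g : V → ℝ) (s v : ℕ → V) (j : ℕ) : V :=
  euclGrad g (s j + (1 - p.θ) • v j) - euclGrad g (s j) - (1 - p.θ) • euclHess g 0 (v j)

/-- Reading the Hessian of the momentum update on an eigenvector gives the scalar recursion with `a
= η λ`. The second unknown, gradient minus `H v`, stands for the previous gradient, from which it
differs by `gradDev`. -/
theorem grad_recursion {s₀ : V} (run : SlowRun p g s₀ s v)
    (he : IsEigenbasis e (euclHess g 0) lam) (i : ι) {j : ℕ} (hj : j < p.steps) :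
    ⟪e i, euclGrad g (s (j + 1))⟫_ℝ = (1 - p.η * lam i) * ((2 - p.θ) * ⟪e i, euclGrad g (s j)⟫_ℝ -
        (1 - p.θ) * ⟪e i, euclGrad g (s j) - euclHess g 0 (v j)⟫_ℝ) +
        ⟪e i, gradDev g s v (j + 1)⟫_ℝ - p.η * lam i * ⟪e i, extraDev p g s v j⟫_ℝ := by
  have h1 : v (j + 1) = (1 - p.θ) • v j - p.η • euclGrad g (s j + (1 - p.θ) • v j) := by
    rw [run.v_succ, run.s_succ j hj]; abel
  have h2 : ⟪e i, euclHess g 0 (v (j + 1))⟫_ℝ = (1 - p.θ) * (lam i * ⟪e i, v j⟫_ℝ) -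
      p.η * (lam i * ⟪e i, euclGrad g (s j + (1 - p.θ) • v j)⟫_ℝ) := by
    rw [he.inner_map, h1, inner_sub_right, inner_smul_right, inner_smul_right]; ring
  simp only [gradDev, extraDev, inner_sub_right, inner_smul_right, h2, he.inner_map,
    Nat.add_sub_cancel]
  ring

theorem norm_gradDev_le {s₀ : V} (run : SlowRun p g s₀ s v) (hg : RegularModel p g)
    (hp : p.Valid) {r : ℝ} (hr : ‖s₀‖ + 3 * p.loc ≤ r) (hrb : r ≤ 3 * p.b) {j : ℕ}
    (hj : j < p.steps) : ‖gradDev g s v (j + 1)‖ ≤ p.ρ * r * ‖v (j + 1)‖ := by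
  have hl := hp.loc_pos
  have h1 := hg.norm_grad_sub_hess_le hp hrb (u := s (j + 1)) (u' := s j)
    (by linarith [run.norm_le (j := j + 1) hj]) (by linarith [run.norm_le hj.le])
  rw [← run.v_succ] at h1
  exact h1

theorem norm_extraDev_le {s₀ : V} (run : SlowRun p g s₀ s v) (hg : RegularModel p g)
    (hp : p.Valid) {r : ℝ} (hr : ‖s₀‖ + 3 * p.loc ≤ r) (hrb : r ≤ 3 * p.b) {j : ℕ}
    (hj : j < p.steps) : ‖extraDev p g s v j‖ ≤ p.ρ * r * ‖v j‖ := by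
  have hl := hp.loc_pos
  have hθ := hp.θ_le
  have hθ0 := hp.θ_pos
  have hρ := hp.ρ_pos
  have h1 := hg.norm_grad_sub_hess_le hp hrb (u := s j + (1 - p.θ) • v j) (u' := s j)
    (by linarith [run.norm_extrapolate_le hp hj.le]) (by linarith [run.norm_le hj.le])
  rw [add_sub_cancel_left, map_smul, norm_smul, Real.norm_of_nonneg (by linarith)] at h1
  refine h1.trans ?_
  have : 0 ≤ p.ρ * r := by
    have := norm_nonneg s₀
    exact mul_nonneg hρ.le (by linarith)
  exact mul_le_mul_of_nonneg_left
    (mul_le_of_le_one_left (norm_nonneg _) (by linarith)) this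

theorem sum_sq_dev_le {s₀ : V} (run : SlowRun p g s₀ s v) (hg : RegularModel p g)
    (hp : p.Valid) {r : ℝ} (hr : ‖s₀‖ + 3 * p.loc ≤ r) (hrb : r ≤ 3 * p.b) :
    ∑ j ∈ Finset.range p.steps, (‖gradDev g s v (j + 1)‖ ^ 2 + ‖extraDev p g s v j‖ ^ 2) ≤
      2 * (p.ρ * r) ^ 2 * (p.loc ^ 2 / p.T) := by
  have h1 : ∑ j ∈ Finset.range p.steps,
      (‖gradDev g s v (j + 1)‖ ^ 2 + ‖extraDev p g s v j‖ ^ 2) ≤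
      ∑ j ∈ Finset.range p.steps, ((p.ρ * r) ^ 2 * ‖v (j + 1)‖ ^ 2 + (p.ρ * r) ^ 2 * ‖v j‖ ^ 2) := by
    refine Finset.sum_le_sum fun j hj => ?_
    rw [Finset.mem_range] at hj
    rw [← mul_pow, ← mul_pow]
    exact add_le_add (pow_le_pow_left₀ (norm_nonneg _) (run.norm_gradDev_le hg hp hr hrb hj) 2)
      (pow_le_pow_left₀ (norm_nonneg _) (run.norm_extraDev_le hg hp hr hrb hj) 2)
  -- The index shift costs nothing because `v 0 = 0`.
  have h2 : ∑ j ∈ Finset.range p.steps, ‖v j‖ ^ 2 ≤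
      ∑ j ∈ Finset.range p.steps, ‖v (j + 1)‖ ^ 2 := by
    have e1 := Finset.sum_range_succ (fun j => ‖v j‖ ^ 2) p.steps
    have e2 := Finset.sum_range_succ' (fun j => ‖v j‖ ^ 2) p.steps
    simp only [run.v_zero, norm_zero] at e2
    have : 0 ≤ ‖v p.steps‖ ^ 2 := sq_nonneg _
    linarith
  refine h1.trans ?_
  rw [Finset.sum_add_distrib, ← Finset.mul_sum, ← Finset.mul_sum]
  have h3 := mul_le_mul_of_nonneg_left (h2.trans run.sum_le) (sq_nonneg (p.ρ * r))
  have h4 := mul_le_mul_of_nonneg_left run.sum_le (sq_nonneg (p.ρ * r))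
  linarith

/-- The components of the gradient outside the nearly flat directions. -/
theorem sq_inner_grad_le {s₀ : V} (run : SlowRun p g s₀ s v) (hg : RegularModel p g)
    (hp : p.Valid) (he : IsEigenbasis e (euclHess g 0) lam) {N : ℕ} (hN : p.steps = 2 * N)
    (i : ι) (hi : p.σ ≤ |lam i|) :
    ⟪e i, euclGrad g (s N)⟫_ℝ ^ 2 ≤ 2 * (1 - p.θ / 2) ^ N * ⟪e i, euclGrad g s₀⟫_ℝ ^ 2 +
      4 / p.θ ^ 2 * (1 - p.θ / 2) ^ N * (⟪e i, euclGrad g (s p.steps)⟫_ℝ ^ 2 +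
        ⟪e i, euclGrad g (s p.steps) - euclHess g 0 (v p.steps)⟫_ℝ ^ 2) +
      16 / p.θ * ∑ j ∈ Finset.range p.steps,
        (⟪e i, gradDev g s v (j + 1)⟫_ℝ ^ 2 + ⟪e i, extraDev p g s v j⟫_ℝ ^ 2) := by
  have hθ := hp.θ_pos
  have hθ' := hp.θ_le
  have hη := hp.η_pos
  have hησ := hp.η_mul_σ
  have hηℓ := hp.η_mul_ℓ
  have hlam := he.abs_le (hg.norm_euclHess_zero_le hp) i
  set h : ℕ → ℝ := fun j => ⟪e i, euclGrad g (s j)⟫_ℝ with hh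
  set k : ℕ → ℝ := fun j => ⟪e i, euclGrad g (s j) - euclHess g 0 (v j)⟫_ℝ with hk
  set d : ℕ → ℝ := fun j => ⟪e i, gradDev g s v j⟫_ℝ with hd
  set w : ℕ → ℝ := fun j => ⟪e i, extraDev p g s v j⟫_ℝ with hw
  have hk0 : k 0 = h 0 := by simp [hk, hh, run.v_zero]
  have hrec : ∀ j < p.steps, h (j + 1) = (1 - p.η * lam i) *
      ((2 - p.θ) * h j - (1 - p.θ) * k j) + d (j + 1) - p.η * lam i * w j :=
    fun j hj => run.grad_recursion he i hj
  have hkrec : ∀ j < p.steps, k (j + 1) = h j + d (j + 1) := by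
    intro j _
    simp only [hk, hh, hd, gradDev, inner_sub_right, Nat.add_sub_cancel]; ring
  have h00 : h 0 = ⟪e i, euclGrad g s₀⟫_ℝ := by simp only [hh, run.s_zero]
  have hS : ∑ j ∈ Finset.range N, (d (j + 1) ^ 2 + w j ^ 2) ≤
      ∑ j ∈ Finset.range p.steps, (d (j + 1) ^ 2 + w j ^ 2) :=
    Finset.sum_le_sum_of_subset_of_nonneg (Finset.range_mono (by omega))
      fun _ _ _ => by positivity
  have hS0 : 0 ≤ ∑ j ∈ Finset.range p.steps, (d (j + 1) ^ 2 + w j ^ 2) := by positivity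
  have hpow : 0 ≤ (1 - p.θ / 2) ^ N := pow_nonneg (by linarith) N
  change h N ^ 2 ≤ 2 * (1 - p.θ / 2) ^ N * ⟪e i, euclGrad g s₀⟫_ℝ ^ 2 +
      4 / p.θ ^ 2 * (1 - p.θ / 2) ^ N * (h p.steps ^ 2 + k p.steps ^ 2) +
      16 / p.θ * ∑ j ∈ Finset.range p.steps, (d (j + 1) ^ 2 + w j ^ 2)
  rw [← h00]
  -- Stable modes decay over `N` steps from the start. Saddle modes also need `N` backward steps
  -- from the end, which is why the midpoint is examined.
  rcases le_abs.1 hi with hpos | hneg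
  · have ha : 4 * p.θ ^ 2 ≤ p.η * lam i := by rw [← hησ]; gcongr
    have ha' : p.η * lam i ≤ 1 / 4 := by
      rw [← hηℓ]; gcongr; exact (le_abs_self _).trans hlam
    have h1 := sq_le_of_oscillating hθ hθ' ha ha' hk0 hrec hkrec N (by omega)
    have h2 := mul_le_mul_of_nonneg_left hS (show 0 ≤ 12 / p.θ by positivity)
    have h3 : 0 ≤ 4 / p.θ ^ 2 * (1 - p.θ / 2) ^ N * (h p.steps ^ 2 + k p.steps ^ 2) := by
      positivity
    have h4 : 12 / p.θ * ∑ j ∈ Finset.range p.steps, (d (j + 1) ^ 2 + w j ^ 2) ≤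
        16 / p.θ * ∑ j ∈ Finset.range p.steps, (d (j + 1) ^ 2 + w j ^ 2) := by
      gcongr; norm_num
    have h5 : 2 * ((1 - p.θ / 2) ^ N * h 0 ^ 2 +
        6 / p.θ * ∑ i ∈ Finset.range N, (d (i + 1) ^ 2 + w i ^ 2)) =
        2 * (1 - p.θ / 2) ^ N * h 0 ^ 2 +
          12 / p.θ * ∑ i ∈ Finset.range N, (d (i + 1) ^ 2 + w i ^ 2) := by ring
    linarith
  · have ha : p.η * lam i ≤ -(4 * p.θ ^ 2) := by
      rw [← hησ]
      have := mul_le_mul_of_nonneg_left hneg hη.le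
      linarith
    have h1 := sq_le_of_saddle hθ hθ' ha hk0 hrec hkrec (j := N) (by omega)
    rw [show p.steps - N = N by omega] at h1
    have h2 : ((1 + p.θ)⁻¹) ^ N ≤ (1 - p.θ / 2) ^ N := by
      refine pow_le_pow_left₀ (by positivity) ?_ N
      rw [inv_le_iff_one_le_mul₀ (by positivity)]
      nlinarith
    have h3 : (1 - p.θ) ^ N ≤ (1 - p.θ / 2) ^ N :=
      pow_le_pow_left₀ (by linarith) (by linarith) N
    have h4 := mul_le_mul_of_nonneg_right h3 (sq_nonneg (h 0))
    have h5 := mul_le_mul_of_nonneg_right h2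
      (show 0 ≤ 2 / p.θ ^ 2 * (h p.steps ^ 2 + k p.steps ^ 2) by positivity)
    have h6 : 4 / p.θ ^ 2 * (1 - p.θ / 2) ^ N * (h p.steps ^ 2 + k p.steps ^ 2) =
      2 * ((1 - p.θ / 2) ^ N * (2 / p.θ ^ 2 * (h p.steps ^ 2 + k p.steps ^ 2))) := by ring
    have h7 : 16 / p.θ * ∑ j ∈ Finset.range p.steps, (d (j + 1) ^ 2 + w j ^ 2) =
      2 * (8 / p.θ * ∑ j ∈ Finset.range p.steps, (d (j + 1) ^ 2 + w j ^ 2)) := by ring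
    rw [h6, h7]
    linarith

end SlowRun

end UnperturbedRun

/-! ### A localized unperturbed run has a small gradient at its midpoint. -/

section SmallGradient

variable {V : Type*} [NormedAddCommGroup V] [InnerProductSpace ℝ V] [FiniteDimensional ℝ V]
  {p : Params} {g : V → ℝ} {s v : ℕ → V}

namespace SlowRun

/-- Some momentum in the second half of a run is small. -/
theorem exists_norm_momentum_le {s₀ : V} (run : SlowRun p g s₀ s v) (hp : p.Valid) {N : ℕ}
    (hN : p.steps = 2 * N) (hN0 : 0 < N) :
    ∃ n, N ≤ n ∧ n ≤ p.steps ∧ ‖v n‖ ≤ p.θ * p.loc := by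
  have hT := hp.T_pos
  have hTN : p.T = 2 * N := by rw [← hp.steps_eq, hN]; push_cast; ring
  have hNpos : (0 : ℝ) < N := by exact_mod_cast hN0
  have h1 : ∑ j ∈ Finset.range N, ‖v (N + j + 1)‖ ^ 2 ≤ p.loc ^ 2 / p.T := by
    refine le_trans ?_ run.sum_le
    have := Finset.sum_range_add (fun j => ‖v (j + 1)‖ ^ 2) N N
    rw [hN, two_mul, this]
    have : 0 ≤ ∑ j ∈ Finset.range N, ‖v (j + 1)‖ ^ 2 := by positivity
    linarith
  have h2 : ∑ j ∈ Finset.range N, ‖v (N + j + 1)‖ ^ 2 ≤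
      ∑ _j ∈ Finset.range N, p.loc ^ 2 / p.T / N := by
    refine h1.trans_eq ?_
    rw [Finset.sum_const, Finset.card_range, nsmul_eq_mul]; field_simp
  -- Pigeonhole over the second half of the run, whose squared momenta have a small sum.
  obtain ⟨j, hj, hle⟩ := Finset.exists_le_of_sum_le
    (Finset.nonempty_range_iff.2 (by omega)) h2
  rw [Finset.mem_range] at hj
  refine ⟨N + j + 1, by omega, by omega, ?_⟩
  refine abs_le_of_sq_le_sq' ?_ (mul_nonneg hp.θ_pos.le hp.loc_pos.le) |>.2
  refine hle.trans ?_
  have h3 : p.θ * p.T ≥ 2 := by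
    have e1 : p.θ * p.T = p.χ * p.c / 4 := by
      have := hp.θ_pos
      rw [hp.T_eq]; field_simp
    have e2 := hp.two_le_χ
    have e3 := hp.le_c
    rw [cMin] at e3
    nlinarith
  have h4 : (N : ℝ) = p.T / 2 := by linarith
  rw [h4, div_div, div_le_iff₀ (by positivity)]
  have h5 : (2 : ℝ) ≤ (p.θ * p.T) ^ 2 := by nlinarith
  have h6 := mul_le_mul_of_nonneg_right h5 (sq_nonneg p.loc)
  nlinarith

variable {ι : Type*} [Fintype ι] {e : OrthonormalBasis ι ℝ V} {lam : ι → ℝ}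

/-- The gradient at an iterate is a small vector, up to the Hessian applied to a short vector. -/
theorem exists_grad_decomposition (run : SlowRun p g 0 s v) (hg : RegularModel p g)
    (hp : p.Valid) {N : ℕ} (hN : p.steps = 2 * N) (hN0 : 0 < N) :
    ∃ w x : V, euclGrad g (s N) = x + euclHess g 0 w ∧ ‖w‖ ≤ 4 * p.loc ∧
      ‖x‖ ≤ 2 * p.σ * p.loc := by
  obtain ⟨n, hNn, hn, hvn⟩ := run.exists_norm_momentum_le hp hN hN0
  have hθ := hp.θ_pos
  have hθ' := hp.θ_le
  have hη := hp.η_pos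
  have hσ := hp.σ_pos
  have hloc := hp.loc_pos
  have hlocle := hp.loc_le
  have hlen := hp.len_pos
  have hlb := hp.len_le_b
  have hnpos : (0 : ℝ) < n := by exact_mod_cast (lt_of_lt_of_le hN0 hNn)
  set u : ℕ → V := fun j => s j + (1 - p.θ) • v j with hu
  -- The midpoint gradient is split into the average gradient, small by `sum_grad`, the Hessian
  -- applied to the mean displacement `w`, and a second-order error.
  set avg : V := (n : ℝ)⁻¹ • ∑ j ∈ Finset.range n, euclGrad g (u j) with havg
  set w : V := (n : ℝ)⁻¹ • ∑ j ∈ Finset.range n, (s N - u j) with hw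
  set err : V := (n : ℝ)⁻¹ • ∑ j ∈ Finset.range n,
    (euclGrad g (s N) - euclGrad g (u j) - euclHess g 0 (s N - u j)) with herr
  have hconst : ∀ z : V, (n : ℝ)⁻¹ • ∑ _j ∈ Finset.range n, z = z := by
    intro z
    rw [Finset.sum_const, Finset.card_range, ← Nat.cast_smul_eq_nsmul ℝ, smul_smul,
      inv_mul_cancel₀ hnpos.ne', one_smul]
  have hmean : ∀ (f : ℕ → V) (B : ℝ), (∀ j < n, ‖f j‖ ≤ B) →
      ‖(n : ℝ)⁻¹ • ∑ j ∈ Finset.range n, f j‖ ≤ B := by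
    intro f B hf
    rw [norm_smul, norm_inv, Real.norm_of_nonneg hnpos.le, inv_mul_le_iff₀ hnpos]
    refine (norm_sum_le_of_le _ fun j hj => hf j (Finset.mem_range.1 hj)).trans_eq ?_
    simp
  have hun : ∀ j < n, ‖u j‖ ≤ 3 * p.loc := fun j hj => by
    simpa using run.norm_extrapolate_le hp (j := j) (by omega)
  have hsN : ‖s N‖ ≤ p.loc := by simpa using run.norm_le (j := N) (by omega)
  have hdiff : ∀ j < n, ‖s N - u j‖ ≤ 4 * p.loc := fun j hj =>
    (norm_sub_le _ _).trans (by linarith [hun j hj])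
  refine ⟨w, avg + err, ?_, hmean _ _ hdiff, ?_⟩
  · have h1 : euclHess g 0 w = (n : ℝ)⁻¹ • ∑ j ∈ Finset.range n, euclHess g 0 (s N - u j) := by
      rw [hw, map_smul, map_sum]
    rw [h1, havg, herr, ← smul_add, ← smul_add, ← Finset.sum_add_distrib,
      ← Finset.sum_add_distrib, ← hconst (euclGrad g (s N))]
    congr 1
    refine Finset.sum_congr rfl fun j _ => ?_
    rw [hconst]
    abel
  · have h1 : ‖err‖ ≤ p.σ * p.loc := by
      refine hmean _ _ fun j hj => ?_
      have e1 := hg.norm_grad_sub_hess_le hp (r := 3 * p.loc) (by linarith)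
        (u := s N) (u' := u j) (by linarith) (hun j hj)
      refine e1.trans ?_
      have hρ := hp.ρ_pos
      calc p.ρ * (3 * p.loc) * ‖s N - u j‖
          ≤ p.ρ * (3 * (p.len / 10 ^ 20)) * (4 * p.loc) := by
            gcongr
            exact hdiff j hj
        _ = p.ρ * p.len * (12 / 10 ^ 20) * p.loc := by ring
        _ ≤ p.σ * 1 * p.loc := by rw [hp.ρ_mul_len]; gcongr; norm_num
        _ = p.σ * p.loc := by ring
    have h2 : ‖avg‖ ≤ p.σ * p.loc := by
      have e1 := run.sum_grad hn
      have e2 : p.η * n * ‖avg‖ ≤ 2 * p.θ * p.loc := by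
        have f1 : (p.η * n) • avg = -((1 - p.θ) • v n) - p.θ • s n := by
          rw [← e1, havg, smul_smul, mul_assoc, mul_inv_cancel₀ hnpos.ne', mul_one]
        have f2 : ‖(p.η * n) • avg‖ = p.η * n * ‖avg‖ := by
          rw [norm_smul, Real.norm_of_nonneg (by positivity)]
        rw [← f2, f1]
        refine (norm_sub_le _ _).trans ?_
        rw [norm_neg, norm_smul, norm_smul, Real.norm_of_nonneg hθ.le,
          Real.norm_of_nonneg (by linarith)]
        have f3 : (1 - p.θ) * ‖v n‖ ≤ ‖v n‖ := mul_le_of_le_one_left (norm_nonneg _) (by linarith)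
        have f4 : p.θ * ‖s n‖ ≤ p.θ * p.loc :=
          mul_le_mul_of_nonneg_left (by simpa using run.norm_le hn) hθ.le
        linarith
      -- This is where `n ≥ T / 2` matters: dividing the telescoped sum by `η n` must leave only `σ
      -- loc`.
      have e3 : 2 * p.θ / p.σ ≤ p.η * n := by
        have f1 : p.T / 2 ≤ n := by
          rw [← hp.steps_eq, hN]
          have : (N : ℝ) ≤ n := by exact_mod_cast hNn
          push_cast; linarith
        have f2 : p.η * (p.T / 2) = 2 * p.θ / p.σ * (p.χ * p.c / 8 * 2) := by
          rw [hp.T_eq, hp.η_eq]; field_simp; norm_num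
        have f3 : 1 ≤ p.χ * p.c / 8 * 2 := by
          have g2 := hp.two_le_χ
          have g3 := hp.le_c
          rw [cMin] at g3
          nlinarith
        calc 2 * p.θ / p.σ ≤ 2 * p.θ / p.σ * (p.χ * p.c / 8 * 2) :=
              le_mul_of_one_le_right (by positivity) f3
          _ = p.η * (p.T / 2) := f2.symm
          _ ≤ p.η * n := by gcongr
      have e4 : 2 * p.θ / p.σ * ‖avg‖ ≤ 2 * p.θ / p.σ * (p.σ * p.loc) := by
        refine (mul_le_mul_of_nonneg_right e3 (norm_nonneg _)).trans (e2.trans_eq ?_)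
        field_simp
      exact le_of_mul_le_mul_left e4 (by positivity)
    exact (norm_add_le _ _).trans (by linarith)

set_option maxHeartbeats 800000 in
/-- In the middle of an unperturbed run that stays close to its start, the gradient is small. -/
theorem norm_grad_le (run : SlowRun p g 0 s v) (hg : RegularModel p g)
    (hp : p.Valid) (h0 : ‖euclGrad g 0‖ ≤ 2 * p.ℓ * p.M) {N : ℕ} (hN : p.steps = 2 * N)
    (hN0 : 0 < N) : ‖euclGrad g (s N)‖ ≤ p.ε / 2 := by
  obtain ⟨e, lam, he, -⟩ := exists_isEigenbasis (inner_euclHess_comm hg.contDiff 0)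
  obtain ⟨w, x, hdec, hw, hx⟩ := run.exists_grad_decomposition hg hp hN hN0
  have hθ := hp.θ_pos
  have hθ' := hp.θ_le
  have hσ := hp.σ_pos
  have hloc := hp.loc_pos
  have hlocle := hp.loc_le
  have hlen := hp.len_pos
  have hlb := hp.len_le_b
  have hε := hp.ε_eq
  have hεpos := hp.ε_pos
  have hb := hp.b_pos
  have hpow : 0 ≤ (1 - p.θ / 2) ^ N := pow_nonneg (by linarith) N
  set k : V := euclGrad g (s p.steps) - euclHess g 0 (v p.steps) with hk
  -- Steep modes use the decay estimate. In flat modes `|λ| < σ`, so the Hessian applied to `w`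
  -- contributes at most `σ` times a component of `w`. One common bound allows summation over the
  -- basis by Parseval.
  have hcomp : ∀ i, ⟪e i, euclGrad g (s N)⟫_ℝ ^ 2 ≤
      2 * (1 - p.θ / 2) ^ N * ⟪e i, euclGrad g 0⟫_ℝ ^ 2 +
      4 / p.θ ^ 2 * (1 - p.θ / 2) ^ N * (⟪e i, euclGrad g (s p.steps)⟫_ℝ ^ 2 + ⟪e i, k⟫_ℝ ^ 2) +
      16 / p.θ * ∑ j ∈ Finset.range p.steps,
        (⟪e i, gradDev g s v (j + 1)⟫_ℝ ^ 2 + ⟪e i, extraDev p g s v j⟫_ℝ ^ 2) +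
      2 * (⟪e i, x⟫_ℝ ^ 2 + p.σ ^ 2 * ⟪e i, w⟫_ℝ ^ 2) := by
    intro i
    rcases le_or_gt p.σ |lam i| with hi | hi
    · have h1 := run.sq_inner_grad_le hg hp he hN i hi
      have h2 : 0 ≤ 2 * (⟪e i, x⟫_ℝ ^ 2 + p.σ ^ 2 * ⟪e i, w⟫_ℝ ^ 2) := by positivity
      linarith
    · have h1 : ⟪e i, euclGrad g (s N)⟫_ℝ = ⟪e i, x⟫_ℝ + lam i * ⟪e i, w⟫_ℝ := by
        rw [hdec, inner_add_right, he.inner_map]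
      have h2 : (lam i * ⟪e i, w⟫_ℝ) ^ 2 ≤ p.σ ^ 2 * ⟪e i, w⟫_ℝ ^ 2 := by
        rw [mul_pow]
        refine mul_le_mul_of_nonneg_right ?_ (sq_nonneg _)
        rw [← sq_abs]
        exact pow_le_pow_left₀ (abs_nonneg _) hi.le 2
      have h3 : 0 ≤ 2 * (1 - p.θ / 2) ^ N * ⟪e i, euclGrad g 0⟫_ℝ ^ 2 := by positivity
      have h4 : 0 ≤ 4 / p.θ ^ 2 * (1 - p.θ / 2) ^ N *
          (⟪e i, euclGrad g (s p.steps)⟫_ℝ ^ 2 + ⟪e i, k⟫_ℝ ^ 2) := by positivity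
      have h5 : 0 ≤ 16 / p.θ * ∑ j ∈ Finset.range p.steps,
        (⟪e i, gradDev g s v (j + 1)⟫_ℝ ^ 2 + ⟪e i, extraDev p g s v j⟫_ℝ ^ 2) := by positivity
      rw [h1]
      nlinarith [sq_nonneg (⟪e i, x⟫_ℝ - lam i * ⟪e i, w⟫_ℝ)]
  have hsum := Finset.sum_le_sum fun i (_ : i ∈ Finset.univ) => hcomp i
  rw [sum_sq_inner] at hsum
  simp only [Finset.sum_add_distrib, ← Finset.mul_sum] at hsum
  rw [Finset.sum_comm, Finset.sum_comm (s := Finset.univ)] at hsum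
  simp only [sum_sq_inner] at hsum
  rw [← Finset.sum_add_distrib] at hsum
  -- the individual contributions
  have hG0 : ‖euclGrad g 0‖ ≤ p.ε * p.θ⁻¹ := by
    refine h0.trans ?_
    rw [hp.two_ℓ_M_eq, ← hε, div_eq_mul_inv, mul_inv]
    have : p.c⁻¹ ≤ 1 := hp.inv_c_le.trans (by norm_num)
    have : p.ε * p.c⁻¹ * (2⁻¹ * p.θ⁻¹) ≤ p.ε * 1 * (1 * p.θ⁻¹) := by
      have := hp.inv_c_pos
      gcongr; norm_num
    linarith
  have hθinv : 1 ≤ p.θ⁻¹ := (one_le_inv₀ hθ).2 (by linarith)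
  have hℓloc : p.ℓ * p.loc ≤ p.ε * p.θ⁻¹ ^ 2 := by
    have h1 : p.ℓ = p.σ * p.θ⁻¹ ^ 2 / 16 := by rw [hp.ℓ_eq]; field_simp
    rw [h1, hε]
    have h2 : p.loc ≤ p.len := by linarith
    have : p.σ * p.θ⁻¹ ^ 2 / 16 * p.loc ≤ p.σ * p.θ⁻¹ ^ 2 / 1 * p.len := by
      gcongr; norm_num
    linarith
  have hGT : ‖euclGrad g (s p.steps)‖ ≤ 2 * (p.ε * p.θ⁻¹ ^ 2) := by
    have h1 : ‖s p.steps‖ ≤ p.loc := by simpa using run.norm_le (j := p.steps) le_rfl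
    have h2 := hg.grad_lipschitz (s p.steps) (by simp; linarith) 0 (by simp; positivity)
    rw [sub_zero] at h2
    have h3 := norm_sub_norm_le (euclGrad g (s p.steps)) (euclGrad g 0)
    have h4 := mul_le_mul_of_nonneg_left h1 hp.ℓ_pos.le
    have h5 : p.ε * p.θ⁻¹ ≤ p.ε * p.θ⁻¹ ^ 2 := by
      refine mul_le_mul_of_nonneg_left ?_ hεpos.le
      nlinarith
    linarith
  have hkT : ‖k‖ ≤ 4 * (p.ε * p.θ⁻¹ ^ 2) := by
    have h1 := (euclHess g 0).le_of_opNorm_le (hg.norm_euclHess_zero_le hp) (v p.steps)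
    have h2 := mul_le_mul_of_nonneg_left (run.norm_momentum_le hp le_rfl) hp.ℓ_pos.le
    refine (norm_sub_le _ _).trans ?_
    linarith
  -- The sixth power is the worst loss: `θ⁻²` from the backward estimate times the square of the
  -- `θ⁻²` in the bound on the final gradient.
  have hexp : (1 - p.θ / 2) ^ N * p.θ⁻¹ ^ 6 ≤ 1 / 10 ^ 6 := by
    have hTN : p.T = 2 * N := by rw [← hp.steps_eq, hN]; push_cast; ring
    exact (mul_le_mul_of_nonneg_right (hp.pow_le_exp N hTN) (by positivity)).trans
      hp.exp_neg_mul_le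
  have c1 : 2 * (1 - p.θ / 2) ^ N * ‖euclGrad g 0‖ ^ 2 ≤ p.ε ^ 2 / 100 := by
    have h1 := pow_le_pow_left₀ (norm_nonneg _) hG0 2
    have h2 : (1 - p.θ / 2) ^ N * ‖euclGrad g 0‖ ^ 2 ≤
        p.ε ^ 2 * ((1 - p.θ / 2) ^ N * p.θ⁻¹ ^ 6) := by
      refine (mul_le_mul_of_nonneg_left h1 hpow).trans ?_
      have h3 : p.θ⁻¹ ^ 2 ≤ p.θ⁻¹ ^ 6 := pow_le_pow_right₀ hθinv (by norm_num)
      calc (1 - p.θ / 2) ^ N * (p.ε * p.θ⁻¹) ^ 2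
          = p.ε ^ 2 * ((1 - p.θ / 2) ^ N * p.θ⁻¹ ^ 2) := by ring
        _ ≤ _ := by gcongr
    have h3 := mul_le_mul_of_nonneg_left hexp (sq_nonneg p.ε)
    linarith [sq_nonneg p.ε]
  have c2 : 4 / p.θ ^ 2 * (1 - p.θ / 2) ^ N * (‖euclGrad g (s p.steps)‖ ^ 2 + ‖k‖ ^ 2) ≤
      p.ε ^ 2 / 100 := by
    have h1 := pow_le_pow_left₀ (norm_nonneg _) hGT 2
    have h2 := pow_le_pow_left₀ (norm_nonneg _) hkT 2
    have h3 : 4 / p.θ ^ 2 * (1 - p.θ / 2) ^ N * (‖euclGrad g (s p.steps)‖ ^ 2 + ‖k‖ ^ 2) ≤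
        4 / p.θ ^ 2 * (1 - p.θ / 2) ^ N *
          ((2 * (p.ε * p.θ⁻¹ ^ 2)) ^ 2 + (4 * (p.ε * p.θ⁻¹ ^ 2)) ^ 2) :=
      mul_le_mul_of_nonneg_left (add_le_add h1 h2) (by positivity)
    have h4 : 4 / p.θ ^ 2 * (1 - p.θ / 2) ^ N *
          ((2 * (p.ε * p.θ⁻¹ ^ 2)) ^ 2 + (4 * (p.ε * p.θ⁻¹ ^ 2)) ^ 2) =
        80 * p.ε ^ 2 * ((1 - p.θ / 2) ^ N * p.θ⁻¹ ^ 6) := by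
      rw [div_eq_mul_inv, ← inv_pow]; ring
    have h5 := mul_le_mul_of_nonneg_left hexp (show 0 ≤ 80 * p.ε ^ 2 by positivity)
    linarith [sq_nonneg p.ε]
  have hσloc : p.σ * p.loc ≤ p.ε / 10 ^ 20 := by
    rw [hε]
    have := mul_le_mul_of_nonneg_left hlocle hσ.le
    linarith
  have c3 : 16 / p.θ * ∑ j ∈ Finset.range p.steps,
      (‖gradDev g s v (j + 1)‖ ^ 2 + ‖extraDev p g s v j‖ ^ 2) ≤ p.ε ^ 2 / 100 := by
    have h1 := run.sum_sq_dev_le hg hp (r := 3 * p.loc) (by simp) (by linarith)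
    have h2 := mul_le_mul_of_nonneg_left h1 (show 0 ≤ 16 / p.θ by positivity)
    refine h2.trans ?_
    have hθT : 2 ≤ p.θ * p.T := by
      have e1 : p.θ * p.T = p.χ * p.c / 4 := by rw [hp.T_eq]; field_simp
      have e2 := hp.two_le_χ
      have e3 := hp.le_c
      rw [cMin] at e3
      nlinarith
    have hTpos := hp.T_pos
    have h3 : 16 / p.θ * (2 * (p.ρ * (3 * p.loc)) ^ 2 * (p.loc ^ 2 / p.T)) =
        288 * (p.ρ * p.loc) ^ 2 * p.loc ^ 2 * (1 / (p.θ * p.T)) := by field_simp; ring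
    have h4 : p.ρ * p.loc ≤ p.σ := by
      rw [← hp.ρ_mul_len]
      exact mul_le_mul_of_nonneg_left (by linarith) hp.ρ_pos.le
    have h5 : 1 / (p.θ * p.T) ≤ 1 := by
      rw [div_le_one (by positivity)]; linarith
    have hρ := hp.ρ_pos
    rw [h3]
    calc 288 * (p.ρ * p.loc) ^ 2 * p.loc ^ 2 * (1 / (p.θ * p.T))
        ≤ 288 * p.σ ^ 2 * p.loc ^ 2 * 1 := by gcongr
      _ = 288 * (p.σ * p.loc) ^ 2 := by ring
      _ ≤ 288 * (p.ε / 10 ^ 20) ^ 2 := by gcongr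
      _ ≤ p.ε ^ 2 / 100 := by
        rw [div_pow]
        linarith [sq_nonneg p.ε]
  have c4 : 2 * (‖x‖ ^ 2 + p.σ ^ 2 * ‖w‖ ^ 2) ≤ p.ε ^ 2 / 100 := by
    have h1 := pow_le_pow_left₀ (norm_nonneg _) hx 2
    have h2 := pow_le_pow_left₀ (norm_nonneg _) hw 2
    have h3 := mul_le_mul_of_nonneg_left h2 (sq_nonneg p.σ)
    have h4 := pow_le_pow_left₀ (by positivity) hσloc 2
    rw [div_pow] at h4
    nlinarith [sq_nonneg p.ε]
  refine abs_le_of_sq_le_sq' ?_ (by positivity) |>.2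
  have h6 : (p.ε / 2) ^ 2 = p.ε ^ 2 / 4 := by ring
  rw [h6]
  linarith [sq_nonneg p.ε]

end SlowRun

/-- An unperturbed run with a moderate initial gradient decreases the cost by `ℰ` or ends at an
approximate critical point. -/
theorem tss_none_decrease (hg : RegularModel p g) (hp : p.Valid)
    (h0 : ‖euclGrad g 0‖ ≤ 2 * p.ℓ * p.M) :
    g (tss p g none).1 ≤ g 0 - p.E ∨
      (‖euclGrad g (tss p g none).1‖ ≤ p.ε / 2 ∧ g (tss p g none).1 ≤ g 0 ∧
        ‖(tss p g none).1‖ ≤ p.b) := by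
  rcases tssLoop_cases hg hp false (s₀ := (0 : V)) (by simpa using hp.loc_pos.le) with
    h | ⟨-, h⟩ | ⟨s, v, run, hgrad⟩
  · exact Or.inl h
  · exact Or.inr h
  · exfalso
    -- The midpoint `2 m` is a positive index, so it is one of the iterates at which the stopping
    -- test was made and failed.
    obtain ⟨m, hm, hsteps⟩ := hp.exists_steps
    have h1 := run.norm_grad_le hg hp h0 (N := 2 * m) (by omega) (by omega)
    have h2 := hgrad rfl (2 * m - 1) (by omega)
    rw [show 2 * m - 1 + 1 = 2 * m by omega] at h2
    linarith

end SmallGradient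

/-! ### A norm adapted to the linearized momentum iteration. -/

section Coupling

variable {V : Type*} [NormedAddCommGroup V] [InnerProductSpace ℝ V]
  {ι : Type*} [Fintype ι]

/-- The operator that is diagonal with entries `φ` in the orthonormal basis `e`. -/
def diagOp (e : OrthonormalBasis ι ℝ V) (φ : ι → ℝ) : V →ₗ[ℝ] V :=
  ∑ i, φ i • (innerₛₗ ℝ (e i)).smulRight (e i)

theorem inner_diagOp (e : OrthonormalBasis ι ℝ V) (φ : ι → ℝ) (i : ι) (x : V) :
    ⟪e i, diagOp e φ x⟫_ℝ = φ i * ⟪e i, x⟫_ℝ := by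
  classical
  simp only [diagOp, LinearMap.sum_apply, LinearMap.smul_apply, LinearMap.smulRight_apply,
    inner_sum, inner_smul_right, innerₛₗ_apply_apply]
  rw [Finset.sum_eq_single i]
  · rw [real_inner_self_eq_norm_sq, e.norm_eq_one]; ring
  · intro j _ hj
    rw [e.orthonormal.2 hj.symm]; ring
  · simp

theorem sq_norm_diagOp (e : OrthonormalBasis ι ℝ V) (φ : ι → ℝ) (x : V) :
    ‖diagOp e φ x‖ ^ 2 = ∑ i, (φ i * ⟪e i, x⟫_ℝ) ^ 2 := by
  rw [← sum_sq_inner e]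
  simp only [inner_diagOp]

theorem norm_diagOp_le (e : OrthonormalBasis ι ℝ V) {φ ψ : ι → ℝ} {C : ℝ} (hC : 0 ≤ C)
    {x y : V} (h : ∀ i, |φ i * ⟪e i, x⟫_ℝ| ≤ C * |ψ i * ⟪e i, y⟫_ℝ|) :
    ‖diagOp e φ x‖ ≤ C * ‖diagOp e ψ y‖ := by
  refine abs_le_of_sq_le_sq' ?_ (by positivity) |>.2
  rw [mul_pow, sq_norm_diagOp, sq_norm_diagOp, Finset.mul_sum]
  refine Finset.sum_le_sum fun i _ => ?_
  rw [← sq_abs, ← sq_abs (ψ i * _), ← mul_pow]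
  exact pow_le_pow_left₀ (abs_nonneg _) (h i) 2

theorem norm_diagOp_le_norm (e : OrthonormalBasis ι ℝ V) {φ : ι → ℝ} {C : ℝ} (hC : 0 ≤ C)
    (h : ∀ i, |φ i| ≤ C) (x : V) : ‖diagOp e φ x‖ ≤ C * ‖x‖ := by
  refine abs_le_of_sq_le_sq' ?_ (by positivity) |>.2
  rw [mul_pow, sq_norm_diagOp, ← sum_sq_inner e x, Finset.mul_sum]
  refine Finset.sum_le_sum fun i _ => ?_
  rw [mul_pow, ← sq_abs]
  exact mul_le_mul_of_nonneg_right (pow_le_pow_left₀ (abs_nonneg _) (h i) 2) (sq_nonneg _)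

/-- Indicators of the nonnegative and of the negative eigenvalues. -/
def posPart (lam : ι → ℝ) (i : ι) : ℝ := if 0 ≤ lam i then 1 else 0

def negPart (lam : ι → ℝ) (i : ι) : ℝ := if 0 ≤ lam i then 0 else 1

/-- Square roots of the nonnegative eigenvalues of the scaled operator. -/
def sqrtPart (η : ℝ) (lam : ι → ℝ) (i : ι) : ℝ := if 0 ≤ lam i then √(η * lam i) else 0

/-- A norm on pairs (position, velocity) that grows at most as fast as the most unstable mode. -/
def coupleNorm (e : OrthonormalBasis ι ℝ V) (lam : ι → ℝ) (θ β η : ℝ) (x y : V) : ℝ :=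
  θ * ‖diagOp e (posPart lam) x‖ +
    ‖WithLp.toLp 2 (diagOp e (posPart lam) y, diagOp e (sqrtPart η lam) x)‖ +
    β * ‖diagOp e (negPart lam) x‖ + (1 - β) * ‖diagOp e (negPart lam) y‖

theorem sq_norm_toLp_prod {V : Type*} [NormedAddCommGroup V] (a b : V) :
    ‖WithLp.toLp 2 (a, b)‖ ^ 2 = ‖a‖ ^ 2 + ‖b‖ ^ 2 := by
  rw [WithLp.prod_norm_sq_eq_of_L2]
  rfl

variable {e : OrthonormalBasis ι ℝ V} {lam : ι → ℝ} {θ α β η : ℝ}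

theorem coupleNorm_add_le (hθ : 0 ≤ θ) (hβ : 0 ≤ β) (hβ1 : β ≤ 1) (x y x' y' : V) :
    coupleNorm e lam θ β η (x + x') (y + y') ≤
      coupleNorm e lam θ β η x y + coupleNorm e lam θ β η x' y' := by
  unfold coupleNorm
  simp only [map_add]
  have h1 := mul_le_mul_of_nonneg_left
    (norm_add_le (diagOp e (posPart lam) x) (diagOp e (posPart lam) x')) hθ
  have h2 := norm_add_le
    (WithLp.toLp 2 (diagOp e (posPart lam) y, diagOp e (sqrtPart η lam) x))
    (WithLp.toLp 2 (diagOp e (posPart lam) y', diagOp e (sqrtPart η lam) x'))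
  have h3 := mul_le_mul_of_nonneg_left
    (norm_add_le (diagOp e (negPart lam) x) (diagOp e (negPart lam) x')) hβ
  have h4 := mul_le_mul_of_nonneg_left
    (norm_add_le (diagOp e (negPart lam) y) (diagOp e (negPart lam) y'))
    (show 0 ≤ 1 - β by linarith)
  rw [← WithLp.toLp_add, Prod.mk_add_mk] at h2
  linarith

theorem norm_pos_le : ∀ x : V, ‖diagOp e (posPart lam) x‖ ≤ ‖x‖ := fun x => by
  have := norm_diagOp_le_norm e (φ := posPart lam) zero_le_one
    (fun i => by unfold posPart; split_ifs <;> simp) x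
  linarith

theorem norm_neg_le : ∀ x : V, ‖diagOp e (negPart lam) x‖ ≤ ‖x‖ := fun x => by
  have := norm_diagOp_le_norm e (φ := negPart lam) zero_le_one
    (fun i => by unfold negPart; split_ifs <;> simp) x
  linarith

theorem norm_sqrtPart_le (hlam : ∀ i, η * lam i ≤ 1 / 4) (x : V) :
    ‖diagOp e (sqrtPart η lam) x‖ ≤ 1 / 2 * ‖x‖ := by
  refine norm_diagOp_le_norm e (by norm_num) (fun i => ?_) x
  unfold sqrtPart
  split_ifs
  · rw [abs_of_nonneg (Real.sqrt_nonneg _), Real.sqrt_le_left (by norm_num)]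
    norm_num
    linarith [hlam i]
  · simp

theorem norm_le_add (x : V) :
    ‖x‖ ≤ ‖diagOp e (posPart lam) x‖ + ‖diagOp e (negPart lam) x‖ := by
  have h : x = diagOp e (posPart lam) x + diagOp e (negPart lam) x := by
    refine InnerProductSpace.ext_inner_left_basis e.toBasis fun i => ?_
    rw [e.coe_toBasis, inner_add_right, inner_diagOp, inner_diagOp, posPart, negPart]
    split_ifs <;> ring
  conv_lhs => rw [h]
  exact norm_add_le _ _

/-- Used for the nonlinear error, which enters position and momentum equally. The weights `β` and `1
- β` then add up to one. -/
theorem coupleNorm_diag_le (hθ : 0 ≤ θ) (hθ' : θ ≤ 1 / 5)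
    (hlam : ∀ i, η * lam i ≤ 1 / 4) (d : V) : coupleNorm e lam θ β η d d ≤ 3 * ‖d‖ := by
  have h1 := norm_pos_le (e := e) (lam := lam) d
  have h2 := norm_neg_le (e := e) (lam := lam) d
  have h3 := norm_sqrtPart_le (e := e) hlam d
  have h4 : ‖WithLp.toLp 2 (diagOp e (posPart lam) d, diagOp e (sqrtPart η lam) d)‖ ≤
      3 / 2 * ‖d‖ := by
    refine abs_le_of_sq_le_sq' ?_ (by positivity) |>.2
    rw [sq_norm_toLp_prod]
    nlinarith [norm_nonneg d, norm_nonneg (diagOp e (posPart lam) d),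
      norm_nonneg (diagOp e (sqrtPart η lam) d)]
  unfold coupleNorm
  nlinarith [norm_nonneg d, norm_nonneg (diagOp e (posPart lam) d),
    norm_nonneg (diagOp e (negPart lam) d)]

/-- The factor `θ` is lost because positions in nonnegative modes are guaranteed only the weight
`θ`. -/
theorem norm_add_norm_le_coupleNorm (hθ : 0 < θ) (hθ' : θ ≤ 1 / 5) (hβ : θ ≤ β)
    (hβ1 : θ ≤ 1 - β) (x y : V) :
    θ * (‖x‖ + ‖y‖) ≤ 2 * coupleNorm e lam θ β η x y := by
  have h1 := norm_le_add (e := e) (lam := lam) x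
  have h2 := norm_le_add (e := e) (lam := lam) y
  have h3 : ‖diagOp e (posPart lam) y‖ ≤
      ‖WithLp.toLp 2 (diagOp e (posPart lam) y, diagOp e (sqrtPart η lam) x)‖ := by
    refine abs_le_of_sq_le_sq' ?_ (norm_nonneg _) |>.2
    rw [sq_norm_toLp_prod]
    linarith [sq_nonneg ‖diagOp e (sqrtPart η lam) x‖]
  have h4 := mul_le_mul_of_nonneg_left h1 hθ.le
  have h5 := mul_le_mul_of_nonneg_left h2 hθ.le
  have h6 := mul_le_mul_of_nonneg_right hβ (norm_nonneg (diagOp e (negPart lam) x))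
  have h7 := mul_le_mul_of_nonneg_right hβ1 (norm_nonneg (diagOp e (negPart lam) y))
  have h8 : θ * ‖diagOp e (posPart lam) y‖ ≤ ‖diagOp e (posPart lam) y‖ :=
    mul_le_of_le_one_left (norm_nonneg _) (by linarith)
  have h9 := mul_nonneg hθ.le (norm_nonneg (diagOp e (posPart lam) x))
  have h10 := mul_nonneg (hθ.le.trans hβ) (norm_nonneg (diagOp e (negPart lam) x))
  have h11 := mul_nonneg (hθ.le.trans hβ1) (norm_nonneg (diagOp e (negPart lam) y))
  unfold coupleNorm
  have h12 := norm_nonneg (WithLp.toLp 2 (diagOp e (posPart lam) y, diagOp e (sqrtPart η lam) x))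
  linarith

/-- Growth of the norm in one step of the linear recursion. -/
theorem coupleNorm_step_le {H : V →L[ℝ] V} (he : IsEigenbasis e H lam) (hη : 0 < η) (hθ : 0 < θ)
    (hθ' : θ ≤ 1 / 5) {A : ℝ} (hα : θ ≤ α) (hβ : θ ≤ β) (hβ1 : β < 1) (hαβ : α * β = A)
    (hd : α - β = -θ + (2 - θ) * A) (hlam : ∀ i, η * lam i ≤ 1 / 4) (hA : ∀ i, -A ≤ η * lam i)
    (x y : V) :
    coupleNorm e lam θ β η (x + (1 - θ) • y - η • H (x + (1 - θ) • y))
        ((1 - θ) • y - η • H (x + (1 - θ) • y)) ≤ (1 + α) * coupleNorm e lam θ β η x y := by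
  set q := x + (1 - θ) • y with hq
  have hA0 : 0 < A := by rw [← hαβ]; exact mul_pos (by linarith) (by linarith)
  have hprod : (1 + α) * (1 - β) = (1 - θ) * (1 + A) := by nlinarith
  have hqi : ∀ i, ⟪e i, q⟫_ℝ = ⟪e i, x⟫_ℝ + (1 - θ) * ⟪e i, y⟫_ℝ := fun i => by
    rw [hq, inner_add_right, inner_smul_right]
  have hx' : ∀ i, ⟪e i, q - η • H q⟫_ℝ = (1 - η * lam i) * ⟪e i, q⟫_ℝ := fun i => by
    rw [inner_sub_right, inner_smul_right, he.inner_map]; ring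
  have hy' : ∀ i, ⟪e i, (1 - θ) • y - η • H q⟫_ℝ = (1 - θ) * ⟪e i, y⟫_ℝ -
      η * lam i * ⟪e i, q⟫_ℝ := fun i => by
    rw [inner_sub_right, inner_smul_right, inner_smul_right, he.inner_map]; ring
  -- nonnegative part
  have hN : ‖WithLp.toLp 2 (diagOp e (posPart lam) ((1 - θ) • y - η • H q),
      diagOp e (sqrtPart η lam) (q - η • H q))‖ ≤
      ‖WithLp.toLp 2 (diagOp e (posPart lam) y, diagOp e (sqrtPart η lam) x)‖ := by
    refine abs_le_of_sq_le_sq' ?_ (norm_nonneg _) |>.2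
    rw [sq_norm_toLp_prod, sq_norm_toLp_prod]
    simp only [sq_norm_diagOp]
    rw [← Finset.sum_add_distrib, ← Finset.sum_add_distrib]
    refine Finset.sum_le_sum fun i _ => ?_
    rw [hx', hy', hqi]
    unfold posPart sqrtPart
    split_ifs with hi
    · have ha : 0 ≤ η * lam i := mul_nonneg hη.le hi
      set a := η * lam i with ha'
      have ha4 := hlam i
      have hsq : ∀ Z : ℝ, (√a * Z) ^ 2 = a * Z ^ 2 := fun Z => by rw [mul_pow, Real.sq_sqrt ha]
      rw [hsq, hsq, one_mul, one_mul]
      set X := ⟪e i, x⟫_ℝ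
      set Y := ⟪e i, y⟫_ℝ
      have e1 : ((1 - θ) * Y) ^ 2 ≤ Y ^ 2 := by
        rw [mul_pow]; exact mul_le_of_le_one_left (sq_nonneg _) (by nlinarith)
      -- The harmonic energy of a nonnegative mode does not increase: its loss is a sum of
      -- nonnegative terms.
      have e2 : Y ^ 2 + a * X ^ 2 - ((((1 - θ) * Y - a * (X + (1 - θ) * Y)) ^ 2 +
          a * ((1 - a) * (X + (1 - θ) * Y)) ^ 2)) =
          (Y ^ 2 - ((1 - θ) * Y) ^ 2) + a * (a * (1 - a) * (X + (1 - θ) * Y) ^ 2) +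
            a * ((1 - θ) * Y) ^ 2 := by ring
      have e3 : 0 ≤ a * (a * (1 - a) * (X + (1 - θ) * Y) ^ 2) :=
        mul_nonneg ha (mul_nonneg (mul_nonneg ha (by linarith)) (sq_nonneg _))
      have e4 : 0 ≤ a * ((1 - θ) * Y) ^ 2 := mul_nonneg ha (sq_nonneg _)
      linarith
    · simp
  -- Positions may drift by the momentum norm. With weight `θ ≤ α` this drift fits within the
  -- allowed growth.
  have hPx : ‖diagOp e (posPart lam) (q - η • H q)‖ ≤ ‖diagOp e (posPart lam) x‖ +
      ‖WithLp.toLp 2 (diagOp e (posPart lam) y, diagOp e (sqrtPart η lam) x)‖ := by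
    have e1 : q - η • H q = x + ((1 - θ) • y - η • H q) := by rw [hq]; abel
    rw [e1, map_add]
    refine (norm_add_le _ _).trans (add_le_add le_rfl (le_trans ?_ hN))
    refine abs_le_of_sq_le_sq' ?_ (norm_nonneg _) |>.2
    rw [sq_norm_toLp_prod]
    linarith [sq_nonneg ‖diagOp e (sqrtPart η lam) (q - η • H q)‖]
  -- negative part
  have hneg1 : ‖diagOp e (negPart lam) (q - η • H q)‖ ≤ (1 + A) * ‖diagOp e (negPart lam) q‖ := by
    refine norm_diagOp_le e (by linarith) fun i => ?_
    rw [hx']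
    unfold negPart
    split_ifs with hi
    · simp
    · have : η * lam i < 0 := mul_neg_of_pos_of_neg hη (not_le.1 hi)
      rw [one_mul, one_mul, abs_mul, abs_of_nonneg (by linarith)]
      exact mul_le_mul_of_nonneg_right (by linarith [hA i]) (abs_nonneg _)
  have hneg2 : ‖diagOp e (negPart lam) (η • H q)‖ ≤ A * ‖diagOp e (negPart lam) q‖ := by
    refine norm_diagOp_le e hA0.le fun i => ?_
    rw [inner_smul_right, he.inner_map]
    unfold negPart
    split_ifs with hi
    · simp
    · have : η * lam i < 0 := mul_neg_of_pos_of_neg hη (not_le.1 hi)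
      rw [one_mul, one_mul, ← mul_assoc, abs_mul, abs_of_neg this]
      exact mul_le_mul_of_nonneg_right (by linarith [hA i]) (abs_nonneg _)
  have hnegx : ‖diagOp e (negPart lam) (q - η • H q)‖ ≤
      (1 + A) * (‖diagOp e (negPart lam) x‖ + (1 - θ) * ‖diagOp e (negPart lam) y‖) := by
    refine hneg1.trans (mul_le_mul_of_nonneg_left ?_ (by linarith))
    rw [hq, map_add, map_smul]
    refine (norm_add_le _ _).trans ?_
    rw [norm_smul, Real.norm_of_nonneg (by linarith)]
  have hnegy : ‖diagOp e (negPart lam) ((1 - θ) • y - η • H q)‖ ≤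
      (1 - θ) * (1 + A) * ‖diagOp e (negPart lam) y‖ + A * ‖diagOp e (negPart lam) x‖ := by
    rw [map_sub]
    refine (norm_sub_le _ _).trans ?_
    have e1 : ‖diagOp e (negPart lam) q‖ ≤
        ‖diagOp e (negPart lam) x‖ + (1 - θ) * ‖diagOp e (negPart lam) y‖ := by
      rw [hq, map_add, map_smul]
      refine (norm_add_le _ _).trans ?_
      rw [norm_smul, Real.norm_of_nonneg (by linarith)]
    have e2 := mul_le_mul_of_nonneg_left e1 hA0.le
    rw [map_smul, norm_smul, Real.norm_of_nonneg (by linarith)]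
    linarith
  unfold coupleNorm
  have f1 := mul_le_mul_of_nonneg_left hPx hθ.le
  have f2 := mul_le_mul_of_nonneg_left hnegx (show 0 ≤ β by linarith)
  have f3 := mul_le_mul_of_nonneg_left hnegy (show 0 ≤ 1 - β by linarith)
  set a1 := ‖diagOp e (posPart lam) x‖
  set a2 := ‖WithLp.toLp 2 (diagOp e (posPart lam) y, diagOp e (sqrtPart η lam) x)‖
  set a3 := ‖diagOp e (negPart lam) x‖
  set a4 := ‖diagOp e (negPart lam) y‖
  have g1 : 0 ≤ a1 := norm_nonneg _
  have g2 : 0 ≤ a2 := norm_nonneg _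
  -- In the negative modes the triangle inequality gives a nonnegative two-by-two matrix, and `(β, 1
  -- - β)` is its left eigenvector for the eigenvalue `1 + α`.
  have g3 : β * ((1 + A) * (a3 + (1 - θ) * a4)) + (1 - β) * ((1 - θ) * (1 + A) * a4 + A * a3) =
      (1 + α) * (β * a3 + (1 - β) * a4) := by
    have : (1 + α) * (β * a3 + (1 - β) * a4) =
      (β + α * β) * a3 + ((1 + α) * (1 - β)) * a4 := by ring
    rw [this, hprod, hαβ]; ring
  have g4 : θ * a2 ≤ α * a2 := mul_le_mul_of_nonneg_right hα g2
  have g5 : 0 ≤ α * (θ * a1) := mul_nonneg (by linarith) (mul_nonneg hθ.le g1)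
  have g6 : (1 + α) * (θ * a1 + a2 + β * a3 + (1 - β) * a4) =
      θ * a1 + a2 + α * (θ * a1) + α * a2 + (1 + α) * (β * a3 + (1 - β) * a4) := by ring
  rw [g6, ← g3]
  linarith

end Coupling

/-! ### Separation of two localized runs. -/

section CoupledRuns

/-- Growth of the unstable component `z` of a sequence of size at most `Ψ` whose deviation from a
linear recursion is controlled by `Ψ`. -/
theorem growth_of_perturbed_recursion {Ψ z : ℕ → ℝ} {α μ : ℝ} {N : ℕ} (hα : 0 ≤ α) (hμ : 0 ≤ μ)
    (hμN : μ * N ≤ 1 / 100) (hΨ0 : 0 ≤ Ψ 0) (hΨ : ∀ j < N, Ψ (j + 1) ≤ (1 + α + μ) * Ψ j)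
    (hz : ∀ j < N, (1 + α) * z j - μ * Ψ j ≤ z (j + 1)) :
    (1 + α) ^ N * (z 0 - 1 / 50 * Ψ 0) ≤ z N := by
  -- The lower bound for `z` is the exact solution of its recursion with `Ψ` replaced by its upper
  -- bound: the accumulated errors sum to `((1 + α + μ) ^ j - (1 + α) ^ j) * Ψ 0`.
  have h : ∀ j ≤ N, Ψ j ≤ (1 + α + μ) ^ j * Ψ 0 ∧
      (1 + α) ^ j * (z 0 + Ψ 0) - (1 + α + μ) ^ j * Ψ 0 ≤ z j := by
    intro j
    induction j with
    | zero => intro _; simp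
    | succ j ih =>
      intro hj
      obtain ⟨h1, h2⟩ := ih (by omega)
      have h3 := hΨ j hj
      have h4 := hz j hj
      have h5 := mul_le_mul_of_nonneg_left h1 (show 0 ≤ 1 + α + μ by linarith)
      have h6 := mul_le_mul_of_nonneg_left h1 hμ
      have h7 := mul_le_mul_of_nonneg_left h2 (show 0 ≤ 1 + α by linarith)
      rw [pow_succ', pow_succ']
      constructor
      · linarith
      · linarith
  obtain ⟨-, h2⟩ := h N le_rfl
  have h3 : (1 + α + μ) ^ N ≤ (1 + α) ^ N * (51 / 50) := by
    have e1 : 1 + α + μ ≤ (1 + α) * (1 + μ) := by nlinarith [mul_nonneg hα hμ]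
    refine (pow_le_pow_left₀ (by linarith) e1 N).trans ?_
    rw [mul_pow]
    refine mul_le_mul_of_nonneg_left ?_ (by positivity)
    have e2 : (1 + μ) ^ N ≤ Real.exp (μ * N) := by
      rw [mul_comm, Real.exp_nat_mul]
      exact pow_le_pow_left₀ (by linarith) (by linarith [Real.add_one_le_exp μ]) N
    have e3 : Real.exp (1 / 100) ≤ 51 / 50 := by
      have e4 := Real.add_one_le_exp (-(1 / 100 : ℝ))
      rw [Real.exp_neg] at e4
      have e5 : Real.exp (1 / 100) ≤ (99 / 100)⁻¹ :=
        (le_inv_comm₀ (Real.exp_pos _) (by norm_num)).2 (by linarith)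
      exact e5.trans (by norm_num)
    exact (e2.trans (Real.exp_le_exp.2 hμN)).trans e3
  have h4 := mul_le_mul_of_nonneg_right h3 hΨ0
  linarith

variable {V : Type*} [NormedAddCommGroup V] [InnerProductSpace ℝ V] {ι : Type*} [Fintype ι]
  {e : OrthonormalBasis ι ℝ V} {lam : ι → ℝ} {θ β η : ℝ}

theorem coupleNorm_nonneg (hθ : 0 ≤ θ) (hβ : 0 ≤ β) (hβ1 : β ≤ 1) (x y : V) :
    0 ≤ coupleNorm e lam θ β η x y := by
  have : 0 ≤ 1 - β := by linarith
  unfold coupleNorm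
  positivity

theorem diagOp_posPart_self {i : ι} (hi : lam i < 0) : diagOp e (posPart lam) (e i) = 0 := by
  have h := sq_norm_diagOp e (posPart lam) (e i)
  rw [Finset.sum_eq_zero] at h
  · simpa using h
  intro j _
  by_cases hj : j = i
  · subst hj
    simp [posPart, not_le.2 hi]
  · simp [e.orthonormal.2 hj]

theorem diagOp_sqrtPart_self {i : ι} (hi : lam i < 0) :
    diagOp e (sqrtPart η lam) (e i) = 0 := by
  have h := sq_norm_diagOp e (sqrtPart η lam) (e i)
  rw [Finset.sum_eq_zero] at h
  · simpa using h
  intro j _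
  by_cases hj : j = i
  · subst hj
    simp [sqrtPart, not_le.2 hi]
  · simp [e.orthonormal.2 hj]

/-- Pairs of starting points in a cone around an unstable direction. -/
theorem coupleNorm_cone_le (hθ : 0 < θ) (hθ' : θ ≤ 1 / 5) (hβ : θ ≤ β)
    (hlam : ∀ i, η * lam i ≤ 1 / 4) {i : ι} (hi : lam i < 0) {t : ℝ} (ht : 0 ≤ t) {w : V}
    (hw : ‖w - t • e i‖ ≤ θ * t) : coupleNorm e lam θ β η w 0 ≤ 2 * β * t := by
  have hP : diagOp e (posPart lam) w = diagOp e (posPart lam) (w - t • e i) := by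
    rw [map_sub, map_smul, diagOp_posPart_self hi, smul_zero, sub_zero]
  have hS : diagOp e (sqrtPart η lam) w = diagOp e (sqrtPart η lam) (w - t • e i) := by
    rw [map_sub, map_smul, diagOp_sqrtPart_self hi, smul_zero, sub_zero]
  have h1 := norm_pos_le (e := e) (lam := lam) (w - t • e i)
  have h2 := norm_sqrtPart_le (e := e) hlam (w - t • e i)
  have h3 := norm_neg_le (e := e) (lam := lam) w
  have h4 : ‖w‖ ≤ θ * t + t := by
    have := norm_add_le (w - t • e i) (t • e i)
    rw [sub_add_cancel, norm_smul, e.norm_eq_one, mul_one, Real.norm_of_nonneg ht] at this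
    linarith
  have h5 : ‖WithLp.toLp 2 (diagOp e (posPart lam) (0 : V), diagOp e (sqrtPart η lam) w)‖ =
      ‖diagOp e (sqrtPart η lam) w‖ := by
    refine (sq_eq_sq₀ (norm_nonneg _) (norm_nonneg _)).1 ?_
    rw [sq_norm_toLp_prod, map_zero, norm_zero]; ring
  unfold coupleNorm
  rw [h5, map_zero, norm_zero, hP, hS]
  have hβ0 : 0 < β := by linarith
  have g1 : θ * ‖diagOp e (posPart lam) (w - t • e i)‖ ≤ 1 / 5 * (β * t) := by
    have := mul_le_mul hθ' (h1.trans (hw.trans (mul_le_mul_of_nonneg_right hβ ht))) (norm_nonneg _)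
      (by norm_num)
    linarith
  have g2 : ‖diagOp e (sqrtPart η lam) (w - t • e i)‖ ≤ 1 / 2 * (β * t) :=
    h2.trans (mul_le_mul_of_nonneg_left (hw.trans (mul_le_mul_of_nonneg_right hβ ht)) (by norm_num))
  have g3 : β * ‖diagOp e (negPart lam) w‖ ≤ β * (6 / 5 * t) := by
    refine mul_le_mul_of_nonneg_left (h3.trans (h4.trans ?_)) hβ0.le
    have := mul_le_mul_of_nonneg_right hθ' ht
    linarith
  have g4 := mul_nonneg hβ0.le ht
  linarith

variable [FiniteDimensional ℝ V] {p : Params} {g : V → ℝ}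

/-- Two runs whose starting points differ essentially in the most unstable direction cannot both
stay close to their starting points. -/
theorem growth_of_slowRuns (hg : RegularModel p g) (hp : p.Valid)
    (he : IsEigenbasis e (euclHess g 0) lam) {i : ι} (hi : lam i < -p.σ)
    (hmin : ∀ k, lam i ≤ lam k) {ξ ξ' : V} {s v s' v' : ℕ → V} (run : SlowRun p g ξ s v)
    (run' : SlowRun p g ξ' s' v') (hξ : ‖ξ‖ ≤ p.loc) (hξ' : ‖ξ'‖ ≤ p.loc) {t : ℝ} (ht : 0 ≤ t)
    (hw : ‖ξ' - ξ - t • e i‖ ≤ p.θ * t) :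
    (1 + p.θ) ^ p.steps * (p.θ * t) ≤ 8 * p.loc := by
  have hθ := hp.θ_pos
  have hθ' := hp.θ_le
  have hη := hp.η_pos
  have hσ := hp.σ_pos
  have hloc := hp.loc_pos
  have hlen := hp.len_pos
  have hρ := hp.ρ_pos
  have habs : ∀ k, |p.η * lam k| ≤ 1 / 4 := fun k => by
    rw [abs_mul, abs_of_pos hη, ← hp.η_mul_ℓ]
    exact mul_le_mul_of_nonneg_left (he.abs_le (hg.norm_euclHess_zero_le hp) k) hη.le
  have hlam : ∀ k, p.η * lam k ≤ 1 / 4 := fun k => (abs_le.1 (habs k)).2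
  set A := -(p.η * lam i) with hA
  have hA1 : A ≤ 1 / 4 := by linarith [(abs_le.1 (habs i)).1]
  have hA2 : 4 * p.θ ^ 2 ≤ A := by
    rw [← hp.η_mul_σ, hA, ← mul_neg]
    exact mul_le_mul_of_nonneg_left (by linarith) hη.le
  have hAk : ∀ k, -A ≤ p.η * lam k := fun k => by
    rw [hA, neg_neg]; exact mul_le_mul_of_nonneg_left (hmin k) hη.le
  obtain ⟨α, β, hα, hβ, hβ1, hαβ, hd⟩ := exists_unstable_rates hθ hθ' hA2
  have hα0 : 0 ≤ α := by linarith
  have hβ0 : 0 < β := by linarith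
  have hprod : (1 + α) * (1 - β) = (1 - p.θ) * (1 + A) := by nlinarith
  have hβθ : p.θ ≤ 1 - β := by
    have e1 : α ≤ 3 / 2 := by nlinarith
    nlinarith
  set x : ℕ → V := fun j => s' j - s j with hx
  set y : ℕ → V := fun j => v' j - v j with hy
  set q : ℕ → V := fun j => x j + (1 - p.θ) • y j with hq
  set H := euclHess g 0 with hH
  -- The difference of the runs obeys the linear iteration up to this error, which is small relative
  -- to `q` since both runs stay near the origin.
  set D : ℕ → V := fun j => euclGrad g (s' j + (1 - p.θ) • v' j) -
    euclGrad g (s j + (1 - p.θ) • v j) - H (q j) with hD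
  have hqdiff : ∀ j, q j = (s' j + (1 - p.θ) • v' j) - (s j + (1 - p.θ) • v j) := fun j => by
    simp only [hq, hx, hy, smul_sub]; abel
  have hrec : ∀ j < p.steps, x (j + 1) = (q j - p.η • H (q j)) + (-(p.η • D j)) := by
    intro j hj
    simp only [hx, hD, run.s_succ j hj, run'.s_succ j hj]
    rw [hqdiff, smul_sub, smul_sub]
    abel
  have hrecy : ∀ j < p.steps,
      y (j + 1) = ((1 - p.θ) • y j - p.η • H (q j)) + (-(p.η • D j)) := by
    intro j hj
    have e1 : y (j + 1) = x (j + 1) - x j := by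
      simp only [hy, hx, run.v_succ, run'.v_succ]; abel
    rw [e1, hrec j hj]
    simp only [hq]
    abel
  have hDle : ∀ j < p.steps, ‖D j‖ ≤ p.ρ * (4 * p.loc) * ‖q j‖ := by
    intro j hj
    have e1 := run.norm_extrapolate_le hp hj.le
    have e2 := run'.norm_extrapolate_le hp hj.le
    have e3 := hg.norm_grad_sub_hess_le hp (r := 4 * p.loc) (u := s' j + (1 - p.θ) • v' j)
      (u' := s j + (1 - p.θ) • v j)
      (by linarith [hp.loc_le, hp.len_le_b]) (by linarith) (by linarith)
    rwa [← hqdiff] at e3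
  set Ψ : ℕ → ℝ := fun j => coupleNorm e lam p.θ β p.η (x j) (y j) with hΨ
  have hΨnn : ∀ j, 0 ≤ Ψ j := fun j => coupleNorm_nonneg hθ.le hβ0.le hβ1.le _ _
  -- Chosen so that `3 * η * ρ * (4 * loc) * 2 = μ * θ`; the `3` comes from `coupleNorm_diag_le`,
  -- the `2` and `θ` from `norm_add_norm_le_coupleNorm`.
  set μ : ℝ := 192 * p.θ * p.χ⁻¹ ^ 2 * p.c⁻¹ ^ 3 with hμ
  have hχ := hp.inv_χ_pos
  have hc := hp.inv_c_pos
  have hμ0 : 0 ≤ μ := by positivity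
  have hDμ : ∀ j < p.steps, 3 * (p.η * ‖D j‖) ≤ μ * Ψ j := by
    intro j hj
    have e1 : ‖q j‖ ≤ ‖x j‖ + ‖y j‖ := by
      refine (norm_add_le _ _).trans (add_le_add le_rfl ?_)
      rw [norm_smul, Real.norm_of_nonneg (by linarith)]
      exact mul_le_of_le_one_left (norm_nonneg _) (by linarith)
    have e2 := norm_add_norm_le_coupleNorm (e := e) (lam := lam) (η := p.η) hθ hθ' hβ hβθ (x j) (y j)
    have e3 := hDle j hj
    have e4 : 3 * (p.η * (p.ρ * (4 * p.loc))) * 2 = μ * p.θ := by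
      rw [hμ, hp.η_eq, hp.ρ_eq, Params.loc]
      field_simp
      norm_num
    have e5 : p.θ * ‖q j‖ ≤ 2 * Ψ j := (mul_le_mul_of_nonneg_left e1 hθ.le).trans e2
    have e6 : p.θ * (3 * (p.η * ‖D j‖)) ≤ p.θ * (μ * Ψ j) := by
      calc p.θ * (3 * (p.η * ‖D j‖)) ≤ p.θ * (3 * (p.η * (p.ρ * (4 * p.loc) * ‖q j‖))) := by gcongr
        _ = 3 * (p.η * (p.ρ * (4 * p.loc))) * (p.θ * ‖q j‖) := by ring
        _ ≤ 3 * (p.η * (p.ρ * (4 * p.loc))) * (2 * Ψ j) := by gcongr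
        _ = μ * p.θ * Ψ j := by rw [← e4]; ring
        _ = p.θ * (μ * Ψ j) := by ring
    exact le_of_mul_le_mul_left e6 hθ
  have hstep : ∀ j < p.steps, Ψ (j + 1) ≤ (1 + α + μ) * Ψ j := by
    intro j hj
    have e1 := coupleNorm_step_le he hη hθ hθ' hα hβ hβ1 hαβ hd hlam hAk (x j) (y j)
    have e2 := coupleNorm_add_le (e := e) (lam := lam) (η := p.η) hθ.le hβ0.le hβ1.le
      (q j - p.η • H (q j)) ((1 - p.θ) • y j - p.η • H (q j)) (-(p.η • D j)) (-(p.η • D j))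
    rw [← hrec j hj, ← hrecy j hj] at e2
    have e3 := coupleNorm_diag_le (e := e) (β := β) hθ.le hθ' hlam (-(p.η • D j))
    rw [norm_neg, norm_smul, Real.norm_of_nonneg hη.le] at e3
    have e4 := hDμ j hj
    change Ψ (j + 1) ≤ _ at e2
    change _ ≤ (1 + α) * Ψ j at e1
    linarith
  -- The left eigenvector applied to the most unstable mode: in the linear iteration this quantity
  -- grows by exactly `1 + α`.
  set z : ℕ → ℝ := fun j => β * ⟪e i, x j⟫_ℝ + (1 - β) * ⟪e i, y j⟫_ℝ with hz
  have hzstep : ∀ j < p.steps, (1 + α) * z j - μ * Ψ j ≤ z (j + 1) := by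
    intro j hj
    have e1 : z (j + 1) = (1 + α) * z j - p.η * ⟪e i, D j⟫_ℝ := by
      simp only [hz]
      rw [hrec j hj, hrecy j hj]
      simp only [inner_add_right, inner_sub_right, inner_neg_right, inner_smul_right]
      rw [he.inner_map]
      simp only [hq, inner_add_right, inner_smul_right]
      have f1 : p.η * lam i = -(α * β) := by rw [hαβ, hA, neg_neg]
      have f2 : (1 + α) * (1 - β) = (1 - p.θ) * (1 + α * β) := by rw [hαβ]; exact hprod
      linear_combination (-(⟪e i, x j⟫_ℝ + (1 - p.θ) * ⟪e i, y j⟫_ℝ)) * f1 - ⟪e i, y j⟫_ℝ * f2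
    have e2 : p.η * ⟪e i, D j⟫_ℝ ≤ p.η * ‖D j‖ := by
      refine mul_le_mul_of_nonneg_left ?_ hη.le
      refine (real_inner_le_norm _ _).trans ?_
      rw [e.norm_eq_one, one_mul]
    have e3 := hDμ j hj
    have e4 : 0 ≤ p.η * ‖D j‖ := by positivity
    rw [e1]
    linarith
  have hμT : μ * p.steps ≤ 1 / 100 := by
    rw [hp.steps_eq, hp.T_eq, hμ]
    have e1 : 192 * p.θ * p.χ⁻¹ ^ 2 * p.c⁻¹ ^ 3 * (p.χ * p.c / (4 * p.θ)) =
        48 * p.χ⁻¹ * p.c⁻¹ ^ 2 := by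
      have := hp.χ_pos
      have := hp.c_pos
      field_simp
      norm_num
    rw [e1]
    have e2 := hp.inv_χ_le
    have e3 := hp.inv_c_le
    calc 48 * p.χ⁻¹ * p.c⁻¹ ^ 2 ≤ 48 * (1 / 2) * (1 / 10 ^ 9) ^ 2 := by gcongr
      _ ≤ 1 / 100 := by norm_num
  have hgrow := growth_of_perturbed_recursion hα0 hμ0 hμT (hΨnn 0) hstep hzstep
  have hx0 : x 0 = ξ' - ξ := by simp only [hx, run.s_zero, run'.s_zero]
  have hy0 : y 0 = 0 := by simp only [hy, run.v_zero, run'.v_zero, sub_zero]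
  have hi0 : lam i < 0 := by linarith
  have hΨ0 : Ψ 0 ≤ 2 * β * t := by
    simp only [hΨ, hx0, hy0]
    exact coupleNorm_cone_le hθ hθ' hβ hlam hi0 ht hw
  have hz0 : 4 / 5 * (β * t) ≤ z 0 := by
    simp only [hz, hx0, hy0, inner_zero_right, mul_zero, add_zero]
    have e1 : ⟪e i, ξ' - ξ⟫_ℝ = ⟪e i, ξ' - ξ - t • e i⟫_ℝ + t := by
      rw [inner_sub_right _ (ξ' - ξ), inner_smul_right, real_inner_self_eq_norm_sq, e.norm_eq_one]
      ring
    have e2 := neg_le_of_abs_le (abs_real_inner_le_norm (e i) (ξ' - ξ - t • e i))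
    rw [e.norm_eq_one, one_mul] at e2
    have e3 := mul_le_mul_of_nonneg_right hθ' ht
    have e4 : 4 / 5 * t ≤ ⟪e i, ξ' - ξ⟫_ℝ := by rw [e1]; linarith
    have := mul_le_mul_of_nonneg_left e4 hβ0.le
    linarith
  have hzT : z p.steps ≤ 4 * p.loc := by
    have e1 : ⟪e i, x p.steps⟫_ℝ ≤ 4 * p.loc := by
      refine (real_inner_le_norm _ _).trans ?_
      rw [e.norm_eq_one, one_mul]
      refine (norm_sub_le _ _).trans ?_
      have f1 := run.norm_le le_rfl
      have f2 := run'.norm_le le_rfl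
      linarith
    have e2 : ⟪e i, y p.steps⟫_ℝ ≤ 4 * p.loc := by
      refine (real_inner_le_norm _ _).trans ?_
      rw [e.norm_eq_one, one_mul]
      refine (norm_sub_le _ _).trans ?_
      have f1 := run.norm_momentum_le hp le_rfl
      have f2 := run'.norm_momentum_le hp le_rfl
      linarith
    have e3 := mul_le_mul_of_nonneg_left e1 hβ0.le
    have e4 := mul_le_mul_of_nonneg_left e2 (show 0 ≤ 1 - β by linarith)
    simp only [hz]
    linarith
  have hβt : p.θ * t ≤ β * t := mul_le_mul_of_nonneg_right hβ ht
  have hθt : 0 ≤ p.θ * t := by positivity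
  have h1 : 1 / 2 * (p.θ * t) ≤ z 0 - 1 / 50 * Ψ 0 := by linarith
  have h2 : (1 + p.θ) ^ p.steps ≤ (1 + α) ^ p.steps :=
    pow_le_pow_left₀ (by linarith) (by linarith) _
  have h3 := mul_le_mul h2 h1 (by positivity) (by positivity)
  linarith

end CoupledRuns

/-! ### Volume of the bad perturbations. -/

section Perturbation

open MeasureTheory

variable {V : Type*} [NormedAddCommGroup V] [InnerProductSpace ℝ V] [FiniteDimensional ℝ V]

/-- A closed subset of a ball that meets each line in the direction `u` in pairs of points at
distance less than `t` only has small volume. -/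
theorem volume_le_of_thin [MeasurableSpace V] [BorelSpace V] (hdim : 0 < Module.finrank ℝ V)
    {r t : ℝ} (hr : 0 < r) (ht : 0 < t) {Y : Set V} (hY : IsClosed Y)
    (hYr : Y ⊆ Metric.closedBall 0 r) {u : V} (hu : ‖u‖ = 1)
    (hthin : ∀ ξ ∈ Y, ∀ t' ≥ t, ξ + t' • u ∉ Y) :
    volume Y ≤ ENNReal.ofReal (3 * Module.finrank ℝ V * t / r) *
      volume (Metric.closedBall (0 : V) r) := by
  set n := Module.finrank ℝ V with hn
  have hn0 : (0 : ℝ) < n := by exact_mod_cast hdim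
  have : Nontrivial V := Module.nontrivial_of_finrank_pos hdim
  -- The `K + 1` translates by multiples of `t` are disjoint, and `K t ≤ r / n` keeps them in a ball
  -- whose volume is larger by at most `(1 + 1 / n) ^ n ≤ 3`.
  set K : ℕ := ⌊r / (n * t)⌋₊ with hK
  have hK1 : (K : ℝ) ≤ r / (n * t) := Nat.floor_le (by positivity)
  have hK2 : r / (n * t) < K + 1 := Nat.lt_floor_add_one _
  set F : ℕ → Set V := fun k => (fun ξ => ((k * t : ℝ) • u) + ξ) '' Y with hF
  have hFvol : ∀ k, volume (F k) = volume Y := fun k => by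
    simp only [hF, Set.image_add_left]
    exact measure_preimage_add _ _ _
  have hdisj : Set.Pairwise (↑(Finset.range (K + 1))) (Function.onFun Disjoint F) := by
    have key : ∀ k k' : ℕ, k < k' → Disjoint (F k) (F k') := by
      intro k k' hkk
      rw [Set.disjoint_left]
      rintro _ ⟨ξ, hξ, rfl⟩ ⟨ξ', hξ', h⟩
      simp only at h
      refine hthin ξ' hξ' ((k' - k : ℝ) * t) ?_ ?_
      · have : (1 : ℝ) ≤ k' - k := by
          have : ((k + 1 : ℕ) : ℝ) ≤ k' := by exact_mod_cast hkk
          push_cast at this; linarith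
        nlinarith
      · have : ξ' + ((k' - k : ℝ) * t) • u = ξ := by
          have h2 : ξ' + (k' * t : ℝ) • u = ξ + (k * t : ℝ) • u := by
            rw [add_comm ξ', add_comm ξ]; exact h
          rw [sub_mul, sub_smul, add_sub_assoc', h2]; abel
        rwa [this]
    intro k _ k' _ hne
    rcases lt_or_gt_of_ne hne with h | h
    · exact key k k' h
    · exact (key k' k h).symm
  have hFmeas : ∀ k ∈ Finset.range (K + 1), MeasurableSet (F k) := fun k _ =>
    ((Homeomorph.addLeft ((k * t : ℝ) • u)).isClosedMap Y hY).measurableSet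
  have hsub : (⋃ k ∈ Finset.range (K + 1), F k) ⊆ Metric.closedBall (0 : V) (r + K * t) := by
    refine Set.iUnion₂_subset fun k hk => ?_
    rintro _ ⟨ξ, hξ, rfl⟩
    have hk' : (k : ℝ) ≤ K := by
      have := Finset.mem_range.1 hk
      exact_mod_cast Nat.lt_succ_iff.1 this
    rw [mem_closedBall_zero_iff]
    refine (norm_add_le _ _).trans ?_
    rw [norm_smul, hu, mul_one, Real.norm_of_nonneg (by positivity)]
    have := mem_closedBall_zero_iff.1 (hYr hξ)
    nlinarith
  have h1 : ((K + 1 : ℕ) : ℝ≥0∞) * volume Y ≤ volume (Metric.closedBall (0 : V) (r + K * t)) := by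
    refine le_trans (le_of_eq ?_) (measure_mono hsub)
    rw [measure_biUnion_finset hdisj hFmeas]
    simp [hFvol]
  have hB0 : volume (Metric.ball (0 : V) 1) ≠ ⊤ := measure_ball_lt_top.ne
  rw [Measure.addHaar_closedBall _ _ (by positivity)] at h1
  rw [Measure.addHaar_closedBall _ _ hr.le, ← mul_assoc,
    ← ENNReal.ofReal_mul (by positivity)]
  have h2 : (r + K * t) ^ n ≤ 3 * r ^ n := by
    have e1 : r + K * t ≤ r * (1 + 1 / n) := by
      have := mul_le_mul_of_nonneg_right hK1 ht.le
      have e2 : r / (n * t) * t = r * (1 / n) := by field_simp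
      linarith
    refine (pow_le_pow_left₀ (by positivity) e1 n).trans ?_
    rw [mul_pow, mul_comm]
    refine mul_le_mul_of_nonneg_right ?_ (by positivity)
    have e3 : (1 + 1 / (n : ℝ)) ^ n ≤ Real.exp (1 / n * n) := by
      rw [mul_comm, Real.exp_nat_mul]
      exact pow_le_pow_left₀ (by positivity) (by linarith [Real.add_one_le_exp (1 / (n : ℝ))]) n
    rw [one_div_mul_cancel hn0.ne'] at e3
    exact e3.trans Real.exp_one_lt_three.le
  have h3 : ENNReal.ofReal (K + 1) * volume Y ≤
      ENNReal.ofReal (3 * r ^ n) * volume (Metric.ball (0 : V) 1) := by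
    have : ((K + 1 : ℕ) : ℝ≥0∞) = ENNReal.ofReal (K + 1) := by
      rw [← ENNReal.ofReal_natCast]; push_cast; rfl
    rw [← this]
    exact h1.trans (mul_le_mul_left (ENNReal.ofReal_le_ofReal h2) _)
  have h4 : 0 < (K : ℝ) + 1 := by positivity
  have h5 : volume Y ≤ ENNReal.ofReal (1 / (K + 1)) *
      (ENNReal.ofReal (3 * r ^ n) * volume (Metric.ball (0 : V) 1)) := by
    refine le_trans (le_of_eq ?_) (mul_le_mul_right h3 _)
    rw [← mul_assoc, ← ENNReal.ofReal_mul (by positivity), one_div_mul_cancel h4.ne',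
      ENNReal.ofReal_one, one_mul]
  refine h5.trans ?_
  rw [← mul_assoc, ← ENNReal.ofReal_mul (by positivity)]
  refine mul_le_mul_left (ENNReal.ofReal_le_ofReal ?_) _
  have h6 : 1 / ((K : ℝ) + 1) ≤ n * t / r := by
    rw [one_div_le h4 (by positivity), one_div_div]; exact hK2.le
  calc 1 / ((K : ℝ) + 1) * (3 * r ^ n) ≤ n * t / r * (3 * r ^ n) := by gcongr
    _ = 3 * n * t / r * r ^ n := by ring

/-- The integrand is compared with a constant on a measurable set, so `φ` itself need not be
measurable; closedness of `Y` supplies the measurable set. -/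
theorem le_uniformBallExpectation_of_thin (hdim : 0 < Module.finrank ℝ V)
    {r t : ℝ} (hr : 0 < r) (ht : 0 < t) {Y : Set V} (hY : IsClosed Y)
    (hYr : Y ⊆ Metric.closedBall 0 r) {u : V} (hu : ‖u‖ = 1)
    (hthin : ∀ ξ ∈ Y, ∀ t' ≥ t, ξ + t' • u ∉ Y) {φ : V → ℝ≥0∞} {m : ℝ≥0∞}
    (hφ : ∀ ξ ∈ Metric.closedBall (0 : V) r, ξ ∉ Y → m ≤ φ ξ) :
    m * (1 - ENNReal.ofReal (3 * Module.finrank ℝ V * t / r)) ≤ uniformBallExpectation r φ := by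
  let _ : MeasurableSpace V := borel V
  have : BorelSpace V := ⟨rfl⟩
  have hvol := volume_le_of_thin hdim hr ht hY hYr hu hthin
  set δ := ENNReal.ofReal (3 * Module.finrank ℝ V * t / r)
  change _ ≤ ⨍⁻ ξ in Metric.closedBall (0 : V) r, φ ξ ∂volume
  have hB0 : volume (Metric.closedBall (0 : V) r) ≠ 0 :=
    (Metric.measure_closedBall_pos _ _ hr).ne'
  have hBt : volume (Metric.closedBall (0 : V) r) ≠ ⊤ := measure_closedBall_lt_top.ne
  rw [setLAverage_eq, ENNReal.le_div_iff_mul_le (Or.inl hB0) (Or.inl hBt)]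
  calc m * (1 - δ) * volume (Metric.closedBall (0 : V) r)
      = m * (volume (Metric.closedBall (0 : V) r) -
          δ * volume (Metric.closedBall (0 : V) r)) := by
        rw [mul_assoc, ENNReal.sub_mul (fun _ _ => hBt), one_mul]
    _ ≤ m * (volume (Metric.closedBall (0 : V) r) - volume Y) := by gcongr
    _ ≤ m * volume (Metric.closedBall (0 : V) r \ Y) := by
        gcongr; exact le_measure_sdiff
    _ = ∫⁻ _ in Metric.closedBall (0 : V) r \ Y, m := by rw [setLIntegral_const]
    _ ≤ ∫⁻ ξ in Metric.closedBall (0 : V) r \ Y, φ ξ := by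
        refine setLIntegral_mono' (Metric.isClosed_closedBall.measurableSet.diff hY.measurableSet)
          fun ξ hξ => hφ ξ hξ.1 hξ.2
    _ ≤ ∫⁻ ξ in Metric.closedBall (0 : V) r, φ ξ := lintegral_mono_set Set.sdiff_subset

theorem le_uniformBallExpectation {r : ℝ} (hr : 0 < r) {φ : V → ℝ≥0∞} {m : ℝ≥0∞}
    (hφ : ∀ ξ ∈ Metric.closedBall (0 : V) r, m ≤ φ ξ) : m ≤ uniformBallExpectation r φ := by
  let _ : MeasurableSpace V := borel V
  have : BorelSpace V := ⟨rfl⟩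
  change _ ≤ ⨍⁻ ξ in Metric.closedBall (0 : V) r, φ ξ ∂volume
  have hB0 : volume (Metric.closedBall (0 : V) r) ≠ 0 :=
    (Metric.measure_closedBall_pos _ _ hr).ne'
  have hBt : volume (Metric.closedBall (0 : V) r) ≠ ⊤ := measure_closedBall_lt_top.ne
  rw [setLAverage_eq, ENNReal.le_div_iff_mul_le (Or.inl hB0) (Or.inl hBt), ← setLIntegral_const]
  exact setLIntegral_mono' Metric.isClosed_closedBall.measurableSet hφ

variable {p : Params} {g : V → ℝ}

/-- The radius satisfies `ε r = 4 θ² c⁻¹ E`. The perturbation thus costs at most a quarter of `E`,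
and a run that gains `E` from there has a net gain above `E / 2`. -/
theorem Params.Valid.le_add_quarter (hp : p.Valid) (h0 : ‖euclGrad g 0‖ ≤ p.ε)
    (hup : ∀ s, g s ≤ g 0 + ⟪euclGrad g 0, s⟫_ℝ + p.ℓ / 2 * ‖s‖ ^ 2) {ξ : V} (hξ : ‖ξ‖ ≤ p.r) :
    g ξ ≤ g 0 + p.E / 4 := by
  have h1 := hup ξ
  have h2 : ⟪euclGrad g 0, ξ⟫_ℝ ≤ p.ε * p.r :=
    (real_inner_le_norm _ _).trans (mul_le_mul h0 hξ (norm_nonneg _) hp.ε_pos.le)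
  have hℓ := hp.ℓ_pos
  have h3 : p.ℓ / 2 * ‖ξ‖ ^ 2 ≤ p.ℓ / 2 * p.r ^ 2 := by gcongr
  have hθ := hp.θ_pos
  have hσ := hp.σ_pos
  have hlen := hp.len_pos
  have hχ := hp.inv_χ_pos
  have hc := hp.inv_c_pos
  have hχ1 := hp.inv_χ_le
  have hc1 := hp.inv_c_le
  have hθ2 := hp.θ_sq_le
  have hE := hp.E_pos
  have h4 : p.ε * p.r = 4 * p.θ ^ 2 * p.c⁻¹ * p.E := by
    rw [hp.r_eq, hp.E_eq, hp.ε_eq]; ring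
  have h5 : p.ℓ / 2 * p.r ^ 2 = 1 / 8 * (p.χ⁻¹ ^ 5 * p.c⁻¹ ^ 8) * (p.ε * p.r) := by
    rw [hp.ℓ_eq, hp.r_eq, hp.ε_eq]; field_simp; norm_num
  have h6 : 4 * p.θ ^ 2 * p.c⁻¹ ≤ 4 * (1 / 32) * (1 / 10 ^ 9) := by gcongr
  have h7 : p.χ⁻¹ ^ 5 * p.c⁻¹ ^ 8 ≤ (1 / 2) ^ 5 * (1 / 10 ^ 9) ^ 8 := by gcongr
  have h8 : p.ε * p.r ≤ 1 / 10 * p.E := by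
    rw [h4]; exact mul_le_mul_of_nonneg_right (h6.trans (by norm_num)) hE.le
  have h9 : 0 ≤ p.ε * p.r := by rw [h4]; positivity
  have h10 : p.ℓ / 2 * p.r ^ 2 ≤ 1 * (p.ε * p.r) := by
    rw [h5]
    refine mul_le_mul_of_nonneg_right ?_ h9
    linarith [h7.trans (show (1 / 2 : ℝ) ^ 5 * (1 / 10 ^ 9) ^ 8 ≤ 1 by norm_num)]
  linarith

/-- The perturbations for which the tangent space steps fail to decrease the function. -/
def stuckSet (p : Params) (g : V → ℝ) : Set V :=
  {ξ | ‖ξ‖ ≤ p.r ∧ g 0 - g (tss p g (some ξ)).1 < 1 / 2 * p.E}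

theorem exists_slowRun_of_mem_stuckSet (hg : RegularModel p g) (hp : p.Valid)
    (h0 : ‖euclGrad g 0‖ ≤ p.ε)
    (hup : ∀ s, g s ≤ g 0 + ⟪euclGrad g 0, s⟫_ℝ + p.ℓ / 2 * ‖s‖ ^ 2) {ξ : V}
    (hξ : ξ ∈ stuckSet p g) : ∃ s v, SlowRun p g ξ s v := by
  have h1 := hp.le_add_quarter h0 hup hξ.1
  have hE := hp.E_pos
  rcases tssLoop_cases hg hp true (hξ.1.trans hp.r_le_loc) with h | h | h
  · have h2 := hξ.2
    simp only [tss] at h2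
    linarith
  · exact absurd h.1 (by simp)
  · obtain ⟨s, v, h, -⟩ := h
    exact ⟨s, v, h⟩

/-- Separation along the most unstable direction beyond which two runs cannot both be slow. -/
def Params.sep (p : Params) : ℝ := 9 * p.loc / (p.θ * (1 + p.θ) ^ p.steps)

theorem Params.Valid.sep_pos (hp : p.Valid) : 0 < p.sep := by
  have := hp.loc_pos
  have := hp.θ_pos
  rw [Params.sep]; positivity

/-- Passing to the closure gives a measurable set without studying how the output depends on `ξ`. It
is harmless because `growth_of_slowRuns` allows a cone of opening `θ`: moving each of the two points
by at most `θ t / 2` keeps their difference in the cone. -/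
theorem closure_stuckSet_thin (hg : RegularModel p g) (hp : p.Valid)
    (h0 : ‖euclGrad g 0‖ ≤ p.ε)
    (hup : ∀ s, g s ≤ g 0 + ⟪euclGrad g 0, s⟫_ℝ + p.ℓ / 2 * ‖s‖ ^ 2)
    {ι : Type*} [Fintype ι] {e : OrthonormalBasis ι ℝ V} {lam : ι → ℝ}
    (he : IsEigenbasis e (euclHess g 0) lam) {i : ι} (hi : lam i < -p.σ)
    (hmin : ∀ k, lam i ≤ lam k) :
    ∀ ξ ∈ closure (stuckSet p g), ∀ t ≥ p.sep, ξ + t • e i ∉ closure (stuckSet p g) := by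
  intro ξ hξ t ht hξ'
  have hθ := hp.θ_pos
  have htpos : 0 < t := hp.sep_pos.trans_le ht
  have hd : 0 < p.θ * t / 2 := by positivity
  obtain ⟨ζ, hζ, hζd⟩ := Metric.mem_closure_iff.1 hξ _ hd
  obtain ⟨ζ', hζ', hζd'⟩ := Metric.mem_closure_iff.1 hξ' _ hd
  obtain ⟨s, v, run⟩ := exists_slowRun_of_mem_stuckSet hg hp h0 hup hζ
  obtain ⟨s', v', run'⟩ := exists_slowRun_of_mem_stuckSet hg hp h0 hup hζ'
  have hcone : ‖ζ' - ζ - t • e i‖ ≤ p.θ * t := by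
    have e1 : ζ' - ζ - t • e i = (ξ - ζ) - (ξ + t • e i - ζ') := by abel
    rw [e1]
    refine (norm_sub_le _ _).trans ?_
    rw [← dist_eq_norm, ← dist_eq_norm]
    linarith
  have h1 := growth_of_slowRuns hg hp he hi hmin run run' (hζ.1.trans hp.r_le_loc)
    (hζ'.1.trans hp.r_le_loc) htpos.le hcone
  have hloc := hp.loc_pos
  have h2 : (1 + p.θ) ^ p.steps * (p.θ * p.sep) = 9 * p.loc := by
    rw [Params.sep]; field_simp
  have h3 : (1 + p.θ) ^ p.steps * (p.θ * p.sep) ≤ (1 + p.θ) ^ p.steps * (p.θ * t) := by gcongr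
  linarith

/-- A perturbed run from a point with a direction of pronounced negative curvature decreases the
function with high probability. -/
theorem le_uniformBallExpectation_of_saddle (hg : RegularModel p g) (hp : p.Valid)
    (h0 : ‖euclGrad g 0‖ ≤ p.ε)
    (hup : ∀ s, g s ≤ g 0 + ⟪euclGrad g 0, s⟫_ℝ + p.ℓ / 2 * ‖s‖ ^ 2) {μ : ℝ}
    (hμ : Module.End.HasEigenvalue (euclHess g 0 : V →ₗ[ℝ] V) μ) (hμσ : μ < -p.σ)
    {φ : V → ℝ≥0∞} {m : ℝ≥0∞}
    (hφ : ∀ ξ, ‖ξ‖ ≤ p.r → 1 / 2 * p.E ≤ g 0 - g (tss p g (some ξ)).1 → m ≤ φ ξ) :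
    m * (1 - ENNReal.ofReal (3 * Module.finrank ℝ V * p.sep / p.r)) ≤
      uniformBallExpectation p.r φ := by
  obtain ⟨e, lam, he, hlam⟩ := exists_isEigenbasis (inner_euclHess_comm hg.contDiff 0)
  obtain ⟨i₁, hi₁⟩ := hlam μ hμ
  obtain ⟨i, -, hmin⟩ := Finset.exists_min_image Finset.univ lam ⟨i₁, Finset.mem_univ _⟩
  have hi : lam i < -p.σ := by
    have := hmin i₁ (Finset.mem_univ _)
    linarith
  have hdim : 0 < Module.finrank ℝ V := lt_of_le_of_lt (Nat.zero_le _) i.2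
  refine le_uniformBallExpectation_of_thin hdim hp.r_pos hp.sep_pos isClosed_closure ?_
    (e.norm_eq_one i)
    (closure_stuckSet_thin hg hp h0 hup he hi fun k => hmin k (Finset.mem_univ _)) ?_
  · refine closure_minimal (fun ξ hξ => ?_) Metric.isClosed_closedBall
    exact mem_closedBall_zero_iff.2 hξ.1
  · intro ξ hξ hξ'
    rw [mem_closedBall_zero_iff] at hξ
    refine hφ ξ hξ (not_lt.1 fun h => hξ' (subset_closure ⟨hξ, h⟩))

end Perturbation

/-! ### The choice of the logarithmic factor. -/

section FailureProbability

variable {p : Params}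

/-- The 24th term of the exponential series at `w / 16` leaves a spare factor `w ^ 12`, which
swallows all constants. -/
theorem pow_mul_le_two_rpow {w : ℝ} (hw : 10 ^ 9 ≤ w) : 1296 * w ^ 12 ≤ (2 : ℝ) ^ (w / 8) := by
  have h1 : (w / 16) ^ 24 / (Nat.factorial 24 : ℝ) ≤ Real.exp (w / 16) :=
    Real.pow_div_factorial_le_exp _ (by linarith) 24
  have h2 : Real.exp (w / 16) ≤ (2 : ℝ) ^ (w / 8) := by
    rw [Real.rpow_def_of_pos (by norm_num), Real.exp_le_exp]
    have := Real.log_two_gt_d9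
    nlinarith
  refine le_trans ?_ (h1.trans h2)
  rw [le_div_iff₀ (by positivity), div_pow]
  have h3 : ((10 : ℝ) ^ 9) ^ 12 ≤ w ^ 12 := pow_le_pow_left₀ (by norm_num) hw 12
  have h4 : (1296 : ℝ) * (Nat.factorial 24 : ℝ) * 16 ^ 24 ≤ w ^ 12 := by
    refine le_trans ?_ h3
    norm_num [Nat.factorial]
  rw [le_div_iff₀ (by positivity)]
  have h5 := mul_le_mul_of_nonneg_right h4 (show 0 ≤ w ^ 12 by positivity)
  calc 1296 * w ^ 12 * (Nat.factorial 24 : ℝ) * 16 ^ 24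
      = 1296 * (Nat.factorial 24 : ℝ) * 16 ^ 24 * w ^ 12 := by ring
    _ ≤ w ^ 12 * w ^ 12 := h5
    _ = w ^ 24 := by ring

namespace Params.Valid

/-- Bernoulli's inequality gives `2 ^ θ ≤ 1 + θ`, and `θ T = χ c / 4`. -/
theorem two_rpow_le_pow (hp : p.Valid) : (2 : ℝ) ^ (p.χ * p.c / 4) ≤ (1 + p.θ) ^ p.steps := by
  have hθ := hp.θ_pos
  have h1 : (2 : ℝ) ^ p.θ ≤ 1 + p.θ := by
    have := rpow_one_add_le_one_add_mul_self (s := 1) (by norm_num) hθ.le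
      (by linarith [hp.θ_le])
    norm_num at this
    linarith
  have h2 : p.χ * p.c / 4 = p.θ * p.steps := by
    rw [hp.steps_eq, hp.T_eq]; field_simp
  rw [h2, Real.rpow_mul_natCast (by norm_num)]
  exact pow_le_pow_left₀ (by positivity) h1 _

/-- The growth `(1 + θ) ^ steps ≥ 2 ^ (χ c / 4)` beats everything else. The hypothesis on `χ` bounds
both `√d` and `√d D / (64 θ³ δ)` by `X = 2 ^ χ`, hence their product by `X²`. Half of the exponent
pays for `X²`, the other half for the powers of `χ` and `c`. The target is `2 δ` divided by the
number `3 Δ / E` of occasions to fail. -/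
theorem failure_le (hp : p.Valid) {d : ℕ} (hd : 1 ≤ d) {δ Δ : ℝ} (hδ : 0 < δ) (hδ1 : δ < 1)
    (hΔ : √(p.ε ^ 3 / p.ρ) ≤ Δ)
    (hχ : Real.logb 2 ((d : ℝ) ^ (1 / 2 : ℝ) * p.ℓ ^ (3 / 2 : ℝ) * Δ /
          ((p.ρ * p.ε) ^ (1 / 4 : ℝ) * p.ε ^ 2 * δ)) ≤ p.χ) :
    3 * d * p.sep / p.r ≤ 2 * δ * p.E / (3 * Δ) := by
  have hθ := hp.θ_pos
  have hθ' := hp.θ_le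
  have hσ := hp.σ_pos
  have hlen := hp.len_pos
  have hχ0 := hp.χ_pos
  have hχ2 := hp.two_le_χ
  have hc0 := hp.c_pos
  have hc := hp.le_c
  rw [cMin] at hc
  rw [hp.sqrt_cube_div] at hΔ
  have hbig : 0 < p.σ * p.len ^ 2 := by positivity
  have hΔ0 : 0 < Δ := hbig.trans_le hΔ
  have hdpos : (0 : ℝ) < d := by exact_mod_cast hd
  set D := Δ / (p.σ * p.len ^ 2) with hD
  have hD1 : 1 ≤ D := (one_le_div hbig).2 hΔ
  have hΔD : Δ = D * (p.σ * p.len ^ 2) := by rw [hD]; field_simp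
  set q := √(d : ℝ) with hq
  have hqpos : 0 < q := Real.sqrt_pos.2 hdpos
  have hqsq : q ^ 2 = d := Real.sq_sqrt hdpos.le
  set X : ℝ := (2 : ℝ) ^ p.χ with hX
  have hXpos : 0 < X := by positivity
  have hlog : q * D / (64 * p.θ ^ 3 * δ) ≤ X := by
    have h1 : (d : ℝ) ^ (1 / 2 : ℝ) = q := (Real.sqrt_eq_rpow _).symm
    have h2 : (p.ρ * p.ε) ^ (1 / 4 : ℝ) = √p.σ := by
      rw [Real.sqrt_eq_rpow, Params.σ, Real.sqrt_eq_rpow, ← Real.rpow_mul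
        (mul_pos hp.ρ_pos hp.ε_pos).le]
      norm_num
    have h3 : p.ℓ ^ (3 / 2 : ℝ) = p.σ * √p.σ / (64 * p.θ ^ 3) := by
      have e1 : p.ℓ ^ (3 / 2 : ℝ) = √p.ℓ ^ 3 := by
        rw [Real.sqrt_eq_rpow, ← Real.rpow_mul_natCast hp.ℓ_pos.le]; norm_num
      have e2 : √p.ℓ = √p.σ / (4 * p.θ) := by
        rw [hp.ℓ_eq, Real.sqrt_div hσ.le, show 16 * p.θ ^ 2 = (4 * p.θ) ^ 2 by ring,
          Real.sqrt_sq (by positivity)]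
      have e3 : √p.σ ^ 3 = p.σ * √p.σ := by
        rw [pow_succ, Real.sq_sqrt hσ.le]
      rw [e1, e2, div_pow, e3]; ring
    have h4 : (d : ℝ) ^ (1 / 2 : ℝ) * p.ℓ ^ (3 / 2 : ℝ) * Δ /
          ((p.ρ * p.ε) ^ (1 / 4 : ℝ) * p.ε ^ 2 * δ) = q * D / (64 * p.θ ^ 3 * δ) := by
      have : 0 < √p.σ := Real.sqrt_pos.2 hσ
      rw [h1, h2, h3, hΔD, hp.ε_eq]
      field_simp
    rw [h4] at hχ
    exact (Real.logb_le_iff_le_rpow (by norm_num) (by positivity)).1 hχ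
  have hq_le : q ≤ X := by
    have h1 : q ≤ q * D / (64 * p.θ ^ 3 * δ) := by
      rw [le_div_iff₀ (by positivity)]
      refine mul_le_mul_of_nonneg_left ?_ hqpos.le
      have e1 : 64 * p.θ ^ 3 ≤ 64 * (1 / 5) ^ 3 := by gcongr
      have e2 : 64 * p.θ ^ 3 * δ ≤ 1 * 1 :=
        mul_le_mul (e1.trans (by norm_num)) hδ1.le hδ.le (by norm_num)
      linarith
    exact h1.trans hlog
  have hqD : q * D / (p.θ ^ 3 * δ) ≤ 64 * X := by
    have : q * D / (p.θ ^ 3 * δ) = 64 * (q * D / (64 * p.θ ^ 3 * δ)) := by field_simp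
    rw [this]; linarith
  set w := p.χ * p.c with hw
  have hwc : p.c ≤ w := by rw [hw]; nlinarith
  have hexp : 1296 * (p.χ ^ 8 * p.c ^ 12) * X ^ 2 ≤ (1 + p.θ) ^ p.steps := by
    refine le_trans ?_ hp.two_rpow_le_pow
    have e1 : p.χ ^ 8 * p.c ^ 12 ≤ w ^ 12 := by
      rw [hw, mul_pow]
      exact mul_le_mul_of_nonneg_right (pow_le_pow_right₀ (by linarith) (by norm_num))
        (by positivity)
    have e2 : X ^ 2 ≤ (2 : ℝ) ^ (w / 8) := by
      rw [hX, ← Real.rpow_mul_natCast (by norm_num)]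
      refine Real.rpow_le_rpow_of_exponent_le (by norm_num) ?_
      rw [hw]; push_cast; nlinarith
    have e3 := pow_mul_le_two_rpow (w := w) (by linarith)
    calc 1296 * (p.χ ^ 8 * p.c ^ 12) * X ^ 2 ≤ 1296 * w ^ 12 * (2 : ℝ) ^ (w / 8) := by gcongr
      _ ≤ (2 : ℝ) ^ (w / 8) * (2 : ℝ) ^ (w / 8) := by gcongr
      _ = (2 : ℝ) ^ (w / 4) := by
        rw [← Real.rpow_add (by norm_num)]; congr 1; ring
  set P := (1 + p.θ) ^ p.steps with hP
  have hPpos : 0 < P := by positivity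
  rw [div_le_div_iff₀ hp.r_pos (by positivity)]
  have hsep : p.sep = 9 * p.loc / (p.θ * P) := rfl
  have hlhs : 3 * d * p.sep * (3 * Δ) =
      (p.σ * p.len ^ 3 * p.χ⁻¹ ^ 10 * p.c⁻¹ ^ 15 * p.θ ^ 2 * δ) *
        (162 * (p.χ ^ 8 * p.c ^ 12) * q * (q * D / (p.θ ^ 3 * δ)) / P) := by
    rw [hsep, Params.loc, hΔD, ← hqsq]
    field_simp
    norm_num
  have hrhs : 2 * δ * p.E * p.r =
      (p.σ * p.len ^ 3 * p.χ⁻¹ ^ 10 * p.c⁻¹ ^ 15 * p.θ ^ 2 * δ) * 8 := by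
    rw [hp.E_eq, hp.r_eq]; ring
  rw [hlhs, hrhs]
  refine mul_le_mul_of_nonneg_left ?_ (by positivity)
  rw [div_le_iff₀ hPpos]
  calc 162 * (p.χ ^ 8 * p.c ^ 12) * q * (q * D / (p.θ ^ 3 * δ))
      ≤ 162 * (p.χ ^ 8 * p.c ^ 12) * X * (64 * X) := by gcongr
    _ = 8 * (1296 * (p.χ ^ 8 * p.c ^ 12) * X ^ 2) := by ring
    _ ≤ 8 * P := by linarith

end Params.Valid

end FailureProbability

theorem IsRetraction.pullback_zero {d : ℕ} {M : Type*} [TopologicalSpace M]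
    [ChartedSpace (EuclideanSpace ℝ (Fin d)) M] [IsManifold (𝓡 d) ∞ M]
    {R : TangentBundle (𝓡 d) M → M} (hR : IsRetraction R) (f : M → ℝ) (x : M) :
    pullback f R x 0 = f x := congrArg f (hR.base x)

/-! ### Complexity accounting and success probability of the main loop. -/

section MainLoop

variable {d : ℕ} {M : Type*} [TopologicalSpace M] [ChartedSpace (EuclideanSpace ℝ (Fin d)) M]
  [RiemannianBundle (fun x : M => TangentSpace (𝓡 d) x)]
  {f : M → ℝ} {p : Params} {flow : ℝ}

/-- What one pass through the main loop does if the loop goes on. -/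
structure IsStep (d : ℕ) {M : Type*} [TopologicalSpace M] [ChartedSpace (EuclideanSpace ℝ (Fin d)) M]
    [RiemannianBundle (fun x : M => TangentSpace (𝓡 d) x)]
    (p : Params) (f : M → ℝ) (st st' : State M) : Prop where
  t_le : st'.t ≤ st.t + p.steps
  grad_le : st'.cost.grad ≤ st.cost.grad +
    (if ‖riemGrad d f st.pt‖ ≤ p.ε then p.steps + 1 else 2 * p.steps + 1)
  fn_le : st'.cost.fn ≤ st.cost.fn +
    (if ‖riemGrad d f st.pt‖ ≤ p.ε then 2 * p.steps + 5 else 2 * p.steps + 3)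
  retr_le : st'.cost.retr ≤ st.cost.retr +
    (if ‖riemGrad d f st.pt‖ ≤ p.ε then 3 * p.steps + 4 else 4 * p.steps + 4)
  progress : f st'.pt ≤ f st.pt - p.E ∨
    (‖riemGrad d f st.pt‖ ≤ p.ε ∧ f st'.pt ≤ f st.pt - 1 / 2 * p.E) ∨
    (¬‖riemGrad d f st.pt‖ ≤ p.ε ∧ ‖riemGrad d f st'.pt‖ ≤ p.ε ∧ f st'.pt ≤ f st.pt)

/-- What the last pass through the main loop does. -/
structure IsHalt (d : ℕ) {M : Type*} [TopologicalSpace M] [ChartedSpace (EuclideanSpace ℝ (Fin d)) M]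
    [RiemannianBundle (fun x : M => TangentSpace (𝓡 d) x)]
    (p : Params) (f : M → ℝ) (st st' : State M) : Prop where
  pt_eq : st'.pt = st.pt
  t_eq : st'.t = st.t
  grad_le : st'.cost.grad ≤ st.cost.grad + (p.steps + 1)
  fn_le : st'.cost.fn ≤ st.cost.fn + (2 * p.steps + 5)
  retr_le : st'.cost.retr ≤ st.cost.retr + (3 * p.steps + 4)
  norm_grad_le : ‖riemGrad d f st.pt‖ ≤ p.ε

/-- Bounds on the counters in terms of the decrease of the function so far. -/
structure Invariant (d : ℕ) {M : Type*} [TopologicalSpace M]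
    [ChartedSpace (EuclideanSpace ℝ (Fin d)) M]
    [RiemannianBundle (fun x : M => TangentSpace (𝓡 d) x)]
    (p : Params) (f : M → ℝ) (x₀ : M) (st : State M) : Prop where
  value : f st.pt ≤ f x₀
  t_le : (st.t : ℝ) ≤ 4 * (p.steps * ((f x₀ - f st.pt) / p.E)) +
    (if ‖riemGrad d f st.pt‖ ≤ p.ε then (p.steps : ℝ) else 0)
  grad_le : (st.cost.grad : ℝ) ≤ 8 * (p.steps * ((f x₀ - f st.pt) / p.E)) +
    (if ‖riemGrad d f st.pt‖ ≤ p.ε then 2 * (p.steps : ℝ) + 1 else 0)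
  fn_le : (st.cost.fn : ℝ) ≤ 16 * (p.steps * ((f x₀ - f st.pt) / p.E)) +
    (if ‖riemGrad d f st.pt‖ ≤ p.ε then 2 * (p.steps : ℝ) + 3 else 0)
  retr_le : (st.cost.retr : ℝ) ≤ 24 * (p.steps * ((f x₀ - f st.pt) / p.E)) +
    (if ‖riemGrad d f st.pt‖ ≤ p.ε then 4 * (p.steps : ℝ) + 4 else 0)

theorem Invariant.init (x₀ : M) : Invariant d p f x₀ (.init x₀) := by
  have hc : (0 : Cost).grad = 0 ∧ (0 : Cost).fn = 0 ∧ (0 : Cost).retr = 0 := ⟨rfl, rfl, rfl⟩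
  refine ⟨le_rfl, ?_, ?_, ?_, ?_⟩ <;> simp only [State.init, hc] <;> split_ifs <;> simp <;>
    positivity

/-- The extra allowance at points of small gradient covers an unperturbed pass that found a nearly
critical point without decreasing `f`. The following perturbed pass then halts or gains `E / 2`,
which repays both passes. -/
theorem Invariant.next (hp : p.Valid) {x₀ : M} {st st' : State M} (hI : Invariant d p f x₀ st)
    (hs : IsStep d p f st st') : Invariant d p f x₀ st' := by
  have hE := hp.E_pos
  obtain ⟨m, hm, hsteps⟩ := hp.exists_steps
  have hT : (4 : ℝ) ≤ p.steps := by exact_mod_cast (show 4 ≤ p.steps by omega)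
  obtain ⟨i0, i1, i2, i3, i4⟩ := hI
  obtain ⟨s1, s2, s3, s4, s5⟩ := hs
  have s1' : (st'.t : ℝ) ≤ st.t + p.steps := by exact_mod_cast s1
  have s2' : (st'.cost.grad : ℝ) ≤ st.cost.grad +
    (if ‖riemGrad d f st.pt‖ ≤ p.ε then (p.steps : ℝ) + 1 else 2 * p.steps + 1) := by
    exact_mod_cast s2
  have s3' : (st'.cost.fn : ℝ) ≤ st.cost.fn +
    (if ‖riemGrad d f st.pt‖ ≤ p.ε then 2 * (p.steps : ℝ) + 5 else 2 * p.steps + 3) := by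
    exact_mod_cast s3
  have s4' : (st'.cost.retr : ℝ) ≤ st.cost.retr +
    (if ‖riemGrad d f st.pt‖ ≤ p.ε then 3 * (p.steps : ℝ) + 4 else 4 * p.steps + 4) := by
    exact_mod_cast s4
  have hT0 : (0 : ℝ) ≤ p.steps := by linarith
  have mono : ∀ {a : ℝ}, f st'.pt ≤ f st.pt - a * p.E →
      p.steps * ((f x₀ - f st.pt) / p.E) + a * p.steps ≤
        p.steps * ((f x₀ - f st'.pt) / p.E) := by
    intro a ha
    have e1 : (f x₀ - f st.pt) / p.E + a ≤ (f x₀ - f st'.pt) / p.E := by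
      rw [le_div_iff₀ hE, add_mul, div_mul_cancel₀ _ hE.ne']; linarith
    have := mul_le_mul_of_nonneg_left e1 hT0
    linarith
  set X := p.steps * ((f x₀ - f st.pt) / p.E)
  set X' := p.steps * ((f x₀ - f st'.pt) / p.E)
  rcases s5 with s5 | ⟨s5, s6⟩ | ⟨s5, s6, s7⟩
  · have hX := mono (a := 1) (by linarith)
    refine ⟨by linarith, ?_, ?_, ?_, ?_⟩ <;> split_ifs at * <;> linarith
  · have hX := mono (a := 1 / 2) (by linarith)
    rw [if_pos s5] at *
    refine ⟨by linarith, ?_, ?_, ?_, ?_⟩ <;> split_ifs at * <;> linarith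
  · have hX := mono (a := 0) (by linarith)
    rw [if_neg s5] at *
    refine ⟨by linarith, ?_, ?_, ?_, ?_⟩ <;> rw [if_pos s6] <;> linarith

theorem Invariant.halt (hp : p.Valid) (h : ∀ x, flow ≤ f x) {x₀ : M} {st st' : State M}
    (hI : Invariant d p f x₀ st) (hs : IsHalt d p f st st') :
    IsFirstOrderOutput d p f flow x₀ st' := by
  have hE := hp.E_pos
  obtain ⟨m, hm, hsteps⟩ := hp.exists_steps
  have hT : (4 : ℝ) ≤ p.steps := by exact_mod_cast (show 4 ≤ p.steps by omega)
  obtain ⟨i0, i1, i2, i3, i4⟩ := hI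
  obtain ⟨s0, s1, s2, s3, s4, s5⟩ := hs
  rw [if_pos s5] at i1 i2 i3 i4
  have hX : p.steps * ((f x₀ - f st.pt) / p.E) ≤ p.steps * ((f x₀ - flow) / p.E) := by
    have := h st.pt
    gcongr
  have s2' : (st'.cost.grad : ℝ) ≤ st.cost.grad + (p.steps + 1) := by exact_mod_cast s2
  have s3' : (st'.cost.fn : ℝ) ≤ st.cost.fn + (2 * p.steps + 5) := by exact_mod_cast s3
  have s4' : (st'.cost.retr : ℝ) ≤ st.cost.retr + (3 * p.steps + 4) := by exact_mod_cast s4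
  have hT2 : T₂ p f flow x₀ = 2 * p.steps + 4 * (p.steps * ((f x₀ - flow) / p.E)) := by
    rw [T₂, ← hp.steps_eq]; ring
  refine ⟨by rw [s0]; exact i0, by rw [s0]; exact s5, ?_, ?_, ?_, ?_⟩
  · rw [s1, hT2, ← hp.steps_eq]; linarith
  · rw [hT2]; linarith
  · rw [hT2]; linarith
  · rw [hT2]; linarith

/-- An upper bound for the number of passes through the main loop that are still to come. -/
def remaining (d : ℕ) {M : Type*} [TopologicalSpace M]
    [ChartedSpace (EuclideanSpace ℝ (Fin d)) M]
    [RiemannianBundle (fun x : M => TangentSpace (𝓡 d) x)]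
    (p : Params) (f : M → ℝ) (flow : ℝ) (st : State M) : ℝ :=
  4 * ((f st.pt - flow) / p.E) + (if ‖riemGrad d f st.pt‖ ≤ p.ε then 1 else 2)

theorem one_le_remaining (hp : p.Valid) (h : ∀ x, flow ≤ f x) (st : State M) :
    1 ≤ remaining d p f flow st := by
  have hE := hp.E_pos
  have h1 : 0 ≤ (f st.pt - flow) / p.E := div_nonneg (by linarith [h st.pt]) hE.le
  unfold remaining
  split_ifs <;> linarith

/-- A gain of `E / 2` lowers the first term by two and the second term rises by at most one. A pass
without guaranteed gain moves from a large to a small gradient and lowers the second term. -/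
theorem IsStep.remaining_le (hp : p.Valid) {st st' : State M} (hs : IsStep d p f st st') :
    remaining d p f flow st' + 1 ≤ remaining d p f flow st := by
  have hE := hp.E_pos
  have mono : ∀ {a : ℝ}, f st'.pt ≤ f st.pt - a * p.E →
      (f st'.pt - flow) / p.E + a ≤ (f st.pt - flow) / p.E := by
    intro a ha
    rw [le_div_iff₀ hE, add_mul, div_mul_cancel₀ _ hE.ne']; linarith
  unfold remaining
  rcases hs.progress with s5 | ⟨s5, s6⟩ | ⟨s5, s6, s7⟩
  · have hX := mono (a := 1) (by linarith)
    split_ifs <;> linarith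
  · have hX := mono (a := 1 / 2) (by linarith)
    split_ifs <;> linarith
  · have hX := mono (a := 0) (by linarith)
    rw [if_pos s6, if_neg s5]
    linarith

theorem IsStep.value_le (hp : p.Valid) {st st' : State M} (hs : IsStep d p f st st') :
    f st'.pt ≤ f st.pt := by
  have hE := hp.E_pos
  rcases hs.progress with s5 | ⟨s5, s6⟩ | ⟨s5, s6, s7⟩ <;> linarith

variable [IsManifold (𝓡 d) ∞ M] {R : TangentBundle (𝓡 d) M → M}

theorem RegularPullbacks.regularModel (h : RegularPullbacks f R flow p.ℓ p.ρ p.b)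
    (hR : IsRetraction R) {x : M} (hx : ‖riemGrad d f x‖ ≤ 1 / 2 * p.ℓ * p.b) :
    RegularModel p (pullback f R x) where
  contDiff := hR.contDiff_pullback h.contMDiff x
  grad_zero := by rwa [hR.euclGrad_pullback_zero h.contMDiff]
  grad_lipschitz := h.grad_lipschitz x hx
  hess_lipschitz := h.hess_lipschitz x hx

/-- Decrease in a Riemannian gradient step. -/
theorem RegularPullbacks.gradient_step_le (h : RegularPullbacks f R flow p.ℓ p.ρ p.b)
    (hR : IsRetraction R) (hp : p.Valid) {x : M} (hx : 2 * p.ℓ * p.M < ‖riemGrad d f x‖) :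
    f (R ⟨x, -(p.η • riemGrad d f x)⟩) ≤ f x - p.E := by
  have h1 := h.upper_bound x (-(p.η • riemGrad d f x))
  rw [hR.pullback_zero, hR.euclGrad_pullback_zero h.contMDiff, inner_neg_right,
    inner_smul_right, real_inner_self_eq_norm_sq, norm_neg, norm_smul, mul_pow,
    Real.norm_of_nonneg hp.η_pos.le] at h1
  change f (R ⟨x, -(p.η • riemGrad d f x)⟩) ≤ _ at h1
  set G := ‖riemGrad d f x‖
  have hη := hp.η_pos
  have hθ := hp.θ_pos
  have hσ := hp.σ_pos
  have hlen := hp.len_pos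
  have hχ := hp.inv_χ_pos
  have hc := hp.inv_c_pos
  have h2 : p.ℓ / 2 * (p.η ^ 2 * G ^ 2) = 1 / 8 * (p.η * G ^ 2) := by
    have : p.ℓ / 2 * (p.η ^ 2 * G ^ 2) = p.η * p.ℓ / 2 * (p.η * G ^ 2) := by ring
    rw [this, hp.η_mul_ℓ]; ring
  rw [hp.two_ℓ_M_eq] at hx
  have h3 : (p.σ * p.len * p.c⁻¹ / (2 * p.θ)) ^ 2 ≤ G ^ 2 := by gcongr
  have h4 : p.η * (p.σ * p.len * p.c⁻¹ / (2 * p.θ)) ^ 2 = p.σ * p.len ^ 2 * p.c⁻¹ ^ 2 := by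
    rw [hp.η_eq]; field_simp; norm_num
  have h5 := mul_le_mul_of_nonneg_left h3 hη.le
  rw [h4] at h5
  have h6 : p.E ≤ 1 / 2 * (p.σ * p.len ^ 2 * p.c⁻¹ ^ 2) := by
    rw [hp.E_eq]
    have e1 := hp.inv_χ_le
    have e2 := hp.inv_c_le
    have e3 : p.χ⁻¹ ^ 5 * p.c⁻¹ ^ 5 ≤ (1 / 2) ^ 5 * (1 / 10 ^ 9) ^ 5 := by gcongr
    have e4 : p.χ⁻¹ ^ 5 * p.c⁻¹ ^ 5 ≤ 1 / 2 := e3.trans (by norm_num)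
    calc p.σ * p.len ^ 2 * p.χ⁻¹ ^ 5 * p.c⁻¹ ^ 7
        = p.χ⁻¹ ^ 5 * p.c⁻¹ ^ 5 * (p.σ * p.len ^ 2 * p.c⁻¹ ^ 2) := by ring
      _ ≤ _ := mul_le_mul_of_nonneg_right e4 (by positivity)
  have h7 : 0 ≤ p.σ * p.len ^ 2 * p.c⁻¹ ^ 2 := by positivity
  linarith

theorem cost_add (k k' : Cost) : (k + k').grad = k.grad + k'.grad ∧ (k + k').fn = k.fn + k'.fn ∧
    (k + k').retr = k.retr + k'.retr := ⟨rfl, rfl, rfl⟩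

theorem step_spec (h : RegularPullbacks f R flow p.ℓ p.ρ p.b) (hR : IsRetraction R)
    (hp : p.Valid) (st : State M) (ξ : TangentSpace (𝓡 d) st.pt) :
    (∃ st', step p f R st ξ = .next st' ∧ IsStep d p f st st') ∨
      (∃ st', step p f R st ξ = .halt st' ∧ IsHalt d p f st st') := by
  obtain ⟨m, hm, hsteps⟩ := hp.exists_steps
  have hT : 4 ≤ p.steps := by omega
  have hg0 : (Cost.gradAt).grad = 1 ∧ (Cost.gradAt).fn = 0 ∧ (Cost.gradAt).retr = 0 :=
    ⟨rfl, rfl, rfl⟩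
  have hf0 : (Cost.fnAt).grad = 0 ∧ (Cost.fnAt).fn = 1 ∧ (Cost.fnAt).retr = 0 := ⟨rfl, rfl, rfl⟩
  have hr0 : (Cost.retraction).grad = 0 ∧ (Cost.retraction).fn = 0 ∧ (Cost.retraction).retr = 1 :=
    ⟨rfl, rfl, rfl⟩
  unfold step
  simp only
  split_ifs with h1 h2 h3
  · left
    refine ⟨_, rfl, ?_, ?_, ?_, ?_, Or.inl (h.gradient_step_le hR hp h1)⟩
    · simp only; omega
    · simp only [cost_add, hg0, hr0]; split_ifs <;> omega
    · simp only [cost_add, hg0, hr0]; split_ifs <;> omega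
    · simp only [cost_add, hg0, hr0]; split_ifs <;> omega
  · left
    rw [not_lt] at h1
    have hx := h1.trans hp.two_ℓ_M_le
    have hg := h.regularModel hR hx
    obtain ⟨c1, c2, c3⟩ := tssLoop_cost_le p (pullback f R st.pt) false p.steps 0 0
    have hd := tss_none_decrease hg hp (by rwa [hR.euclGrad_pullback_zero h.contMDiff])
    rw [hR.pullback_zero] at hd
    refine ⟨_, rfl, ?_, ?_, ?_, ?_, ?_⟩
    · simp only; omega
    · rw [if_neg (not_le.2 h2)]
      simp only [cost_add, hg0, hr0, tss]
      simp only [Bool.false_eq_true, if_false] at c1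
      omega
    · rw [if_neg (not_le.2 h2)]
      simp only [cost_add, hg0, hr0, tss]
      omega
    · rw [if_neg (not_le.2 h2)]
      simp only [cost_add, hg0, hr0, tss]
      simp only [Bool.false_eq_true, if_false] at c3
      omega
    · rcases hd with hd | ⟨d1, d2, d3⟩
      · exact Or.inl hd
      · refine Or.inr (Or.inr ⟨not_le.2 h2, ?_, d2⟩)
        have hb := hp.b_pos
        -- The singular value bound turns `ε / 2` in the tangent space into `ε` on the manifold, so
        -- the next pass is perturbed.
        have e1 := hR.norm_riemGrad_le h.contMDiff st.pt _ (h.sigma_min st.pt hx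
          (tss p (pullback f R st.pt) none).1 (mem_closedBall_zero_iff.2 (by linarith)))
        refine e1.trans ?_
        linarith
  · right
    rw [not_lt] at h2
    obtain ⟨c1, c2, c3⟩ := tssLoop_cost_le p (pullback f R st.pt) true p.steps ξ 0
    simp only [if_true] at c1 c3
    refine ⟨_, rfl, rfl, rfl, ?_, ?_, ?_, h2⟩
    all_goals
      simp only [cost_add, hg0, hr0, hf0, tss]
      omega
  · left
    rw [not_lt] at h2 h3
    obtain ⟨c1, c2, c3⟩ := tssLoop_cost_le p (pullback f R st.pt) true p.steps ξ 0
    simp only [if_true] at c1 c3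
    refine ⟨_, rfl, ?_, ?_, ?_, ?_, Or.inr (Or.inl ⟨h2, ?_⟩)⟩
    · simp only; omega
    · rw [if_pos h2]
      simp only [cost_add, hg0, hr0, hf0, tss]
      omega
    · rw [if_pos h2]
      simp only [cost_add, hg0, hr0, hf0, tss]
      omega
    · rw [if_pos h2]
      simp only [cost_add, hg0, hr0, hf0, tss]
      omega
    · simp only
      linarith

/-- For every realization of the perturbations the algorithm returns. -/
theorem exists_run_eq_halt (h : RegularPullbacks f R flow p.ℓ p.ρ p.b) (hR : IsRetraction R)
    (hp : p.Valid) (x₀ : M) (pert : ℕ → (x : M) → TangentSpace (𝓡 d) x) :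
    ∃ (n : ℕ) (st : State M), run p f R x₀ pert n = .halt st ∧
      IsFirstOrderOutput d p f flow x₀ st := by
  have key : ∀ n : ℕ, (∃ st, run p f R x₀ pert n = .halt st ∧
      IsFirstOrderOutput d p f flow x₀ st) ∨
      ∃ st, run p f R x₀ pert n = .next st ∧ Invariant d p f x₀ st ∧
        remaining d p f flow st + n ≤ remaining d p f flow (.init x₀) := by
    intro n
    induction n with
    | zero => exact Or.inr ⟨_, rfl, .init x₀, by simp⟩
    | succ n ih =>
      rcases ih with ⟨st, hst, hQ⟩ | ⟨st, hst, hI, hrem⟩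
      · left
        exact ⟨st, by simp only [run, hst], hQ⟩
      · have hrun : run p f R x₀ pert (n + 1) = step p f R st (pert n st.pt) := by
          simp only [run, hst]
        rcases step_spec h hR hp st (pert n st.pt) with ⟨st', h1, h2⟩ | ⟨st', h1, h2⟩
        · right
          refine ⟨st', hrun.trans h1, hI.next hp h2, ?_⟩
          have := h2.remaining_le (flow := flow) hp
          push_cast
          linarith
        · left
          exact ⟨st', hrun.trans h1, hI.halt hp h.lower_bound h2⟩
  obtain ⟨n, hn⟩ := exists_nat_gt (remaining d p f flow (.init x₀))
  rcases key n with ⟨st, h1, h2⟩ | ⟨st, h1, h2, h3⟩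
  · exact ⟨n, st, h1, h2⟩
  · have := one_le_remaining hp h.lower_bound st (d := d)
    linarith

/-- Lower bound for the probability of returning an approximate second-order point. -/
theorem le_returnProb (h : RegularPullbacks f R flow p.ℓ p.ρ p.b) (hR : IsRetraction R)
    (hp : p.Valid) (x₀ : M) {δ₀ : ℝ} (hδ₀ : 3 * d * p.sep / p.r ≤ δ₀) (n : ℕ) (st : State M)
    (hI : Invariant d p f x₀ st) (hrem : remaining d p f flow st ≤ n) :
    ENNReal.ofReal (1 - δ₀ * (1 + 2 * ((f st.pt - flow) / p.E))) ≤
      returnProb p f R (fun st => IsFirstOrderOutput d p f flow x₀ st ∧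
              IsSecondOrderOutput p f R st) n st := by
  have hE := hp.E_pos
  have hδ' : 0 ≤ 3 * d * p.sep / p.r := by
    have := hp.sep_pos
    have := hp.r_pos
    positivity
  have hδ0 : 0 ≤ δ₀ := hδ'.trans hδ₀
  induction n generalizing st with
  | zero =>
    have := one_le_remaining hp h.lower_bound st (d := d)
    rw [Nat.cast_zero] at hrem
    linarith
  | succ n ih =>
    have hnext : ∀ st', IsStep d p f st st' →
        ENNReal.ofReal (1 - δ₀ * (1 + 2 * ((f st'.pt - flow) / p.E))) ≤
          returnProb p f R (fun st => IsFirstOrderOutput d p f flow x₀ st ∧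
              IsSecondOrderOutput p f R st) n st' := by
      intro st' hs
      refine ih st' (hI.next hp hs) ?_
      have := hs.remaining_le (flow := flow) hp
      push_cast at hrem
      linarith
    have hmono : ∀ st' : State M, f st'.pt ≤ f st.pt →
        ENNReal.ofReal (1 - δ₀ * (1 + 2 * ((f st.pt - flow) / p.E))) ≤
          ENNReal.ofReal (1 - δ₀ * (1 + 2 * ((f st'.pt - flow) / p.E))) := by
      intro st' hle
      refine ENNReal.ofReal_le_ofReal ?_
      have : δ₀ * (1 + 2 * ((f st'.pt - flow) / p.E)) ≤ δ₀ * (1 + 2 * ((f st.pt - flow) / p.E)) := by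
        gcongr
      linarith
    have hval : 0 ≤ (f st.pt - flow) / p.E :=
      div_nonneg (by linarith [h.lower_bound st.pt]) hE.le
    rw [returnProb]
    -- If the current point is already good or the pass is unperturbed, every outcome is acceptable
    -- and no probability is lost.
    by_cases hcase : IsSecondOrderOutput p f R st ∨ ¬‖riemGrad d f st.pt‖ ≤ p.ε
    · refine le_uniformBallExpectation hp.r_pos fun ξ _ => ?_
      rcases step_spec h hR hp st ξ with ⟨st', h1, h2⟩ | ⟨st', h1, h2⟩
      · rw [h1]
        exact (hmono st' (h2.value_le hp)).trans (hnext st' h2)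
      · rw [h1]
        have hsec : IsSecondOrderOutput p f R st' := by
          have := hcase.resolve_right (not_not.2 h2.norm_grad_le)
          unfold IsSecondOrderOutput at this ⊢
          rwa [h2.pt_eq]
        simp only
        rw [if_pos ⟨hI.halt hp h.lower_bound h2, hsec⟩]
        refine ENNReal.ofReal_le_one.2 ?_
        have : 0 ≤ δ₀ * (1 + 2 * ((f st.pt - flow) / p.E)) := by positivity
        linarith
    · push Not at hcase
      obtain ⟨hsec, hgrad⟩ := hcase
      unfold IsSecondOrderOutput at hsec
      push Not at hsec
      obtain ⟨μ, hμ, hμσ⟩ := hsec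
      have hx := hgrad.trans hp.ε_le_half_ℓ_b
      have h0 : ‖euclGrad (pullback f R st.pt) 0‖ ≤ p.ε := by
        rwa [hR.euclGrad_pullback_zero h.contMDiff]
      -- At a bad saddle a fraction of at most `δ₀` of the perturbations is lost. The others
      -- continue from a value lower by `E / 2`, so one unit fewer is charged for what follows, and
      -- `(1 - a)(1 - δ₀) ≥ 1 - a - δ₀` closes the induction.
      refine le_trans ?_ (le_uniformBallExpectation_of_saddle (h.regularModel hR hx) hp h0
        (h.upper_bound st.pt) hμ hμσ
        (m := ENNReal.ofReal (1 - δ₀ * (2 * ((f st.pt - flow) / p.E)))) ?_)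
      · have hfin : Module.finrank ℝ (TangentSpace (𝓡 d) st.pt) = d :=
          finrank_euclideanSpace_fin (𝕜 := ℝ) (n := d)
        rw [hfin, ← ENNReal.ofReal_one, ← ENNReal.ofReal_sub _ hδ']
        set a := δ₀ * (2 * ((f st.pt - flow) / p.E)) with ha
        have ha0 : 0 ≤ a := by positivity
        have e1 : 1 - δ₀ * (1 + 2 * ((f st.pt - flow) / p.E)) = 1 - a - δ₀ := by rw [ha]; ring
        rw [e1]
        rcases le_or_gt (1 - a) 0 with h1 | h1
        · rw [ENNReal.ofReal_of_nonpos (by linarith)]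
          exact zero_le
        · rw [← ENNReal.ofReal_mul h1.le]
          refine ENNReal.ofReal_le_ofReal ?_
          have e2 := mul_le_mul_of_nonneg_left hδ₀ h1.le
          have e3 := mul_nonneg ha0 hδ0
          linarith
      · intro ξ hξ hdrop
        rw [hR.pullback_zero] at hdrop
        rcases step_spec h hR hp st ξ with ⟨st', h1, h2⟩ | ⟨st', h1, h2⟩
        · simp only [h1]
          refine le_trans (ENNReal.ofReal_le_ofReal ?_) (hnext st' h2)
          have hdec : f st'.pt ≤ f st.pt - 1 / 2 * p.E := by
            rcases h2.progress with s5 | ⟨s5, s6⟩ | ⟨s5, s6, s7⟩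
            · linarith
            · exact s6
            · exact absurd hgrad s5
          have e1 : 1 + 2 * ((f st'.pt - flow) / p.E) ≤ 2 * ((f st.pt - flow) / p.E) := by
            have : (f st'.pt - flow) / p.E + 1 / 2 ≤ (f st.pt - flow) / p.E := by
              rw [le_div_iff₀ hE, add_mul, div_mul_cancel₀ _ hE.ne']; linarith
            linarith
          have := mul_le_mul_of_nonneg_left e1 hδ0
          linarith
        · exfalso
          unfold step at h1
          simp only at h1
          split_ifs at h1 with h3 h4 h5
          exact absurd hdrop (not_le.2 h5)

end MainLoop

end PTAGD

end

theorem mainTheorem5 :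
    ∃ c₀ : ℝ, 0 < c₀ ∧
      ∀ (d : ℕ) (_ : 1 ≤ d) (M : Type*) [TopologicalSpace M]
        [ChartedSpace (EuclideanSpace ℝ (Fin d)) M] [IsManifold (𝓡 d) ∞ M]
        [RiemannianBundle (fun x : M => TangentSpace (𝓡 d) x)]
        [IsContMDiffRiemannianBundle (𝓡 d) ∞ (EuclideanSpace ℝ (Fin d))
          (fun x : M => TangentSpace (𝓡 d) x)]
        (f : M → ℝ) (R : TangentBundle (𝓡 d) M → M) (x₀ : M)
        (p : PTAGD.Params) (flow δ Δ : ℝ),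
        PTAGD.IsRetraction R →
        0 < p.b → 0 < p.ρ → PTAGD.RegularPullbacks f R flow p.ℓ p.ρ p.b →
        0 < p.ε → √(p.ρ * p.ε) ≤ 1 / 2 * p.ℓ → p.ε ≤ p.b ^ 2 * p.ρ →
        0 < δ → δ < 1 →
        max (f x₀ - flow) (√(p.ε ^ 3 / p.ρ)) ≤ Δ →
        c₀ ≤ p.c →
        Real.logb 2 ((d : ℝ) ^ (1 / 2 : ℝ) * p.ℓ ^ (3 / 2 : ℝ) * Δ /
          ((p.ρ * p.ε) ^ (1 / 4 : ℝ) * p.ε ^ 2 * δ)) ≤ p.χ →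
        Real.logb 2 (p.θ⁻¹) ≤ p.χ →
        (∃ m : ℕ, 0 < m ∧ p.T = 4 * m) →
        (∀ pert : ℕ → (x : M) → TangentSpace (𝓡 d) x, (∀ n x, ‖pert n x‖ ≤ p.r) →
          ∃ (n : ℕ) (st : PTAGD.State M),
            PTAGD.run p f R x₀ pert n = .halt st ∧
            PTAGD.IsFirstOrderOutput d p f flow x₀ st) ∧
        ENNReal.ofReal (1 - 2 * δ) ≤
          PTAGD.successProb p f R
            (fun st => PTAGD.IsFirstOrderOutput d p f flow x₀ st ∧
              PTAGD.IsSecondOrderOutput p f R st) x₀ := by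
  refine ⟨PTAGD.cMin, by norm_num [PTAGD.cMin], ?_⟩
  intro d hd M _ _ _ _ _ f R x₀ p flow δ Δ hR hb hρ h hε hℓ hεb hδ hδ1 hΔ hc hχ hθ hT
  have hp : p.Valid := ⟨hε, hρ, hb, hℓ, hεb, hc, hθ, hT⟩
  refine ⟨fun pert _ => PTAGD.exists_run_eq_halt h hR hp x₀ pert, ?_⟩
  obtain ⟨hΔ1, hΔ2⟩ := max_le_iff.1 hΔ
  have hfail := hp.failure_le hd hδ hδ1 hΔ2 hχ
  obtain ⟨n, hn⟩ := exists_nat_ge (PTAGD.remaining d p f flow (.init x₀))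
  have h1 := PTAGD.le_returnProb h hR hp x₀ hfail n (.init x₀) (.init x₀) hn
  refine le_trans ?_ (h1.trans (le_iSup (fun n => PTAGD.returnProb p f R
    (fun st => PTAGD.IsFirstOrderOutput d p f flow x₀ st ∧ PTAGD.IsSecondOrderOutput p f R st)
    n (.init x₀)) n))
  refine ENNReal.ofReal_le_ofReal ?_
  have hE := hp.E_pos
  have hσ := hp.σ_pos
  have hlen := hp.len_pos
  have hEΔ : p.E ≤ Δ := by
    refine hp.E_le.trans (le_trans ?_ hΔ2)
    rw [hp.sqrt_cube_div]
    have : 0 < p.σ * p.len ^ 2 := by positivity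
    linarith
  have hΔ0 : 0 < Δ := hE.trans_le hEΔ
  -- Both bounds on `Δ` enter: `E ≤ Δ` absorbs the summand `1`, and `f x₀ - flow ≤ Δ` the rest.
  have h2 : 1 + 2 * ((f x₀ - flow) / p.E) ≤ 3 * Δ / p.E := by
    rw [le_div_iff₀ hE, add_mul, mul_assoc, div_mul_cancel₀ _ hE.ne']
    linarith
  have h3 : 2 * δ * p.E / (3 * Δ) * (1 + 2 * ((f x₀ - flow) / p.E)) ≤
      2 * δ * p.E / (3 * Δ) * (3 * Δ / p.E) := mul_le_mul_of_nonneg_left h2 (by positivity)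
  have h4 : 2 * δ * p.E / (3 * Δ) * (3 * Δ / p.E) = 2 * δ := by field_simp
  simp only [PTAGD.State.init]
  linarith
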